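/- Let $d\ge 1$ and let $\kappa$ be a bounded, Lebesgue-almost everywhere continuous probability density on $\mathbb R^d$. Let $\mathcal M$ be a measurable space (the mark space) with a probability measure $Q$, and let $\Xi((x,t);\mathcal X)$ be a measurable real functional of finite sets $\mathcal X\subset\mathbb R^d\times\mathcal M$ of marked points with distinct locations and of marked points $(x,t)\in\mathcal X$. For $(x,t)\notin\mathcal X$ write $\Xi((x,t);\mathcal X)$ for $\Xi((x,t);\mathcal X\cup\{(x,t)\})$. If $T(x)$, $x\in\mathbb R^d$, are independent marks with law $Q$, write $\xi(x;\mathcal X)$ for the value of $\Xi$ at $x\in\mathcal X\subset\mathbb R^d$ when each $y\in\mathcal X$ carries the mark $T(y)$ (if $\mathcal M$ has one point, $\xi$ is an arbitrary deterministic functional of finite point sets). For $\lambda>0$ put $\xi_\lambda(x;\mathcal X)=\xi(\lambda^{1/d}x;\lambda^{1/d}\mathcal X)$, where marks are kept under the scaling, and let $\mathcal P_{\lambda\kappa}$ be a Poisson point process on $\mathbb R^d$ with intensity $\lambda\kappa$, independent of the marks. Assume $(*)$: * $\Xi$ is bounded, and translation invariant (shifting all locations and keeping the marks does not change its value); * $\xi$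 is strongly exponentially stabilizing: there are constants $L,\alpha,B_0,\lambda_0>0$ such that for all $\lambda\ge\lambda_0$, all finite $\mathcal Z\subset\mathbb R^d$ and all $x\in\mathbb R^d\setminus\mathcal Z$ there is a random variable $R>0$ (a function of the marked process, the mark of $x$ and the marks of $\mathcal Z$) such that, almost surely, for every finite $\mathcal Y\subset\mathbb R^d\setminus B_R(x)$ the value $\xi_\lambda\bigl(x;(\mathcal P_{\lambda\kappa}\cap B_R(x))\cup\mathcal Y\cup\mathcal Z\bigr)$ does not depend on $\mathcal Y$ (for almost all marks of the points of $\mathcal Y\setminus\mathcal Z$), and $\mathbb P(R\ge t)\le L B_0^{|\mathcal Z|}\exp(-\alpha\lambda^{1/d}t)$ for all $t\ge0$. Here $B_R(x)$ is the closed Euclidean ball. Let $\mu^\xi_{\lambda\kappa}=\sum_{x\in\mathcal P_{\lambda\kappa}}\xi_\lambda(x;\mathcal P_{\lambda\kappa})\,\delta_x$. For a finite set $L$, its moment measure $M^L_\lambda$ is the signed measure on $(\mathbb R^d)^L$ with $M^L_\lambda\bigl(\prod_{i\in L}A_i\bigr)=\mathbb E\prod_{i\in L}\mu^\xi_{\lambda\kappa}(A_i)$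 for all Borel sets $A_i$, and its $k$-th cumulant measure is the signed measure $$c^k_\lambda=\sum_{\{L_1,\dots,L_p\}}(-1)^{p-1}(p-1)!\,M^{L_1}_\lambda\cdots M^{L_p}_\lambda$$ on $(\mathbb R^d)^k$, where the sum is over all partitions of $\{1,\dots,k\}$ into non-empty sets and the products are product measures. Then there are constants $A,B<\infty$, depending only on $\xi$ and $\kappa$ (and $d$), such that for all $k\ge2$ and all $\lambda>0$ the cumulant measure $c^k_\lambda$ exists and, for all bounded measurable $F:(\mathbb R^d)^k\to\mathbb R$, $$\Bigl|\int F\,dc^k_\lambda\Bigr|\le A\,B^k\,\|F\|_\infty\,(k!)^{d+2}\,\lambda,$$ where $\|F\|_\infty=\sup|F|$. -/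

import Mathlib

open MeasureTheory Set
open scoped ENNReal Nat

noncomputable section

open scoped Classical in
/-- The law of a Poisson point process on `X` with finite intensity measure `Λ`. A realization
`⟨n, q⟩` consists of the number `n` of points and of an enumeration `q` of them; the law is
`∑ₙ e^{-Λ(X)} / n! • Λ^{⊗ n}`, i.e. the number of points is Poisson distributed with mean `Λ(X)`
and, given their number, the points are independent with common law `Λ / Λ(X)`. -/
def poissonProcessLaw {X : Type*} [MeasurableSpace X] (Λ : Measure X) :
    Measure (Σ n : ℕ, (Fin n → X)) :=
  Measure.sum fun n : ℕ =>
    ENNReal.ofReal (Real.exp (-(Λ univ).toReal) / (n ! : ℝ)) •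
      (Measure.pi fun _ : Fin n => Λ).map (Sigma.mk n)

namespace Stabilizing

/-- The Euclidean space `ℝ^d`. -/
abbrev Space (d : ℕ) : Type := EuclideanSpace ℝ (Fin d)

/-- A point of `ℝ^d` with a mark in the mark space `M`. -/
abbrev MPoint (d : ℕ) (M : Type*) : Type _ := Space d × M

/-- Realizations of a finite marked point process (see `poissonProcessLaw`). -/
abbrev Config (d : ℕ) (M : Type*) : Type _ := Σ n : ℕ, (Fin n → MPoint d M)

/-- A marked configuration: a finite set of marked points with pairwise distinct locations, that
is, a finite set of points of `ℝ^d`, each of which carries one mark. -/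
def IsConfig {d : ℕ} {M : Type*} (X : Finset (MPoint d M)) : Prop :=
  Set.InjOn Prod.fst (X : Set (MPoint d M))

/-- A marked geometric functional `Ξ ((x, t); X)`. Only the values at marked configurations `X`
and marked points `(x, t) ∈ X` matter. An unmarked (deterministic) functional is the case of a
one-point mark space. -/
abbrev Functional (d : ℕ) (M : Type*) : Type _ := MPoint d M → Finset (MPoint d M) → ℝ

section

variable {d : ℕ} {M : Type*}

open scoped Classical in
/-- Measurability of a functional: for every `n` it is measurable as a function of `n + 1` marked
points with distinct locations, the first of which is the distinguished one. -/
def Functional.IsMeasurable [MeasurableSpace M] (Ξ : Functional d M) : Prop :=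
  ∀ n : ℕ, Measurable
    fun q : {q : Fin (n + 1) → MPoint d M // Function.Injective fun i => (q i).1} =>
      Ξ (q.1 0) (Finset.univ.image q.1)

/-- Boundedness: `|Ξ| ≤ C` for some finite constant `C`. -/
def Functional.IsBounded (Ξ : Functional d M) : Prop :=
  ∃ C : ℝ, ∀ X : Finset (MPoint d M), IsConfig X → ∀ p ∈ X, |Ξ p X| ≤ C

open scoped Classical in
/-- Translation invariance: shifting all locations, and keeping the marks, does not change `Ξ`. -/
def Functional.IsTranslationInvariant (Ξ : Functional d M) : Prop :=
  ∀ X : Finset (MPoint d M), IsConfig X → ∀ p ∈ X, ∀ y : Space d,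
    Ξ p X = Ξ (p.1 - y, p.2) (X.image fun q => (q.1 - y, q.2))

open scoped Classical in
/-- The rescaled functional `Ξ_λ ((x, t); X) = Ξ ((λ^{1/d} x, t); λ^{1/d} X)`. -/
def Functional.rescale (Ξ : Functional d M) (lam : ℝ) : Functional d M := fun p X =>
  Ξ (lam ^ (1 / (d : ℝ)) • p.1, p.2) (X.image fun q => (lam ^ (1 / (d : ℝ)) • q.1, q.2))

open scoped Classical in
/-- The finite set `Y` of points of `ℝ^d`, with the marks `τ`. -/
def mark (Y : Finset (Space d)) (τ : Y → M) : Finset (MPoint d M) :=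
  Finset.univ.image fun y : Y => ((y : Space d), τ y)

open scoped Classical in
/-- The set of marked points of a realization. -/
def points (ω : Config d M) : Finset (MPoint d M) := Finset.univ.image ω.2

/-- The random measure `∑_{x ∈ P} ξ (x; P) δ_x`, for the realization `ω` of the process `P`. -/
def randomMeasure (ζ : Functional d M) (ω : Config d M) : SignedMeasure (Space d) :=
  ∑ p ∈ points ω, ζ p (points ω) • (Measure.dirac p.1).toSignedMeasure

variable [MeasurableSpace M]

/-- The law of the Poisson process on `ℝ^d` with intensity `λ κ` (with respect to Lebesgue
measure), the points of which carry independent marks with law `Q`, independent of the process: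
the Poisson process on `ℝ^d × M` with intensity `λ κ(x) dx ⊗ Q`. -/
def markedPoissonLaw (κ : Space d → ℝ) (Q : Measure M) (lam : ℝ) : Measure (Config d M) :=
  poissonProcessLaw
    ((volume.withDensity fun x : Space d => ENNReal.ofReal (lam * κ x)).prod Q)

open scoped Classical in
/-- `R` is a radius of stabilization at the marked point `p` with respect to the configuration `X`
of the functional `(x, X) ↦ ζ (x; X ∪ Z)`, where `Z` is a fixed finite set of marked points:
`ζ (x; (X ∩ B_R(x)) ∪ Y ∪ Z)` does not depend on the finite set `Y ⊆ ℝ^d \ B_R(x)`, almost surely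
with respect to the independent marks of the points of `Y`. (As points of `Z` already have their
marks, one can take `Y` disjoint from the set of locations of `Z`.) -/
def IsStabilizationRadius (ζ : Functional d M) (Q : Measure M) (p : MPoint d M)
    (Z X : Finset (MPoint d M)) (R : ℝ) : Prop :=
  0 < R ∧ ∀ Y : Finset (Space d),
    (∀ y ∈ Y, y ∉ Metric.closedBall p.1 R ∧ y ∉ Z.image Prod.fst) →
      ∀ᵐ τ ∂(Measure.pi fun _ : Y => Q),
        ζ p (insert p (X.filter (fun q => q.1 ∈ Metric.closedBall p.1 R) ∪ mark Y τ ∪ Z)) =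
          ζ p (insert p (X.filter (fun q => q.1 ∈ Metric.closedBall p.1 R) ∪ Z))

/-- Strong exponential stabilization: for some constants `L`, `α`, `B`, `λ₀`, all `λ ≥ λ₀`, all
finite `Z ⊆ ℝ^d` and all `x ∈ ℝ^d \ Z`, the functional `(x, X) ↦ ξ_λ (x; X ∪ Z)` has at `x`, with
respect to the Poisson process of intensity `λ κ`, an almost sure radius of stabilization `R` with
`P (R ≥ t) ≤ L B^|Z| exp (- α λ^{1/d} t)` for all `t ≥ 0`. The probability space carries the marked
Poisson process `ω.1`, the mark `ω.2.1` of `x` and the marks `ω.2.2` of the points of `Z`, all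
independent. -/
def StronglyExpStabilizing (κ : Space d → ℝ) (Q : Measure M) (Ξ : Functional d M) : Prop :=
  ∃ L α B lam₀ : ℝ, 0 < L ∧ 0 < α ∧ 0 < B ∧ 0 < lam₀ ∧
    ∀ lam : ℝ, lam₀ ≤ lam → ∀ (Z : Finset (Space d)) (x : Space d), x ∉ Z →
      ∃ R : Config d M × M × (Z → M) → ℝ, Measurable R ∧
        (∀ᵐ ω ∂((markedPoissonLaw κ Q lam).prod (Q.prod (Measure.pi fun _ : Z => Q))),
          IsStabilizationRadius (Ξ.rescale lam) Q (x, ω.2.1) (mark Z ω.2.2) (points ω.1) (R ω)) ∧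
        ∀ t : ℝ, 0 ≤ t →
          ((markedPoissonLaw κ Q lam).prod (Q.prod (Measure.pi fun _ : Z => Q))).real
              {ω | t ≤ R ω} ≤
            L * B ^ Z.card * Real.exp (-(α * lam ^ (1 / (d : ℝ)) * t))

/-- `κ` is a bounded, Lebesgue-almost everywhere continuous probability density on `ℝ^d`. -/
structure IsGoodDensity (κ : Space d → ℝ) : Prop where
  measurable : Measurable κ
  nonneg : ∀ x, 0 ≤ κ x
  lintegral_eq_one : ∫⁻ x, ENNReal.ofReal (κ x) = 1
  bounded : ∃ K : ℝ, ∀ x, κ x ≤ K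
  ae_continuousAt : ∀ᵐ x, ContinuousAt κ x

/-- The standing assumptions on the density `κ` and on the functional `ξ` that is given by the
marked functional `Ξ` and by independent marks with law `Q`. -/
structure Assumptions (κ : Space d → ℝ) (Q : Measure M) (Ξ : Functional d M) : Prop where
  density : IsGoodDensity κ
  measurable : Ξ.IsMeasurable
  translationInvariant : Ξ.IsTranslationInvariant
  bounded : Ξ.IsBounded
  stabilizing : StronglyExpStabilizing κ Q Ξ

end

section

variable {Ω E : Type*} [MeasurableSpace Ω] [MeasurableSpace E]

/-- `m` is the moment measure on `E^ι` of the random signed measure `ν`: it satisfies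
`m (∏ A_i) = 𝔼 [∏ ν (A_i)]` for measurable `A_i`, where the expectations exist. -/
def IsMomentMeasure (ν : Ω → SignedMeasure E) (P : Measure Ω) {ι : Type*} [Fintype ι]
    (m : SignedMeasure (ι → E)) : Prop :=
  ∀ A : ι → Set E, (∀ i, MeasurableSet (A i)) →
    Integrable (fun ω => ∏ i, ν ω (A i)) P ∧ m (univ.pi A) = ∫ ω, ∏ i, ν ω (A i) ∂P

/-- `c` is the `k`-th cumulant measure of the random signed measure `ν`: all moment measures
`m^L` on `E^L`, `L ⊆ {1, …, k}`, exist, and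
`c = ∑_{L_1, …, L_p} (-1)^{p-1} (p-1)! m^{L_1} ⋯ m^{L_p}`, where the sum is over all partitions of
`{1, …, k}` and the products are product measures (a signed measure on `E^k` is determined by its
values on the products of measurable sets). -/
def IsCumulantMeasure (ν : Ω → SignedMeasure E) (P : Measure Ω) (k : ℕ)
    (c : SignedMeasure (Fin k → E)) : Prop :=
  ∃ m : (L : Finset (Fin k)) → SignedMeasure (L → E), (∀ L, IsMomentMeasure ν P (m L)) ∧
    ∀ A : Fin k → Set E, (∀ i, MeasurableSet (A i)) →
      c (univ.pi A) = ∑ π : Finpartition (Finset.univ : Finset (Fin k)),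
        (-1 : ℝ) ^ (π.parts.card - 1) * ((π.parts.card - 1)! : ℝ) *
          ∏ L ∈ π.parts, m L (univ.pi fun i : L => A i)

/-- The `k`-th cumulant measure is unique. -/
theorem IsCumulantMeasure.unique {ν : Ω → SignedMeasure E} {P : Measure Ω} {k : ℕ}
    {c c' : SignedMeasure (Fin k → E)} (h : IsCumulantMeasure ν P k c)
    (h' : IsCumulantMeasure ν P k c') : c = c' := by
  obtain ⟨m, hm, hc⟩ := h
  obtain ⟨m', hm', hc'⟩ := h'
  have key : ∀ A : Fin k → Set E, (∀ i, MeasurableSet (A i)) →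
      c (univ.pi A) = c' (univ.pi A) := by
    intro A hA
    rw [hc A hA, hc' A hA]
    refine Finset.sum_congr rfl fun π _ => ?_
    congr 1
    refine Finset.prod_congr rfl fun L _ => ?_
    rw [(hm L _ fun i => hA i).2, (hm' L _ fun i => hA i).2]
  refine VectorMeasure.ext_of_generateFrom _ ?_ generateFrom_pi.symm isPiSystem_pi ?_
  · rintro _ ⟨A, hA, rfl⟩
    exact key A fun i => hA i (mem_univ i)
  · simpa [Set.pi_univ] using key (fun _ => univ) fun _ => MeasurableSet.univ

end

end Stabilizing

end

/-!
The bound rests on an explicit density of the cumulant measure and on its decay for configurations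
that fall into distant groups.

By the Mecke formula (`integral_tupleSum`), the expectation of a sum over the `k`-tuples of points
of a Poisson process is a sum, over the patterns of coincidences `f : Fin k ↠ Fin j`, of integrals
over `j` independent points of the intensity measure. Hence the moment measure has, for each
pattern, a density `momentDensity`: the expected product of the scores of the given points, in the
union of the process with these points. The partition formula for cumulants is equivalent to a
recursion (`eq_partitionCumulant`), which turns into a recursion for densities
(`cumulantDensity`, an instance of `weightedCumulant`). In this recursion a product of moments
counts only if the two groups of points have no point in common: a product of two expected sums
over tuples is an expected sum over pairs of tuples of points of independent copies of the process,
which have almost surely no point in common (`tupleIntegral_sum`).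
So the cumulant measure exists, and it is the `patternMeasure` of `cumulantDensity`
(`isCumulantMeasure_patternMeasure`); its total variation is at most the sum over `f` of the
integrals of `|cumulantDensity|`, divided by `j !`.

Without any assumption on the functional, the recursion gives `|cumulantDensity| ≤ k! (3 C)^k`
(`abs_weightedCumulant_le`). If the given points split into two groups at distance larger than
`2 r`, strong stabilization makes the score of every point, up to an event of probability of order
`exp (-γ r)`, a function of the process in the ball of radius `r` about the point and of the points
of its own group (`exists_stability_event`). The process is independent on the two disjoint
neighbourhoods, so the moment densities factorize up to an error of this order. This is inherited
by the cumulant density (`abs_weightedCumulant_le_of_split`), which is therefore of order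
`k! c^k exp (-γ r)` in the mean with respect to the marks (`lintegral_cumulantDensity_le`).

Finally let `ℓ = λ^{-1/d}` and sort the configurations of `j` distinct points by the smallest `m`
for which they are connected at the scale `2 ℓ (m + 1)`. Connected configurations contain a tree
with edges at most as long as the scale. There are at most `j^j` trees, and integrating the leaves
of a tree one by one shows that the connected configurations have measure at most
`j^j λ (W (m + 1)^d)^{j - 1}` (`lintegral_treeCount_le`). Summing this against `exp (-α m)` yields
a factor of order `(d k)! ≤ c^k (k!)^d`, while the sum over the patterns costs a further factor
`k!`. With the factor `k!` of the density, this gives `(k!)^{d + 2} λ`. For `λ` below the range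
of the stabilization hypothesis, the trivial bound on the density suffices.
-/

noncomputable section

namespace Stabilizing

/-! ### Sums over set partitions and the cumulant recursion -/

section Partition

variable {α : Type*} [DecidableEq α]

/-- Removing the part `B` from a partition of `s` leaves a partition of `s \ B`. -/
def removePart {s : Finset α} (π : Finpartition s) {B : Finset α} (hB : B ∈ π.parts) :
    Finpartition (s \ B) where
  parts := π.parts.erase B
  supIndep := π.supIndep.subset (Finset.erase_subset _ _)
  sup_parts := by
    ext x
    simp only [Finset.mem_sup, Finset.mem_erase, id, Finset.mem_sdiff]
    constructor
    · rintro ⟨t, ⟨htB, ht⟩, hx⟩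
      exact ⟨π.subset ht hx, fun hxB => htB (π.eq_of_mem_parts ht hB hx hxB)⟩
    · rintro ⟨hx, hxB⟩
      obtain ⟨t, ht, hxt⟩ := π.exists_mem hx
      exact ⟨t, ⟨fun h => hxB (h ▸ hxt), ht⟩, hxt⟩
  bot_notMem h := π.bot_notMem (Finset.mem_of_mem_erase h)

/-- A partition with a distinguished part `B` is the same as a nonempty set `B` together with a
partition of its complement. -/
theorem sum_parts_eq_sum_removePart {β : Type*} [AddCommMonoid β] (s : Finset α)
    (F : Finset α → Finset (Finset α) → β) :
    ∑ π : Finpartition s, ∑ B ∈ π.parts, F B (π.parts.erase B) =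
      ∑ B ∈ s.powerset with B.Nonempty, ∑ π : Finpartition (s \ B), F B π.parts := by
  rw [Finset.sum_sigma', Finset.sum_sigma']
  refine Finset.sum_bij'
    (i := fun x hx => ⟨x.2, removePart x.1 (by simpa using hx)⟩)
    (j := fun y hy => ⟨y.2.extend (b := y.1) (c := s)
      (by
        have := (Finset.mem_sigma.1 hy).1
        exact (Finset.mem_filter.1 this).2.ne_empty)
      Finset.sdiff_disjoint
      (by
        have := (Finset.mem_sigma.1 hy).1
        exact Finset.sdiff_union_of_subset (Finset.mem_powerset.1 (Finset.mem_filter.1 this).1)),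
      y.1⟩) ?_ ?_ ?_ ?_ ?_
  · rintro ⟨π, B⟩ hx
    have hB : B ∈ π.parts := by simpa using hx
    simpa using ⟨π.subset hB, π.nonempty_of_mem_parts hB⟩
  · rintro ⟨B, π⟩ hy
    simp
  · rintro ⟨π, B⟩ hx
    have hB : B ∈ π.parts := by simpa using hx
    refine Sigma.ext ?_ HEq.rfl
    ext1
    simp [removePart, Finset.insert_erase hB]
  · rintro ⟨B, π⟩ hy
    refine Sigma.ext rfl (heq_of_eq ?_)
    ext1
    simp only [removePart, Finpartition.extend_parts]
    refine Finset.erase_insert fun h => ?_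
    have hB : B.Nonempty := by simpa using (Finset.mem_filter.1 (Finset.mem_sigma.1 hy).1).2
    obtain ⟨x, hx⟩ := hB
    exact (Finset.mem_sdiff.1 (π.subset h hx)).2 hx
  · rintro ⟨π, B⟩ hx
    rfl

/-- The sum over the partitions of `s`, weighted by `w p` for `p` parts, of the product of `m`
over the parts. -/
def partitionSum (w : ℕ → ℝ) (m : Finset α → ℝ) (s : Finset α) : ℝ :=
  ∑ π : Finpartition s, w π.parts.card * ∏ B ∈ π.parts, m B

/-- The inverse of `m` for the convolution of set functions. -/
def convInverse (m : Finset α → ℝ) (s : Finset α) : ℝ :=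
  partitionSum (fun p => (-1) ^ p * (p ! : ℝ)) m s

/-- The cumulant that is given by the sum over all partitions. -/
def partitionCumulant (m : Finset α → ℝ) (s : Finset α) : ℝ :=
  partitionSum (fun p => (-1) ^ (p - 1) * ((p - 1) ! : ℝ)) m s

theorem convInverse_empty (m : Finset α → ℝ) : convInverse m (∅ : Finset α) = 1 := by
  rw [convInverse, partitionSum]
  have : Unique (Finpartition (∅ : Finset α)) :=
    inferInstanceAs (Unique (Finpartition (⊥ : Finset α)))
  rw [Fintype.sum_unique]
  have h : (default : Finpartition (∅ : Finset α)).parts = ∅ :=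
    Finpartition.parts_eq_empty_iff.2 rfl
  simp [h]

theorem sum_mul_convInverse {m : Finset α → ℝ} (hm : m ∅ = 1) {s : Finset α} (hs : s.Nonempty) :
    ∑ B ∈ s.powerset, m B * convInverse m (s \ B) = 0 := by
  have h1 : convInverse m s =
      ∑ B ∈ s.powerset with B.Nonempty, -(m B * convInverse m (s \ B)) := by
    have := sum_parts_eq_sum_removePart s
      (fun B P => -(m B * ((-1) ^ P.card * (P.card ! : ℝ) * ∏ D ∈ P, m D)))
    simp only [convInverse, partitionSum, Finset.mul_sum, ← Finset.sum_neg_distrib]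
    rw [← this]
    refine Finset.sum_congr rfl fun π _ => ?_
    have hp : 0 < π.parts.card :=
      Finset.card_pos.2 (π.parts_nonempty hs.ne_empty)
    obtain ⟨p, hp'⟩ : ∃ p, π.parts.card = p + 1 := ⟨_, (Nat.succ_pred_eq_of_pos hp).symm⟩
    have : ∀ B ∈ π.parts, -(m B * ((-1) ^ (π.parts.erase B).card *
        ((π.parts.erase B).card ! : ℝ) * ∏ D ∈ π.parts.erase B, m D)) =
        (-1) ^ (p + 1) * (p ! : ℝ) * ∏ D ∈ π.parts, m D := by
      intro B hB
      rw [← Finset.mul_prod_erase _ _ hB, Finset.card_erase_of_mem hB, hp', pow_succ]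
      simp only [Nat.add_sub_cancel]
      ring
    rw [Finset.sum_congr rfl this, Finset.sum_const, hp', Nat.factorial_succ]
    push_cast
    simp only [nsmul_eq_mul]
    push_cast
    ring
  have h2 : ∑ B ∈ s.powerset, m B * convInverse m (s \ B) =
      (∑ B ∈ s.powerset with B.Nonempty, m B * convInverse m (s \ B)) +
        m ∅ * convInverse m s := by
    rw [← Finset.sum_filter_add_sum_filter_not s.powerset (fun B => B.Nonempty)]
    congr 1
    have : {B ∈ s.powerset | ¬ B.Nonempty} = {∅} := by
      ext B
      simp only [Finset.mem_filter, Finset.mem_powerset, Finset.not_nonempty_iff_eq_empty,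
        Finset.mem_singleton]
      constructor
      · exact fun h => h.2
      · rintro rfl
        simp
    rw [this]
    simp
  rw [h2, h1, hm, one_mul, ← Finset.sum_add_distrib]
  simp

/-- Singling out the part that contains `a`. -/
theorem partitionCumulant_eq_sum (m : Finset α → ℝ) {s : Finset α} {a : α} (ha : a ∈ s) :
    partitionCumulant m s = ∑ B ∈ s.powerset with a ∈ B, m B * convInverse m (s \ B) := by
  have := sum_parts_eq_sum_removePart s
    (fun B P => if a ∈ B then m B * ((-1) ^ P.card * (P.card ! : ℝ) * ∏ D ∈ P, m D) else 0)
  have h2 : ∑ B ∈ s.powerset with a ∈ B, m B * convInverse m (s \ B) =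
      ∑ B ∈ s.powerset with B.Nonempty, ∑ π : Finpartition (s \ B),
        if a ∈ B then m B * ((-1) ^ π.parts.card * (π.parts.card ! : ℝ) * ∏ D ∈ π.parts, m D)
          else 0 := by
    rw [Finset.sum_filter, Finset.sum_filter]
    refine Finset.sum_congr rfl fun B _ => ?_
    by_cases h : a ∈ B
    · have : B.Nonempty := ⟨a, h⟩
      simp [h, this, convInverse, partitionSum, Finset.mul_sum]
    · simp [h]
  rw [h2, ← this, partitionCumulant, partitionSum]
  refine Finset.sum_congr rfl fun π _ => ?_
  rw [Finset.sum_eq_single_of_mem (π.part a) (π.part_mem.2 ha)]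
  · rw [if_pos (π.mem_part_self.2 ha), Finset.card_erase_of_mem (π.part_mem.2 ha),
      ← Finset.mul_prod_erase _ _ (π.part_mem.2 ha)]
    ring
  · intro B hB hne
    exact if_neg fun h => hne (π.part_eq_of_mem hB h).symm

/-- The cumulants are determined by the recursion `m L = ∑ c B * m (L \ B)`, the sum being over
the sets `B ⊆ L` that contain a distinguished element. -/
theorem eq_partitionCumulant {m c : Finset α → ℝ} (hm : m ∅ = 1) {s : Finset α} {a : α}
    (ha : a ∈ s)
    (h : ∀ L ⊆ s, a ∈ L → m L = ∑ B ∈ L.powerset with a ∈ B, c B * m (L \ B)) :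
    c s = partitionCumulant m s := by
  rw [partitionCumulant_eq_sum m ha]
  have h1 : ∑ B ∈ s.powerset with a ∈ B, m B * convInverse m (s \ B) =
      ∑ L ∈ s.powerset with a ∈ L, ∑ B ∈ L.powerset with a ∈ B,
        c B * (m (L \ B) * convInverse m (s \ L)) := by
    refine Finset.sum_congr rfl fun L hL => ?_
    rw [Finset.mem_filter, Finset.mem_powerset] at hL
    rw [h L hL.1 hL.2, Finset.sum_mul]
    exact Finset.sum_congr rfl fun B _ => mul_assoc _ _ _
  have h2 : ∑ L ∈ s.powerset with a ∈ L, ∑ B ∈ L.powerset with a ∈ B,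
        c B * (m (L \ B) * convInverse m (s \ L)) =
      ∑ B ∈ s.powerset with a ∈ B, ∑ L ∈ s.powerset with B ⊆ L,
        c B * (m (L \ B) * convInverse m (s \ L)) := by
    refine Finset.sum_comm' fun L B => ?_
    simp only [Finset.mem_filter, Finset.mem_powerset]
    constructor
    · rintro ⟨⟨h1, h2⟩, h3, h4⟩
      exact ⟨⟨h1, h3⟩, h3.trans h1, h4⟩
    · rintro ⟨⟨h1, h2⟩, h3, h4⟩
      exact ⟨⟨h1, h2 h4⟩, h2, h4⟩
  have h3 : ∀ B ∈ s.powerset, ∑ L ∈ s.powerset with B ⊆ L,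
      c B * (m (L \ B) * convInverse m (s \ L)) = if B = s then c B else 0 := by
    intro B hB
    rw [Finset.mem_powerset] at hB
    have : ∑ L ∈ s.powerset with B ⊆ L, c B * (m (L \ B) * convInverse m (s \ L)) =
        ∑ D ∈ (s \ B).powerset, c B * (m D * convInverse m ((s \ B) \ D)) := by
      refine Finset.sum_bij' (i := fun L _ => L \ B) (j := fun D _ => B ∪ D) ?_ ?_ ?_ ?_ ?_
      · intro L hL
        simp only [Finset.mem_filter, Finset.mem_powerset] at hL ⊢
        exact Finset.sdiff_subset_sdiff hL.1 le_rfl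
      · intro D hD
        simp only [Finset.mem_filter, Finset.mem_powerset] at hD ⊢
        exact ⟨Finset.union_subset hB (hD.trans Finset.sdiff_subset), Finset.subset_union_left⟩
      · intro L hL
        simp only [Finset.mem_filter, Finset.mem_powerset] at hL
        exact Finset.union_sdiff_of_subset hL.2
      · intro D hD
        simp only [Finset.mem_powerset] at hD
        rw [Finset.union_sdiff_left]
        exact Finset.sdiff_eq_self_of_disjoint
          (Finset.disjoint_left.2 fun x hx hxB => (Finset.mem_sdiff.1 (hD hx)).2 hxB)
      · intro L hL
        simp only [Finset.mem_filter, Finset.mem_powerset] at hL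
        have : (s \ B) \ (L \ B) = s \ L := by
          ext x
          simp only [Finset.mem_sdiff]
          have := @hL.2 x
          tauto
        rw [this]
    rw [this, ← Finset.mul_sum]
    split_ifs with hBs
    · subst hBs
      simp [convInverse_empty, hm]
    · rw [sum_mul_convInverse hm, mul_zero]
      exact Finset.sdiff_nonempty.2 fun h => hBs (hB.antisymm h)
  rw [h1, h2, Finset.sum_congr rfl fun B hB => h3 B (Finset.mem_filter.1 hB).1,
    Finset.sum_ite_eq', if_pos]
  simp [ha]

end Partition

section Cluster

variable {ι : Type*} [LinearOrder ι]

/-- The cumulants of a set function `m` with weights: they are defined by the recursion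
`m L = ∑ κ B * m (L \ B) * χ B (L \ B)`, the sum being over the sets `B ⊆ L` that contain the
least element of `L`. -/
def weightedCumulant (m : Finset ι → ℝ) (χ : Finset ι → Finset ι → ℝ) : Finset ι → ℝ
  | L => if h : L.Nonempty then
      m L - ∑ B ∈ ({B ∈ L.powerset | L.min' h ∈ B ∧ B ≠ L} : Finset (Finset ι)).attach,
        weightedCumulant m χ B.1 * m (L \ B.1) * χ B.1 (L \ B.1)
    else 0
  termination_by L => L.card
  decreasing_by
    have := B.2
    simp only [Finset.mem_filter, Finset.mem_powerset] at this
    exact Finset.card_lt_card (this.1.ssubset_of_ne this.2.2)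

theorem weightedCumulant_eq (m : Finset ι → ℝ) (χ : Finset ι → Finset ι → ℝ) {L : Finset ι}
    (h : L.Nonempty) :
    weightedCumulant m χ L = m L - ∑ B ∈ L.powerset with (L.min' h ∈ B ∧ B ≠ L),
      weightedCumulant m χ B * m (L \ B) * χ B (L \ B) := by
  rw [weightedCumulant, dif_pos h]
  congr 1
  exact Finset.sum_attach _ fun B => weightedCumulant m χ B * m (L \ B) * χ B (L \ B)

theorem sum_weightedCumulant_mul {m : Finset ι → ℝ} {χ : Finset ι → Finset ι → ℝ} (hm : m ∅ = 1)
    (hχ : ∀ B, χ B ∅ = 1) {L : Finset ι} (h : L.Nonempty) :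
    ∑ B ∈ L.powerset with L.min' h ∈ B, weightedCumulant m χ B * m (L \ B) * χ B (L \ B) = m L := by
  have hL : L ∈ ({B ∈ L.powerset | L.min' h ∈ B} : Finset (Finset ι)) := by
    simp [L.min'_mem h]
  rw [← Finset.sum_erase_add _ _ hL]
  have : ({B ∈ L.powerset | L.min' h ∈ B} : Finset (Finset ι)).erase L =
      {B ∈ L.powerset | L.min' h ∈ B ∧ B ≠ L} := by
    ext B
    simp only [Finset.mem_erase, Finset.mem_filter, Finset.mem_powerset]
    tauto
  rw [this, weightedCumulant_eq m χ h]
  simp [hm, hχ]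

theorem weightedCumulant_congr {m m' : Finset ι → ℝ} {χ χ' : Finset ι → Finset ι → ℝ}
    (L : Finset ι) (hm : ∀ B ⊆ L, m B = m' B)
    (hχ : ∀ B ⊆ L, ∀ D ⊆ L, χ B D = χ' B D) :
    weightedCumulant m χ L = weightedCumulant m' χ' L := by
  induction L using Finset.strongInduction with
  | H L ih =>
    rcases L.eq_empty_or_nonempty with rfl | h
    · simp [weightedCumulant]
    rw [weightedCumulant_eq m χ h, weightedCumulant_eq m' χ' h, hm L subset_rfl]
    congr 1
    refine Finset.sum_congr rfl fun B hB => ?_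
    simp only [Finset.mem_filter, Finset.mem_powerset] at hB
    rw [ih B (hB.1.ssubset_of_ne hB.2.2) (fun D hD => hm D (hD.trans hB.1))
      (fun D hD D' hD' => hχ D (hD.trans hB.1) D' (hD'.trans hB.1)),
      hm _ Finset.sdiff_subset, hχ _ hB.1 _ Finset.sdiff_subset]

/-- The constants in the bounds of the weighted cumulants. -/
theorem sum_factorial_mul_pow_add_one_le {L : Finset ι} (h : L.Nonempty) (a : ι) :
    (∑ B ∈ L.powerset with (a ∈ B ∧ B ≠ L), (B.card ! : ℝ) * 3 ^ B.card) + 1 ≤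
      (L.card ! : ℝ) * 3 ^ L.card := by
  have h1 : (∑ B ∈ L.powerset with (a ∈ B ∧ B ≠ L), (B.card ! : ℝ) * 3 ^ B.card) ≤
      ∑ B ∈ L.powerset.erase L, (B.card ! : ℝ) * 3 ^ B.card := by
    refine Finset.sum_le_sum_of_subset_of_nonneg ?_ fun _ _ _ => by positivity
    intro B hB
    simp only [Finset.mem_filter, Finset.mem_powerset, Finset.mem_erase] at hB ⊢
    exact ⟨hB.2.2, hB.1⟩
  have h2 : (∑ B ∈ L.powerset.erase L, (B.card ! : ℝ) * 3 ^ B.card) +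
      (L.card ! : ℝ) * 3 ^ L.card =
      (∑ j ∈ Finset.range L.card, (L.card.choose j : ℝ) * ((j ! : ℝ) * 3 ^ j)) +
        (L.card ! : ℝ) * 3 ^ L.card := by
    rw [Finset.sum_erase_add _ _ (by simp),
      Finset.sum_powerset_apply_card (fun j => (j ! : ℝ) * 3 ^ j), Finset.sum_range_succ]
    simp
  have h3 : (∑ j ∈ Finset.range L.card, (L.card.choose j : ℝ) * ((j ! : ℝ) * 3 ^ j)) ≤
      ∑ j ∈ Finset.range L.card, (L.card ! : ℝ) * 3 ^ j := by
    refine Finset.sum_le_sum fun j hj => ?_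
    have hj' : j ≤ L.card := (Finset.mem_range.1 hj).le
    have h4 : (L.card.choose j : ℝ) * j ! * ((L.card - j)! : ℝ) = L.card ! := by
      exact_mod_cast Nat.choose_mul_factorial_mul_factorial hj'
    rw [← mul_assoc]
    refine mul_le_mul_of_nonneg_right ?_ (by positivity)
    rw [← h4]
    refine le_mul_of_one_le_right (by positivity) ?_
    exact_mod_cast Nat.factorial_pos _
  rw [← Finset.mul_sum] at h3
  have h5 : (∑ j ∈ Finset.range L.card, (3 : ℝ) ^ j) * 2 = 3 ^ L.card - 1 := by
    have := geom_sum_mul (3 : ℝ) L.card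
    norm_num at this ⊢
    exact this
  have h6 : (1 : ℝ) ≤ (L.card ! : ℝ) := by exact_mod_cast Nat.factorial_pos _
  have h7 : (3 : ℝ) ≤ 3 ^ L.card := by
    simpa using pow_le_pow_right₀ (by norm_num : (1 : ℝ) ≤ 3) h.card_pos
  nlinarith

theorem abs_weightedCumulant_le {m : Finset ι → ℝ} {χ : Finset ι → Finset ι → ℝ} {C : ℝ}
    (hC : 1 ≤ C) (hm : ∀ L, |m L| ≤ C ^ L.card) (hχ : ∀ B D, |χ B D| ≤ 1) (L : Finset ι) :
    |weightedCumulant m χ L| ≤ (L.card ! : ℝ) * 3 ^ L.card * C ^ L.card := by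
  induction L using Finset.strongInduction with
  | H L ih =>
    rcases L.eq_empty_or_nonempty with rfl | h
    · simp [weightedCumulant]
    rw [weightedCumulant_eq m χ h]
    have h1 : ∀ B ∈ ({B ∈ L.powerset | L.min' h ∈ B ∧ B ≠ L} : Finset (Finset ι)),
        |weightedCumulant m χ B * m (L \ B) * χ B (L \ B)| ≤
          (B.card ! : ℝ) * 3 ^ B.card * C ^ L.card := by
      intro B hB
      simp only [Finset.mem_filter, Finset.mem_powerset] at hB
      rw [abs_mul, abs_mul]
      calc _ ≤ ((B.card ! : ℝ) * 3 ^ B.card * C ^ B.card) * C ^ (L \ B).card * 1 := by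
            gcongr
            · exact ih B (hB.1.ssubset_of_ne hB.2.2)
            · exact hm _
            · exact hχ _ _
        _ = _ := by
            rw [mul_one, mul_assoc, ← pow_add, add_comm, Finset.card_sdiff_add_card_eq_card hB.1]
    calc _ ≤ |m L| + |∑ B ∈ L.powerset with (L.min' h ∈ B ∧ B ≠ L),
            weightedCumulant m χ B * m (L \ B) * χ B (L \ B)| := abs_sub _ _
      _ ≤ C ^ L.card + ∑ B ∈ L.powerset with (L.min' h ∈ B ∧ B ≠ L),
            (B.card ! : ℝ) * 3 ^ B.card * C ^ L.card :=
          add_le_add (hm L) ((Finset.abs_sum_le_sum_abs _ _).trans (Finset.sum_le_sum h1))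
      _ = ((∑ B ∈ L.powerset with (L.min' h ∈ B ∧ B ≠ L), (B.card ! : ℝ) * 3 ^ B.card) + 1) *
            C ^ L.card := by
          rw [← Finset.sum_mul]
          ring
      _ ≤ _ := by
          gcongr
          exact sum_factorial_mul_pow_add_one_le h _

/-- If `m` is multiplicative up to an error `ε` with respect to a splitting of the index set, then
the cumulants of the sets that meet both parts of the splitting are of order `ε`. -/
theorem abs_weightedCumulant_le_of_split {m : Finset ι → ℝ} {χ : Finset ι → Finset ι → ℝ}
    {C ε : ℝ} (hC : 1 ≤ C) (hm : ∀ L, |m L| ≤ C ^ L.card) (hm0 : m ∅ = 1)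
    (hχ : ∀ B D, |χ B D| ≤ 1) (hχ0 : ∀ B, χ B ∅ = 1) (col : ι → Bool)
    (hcol : ∀ (b : Bool) (B D : Finset ι), (∀ i ∈ B, col i = b) →
      χ B D = χ B {i ∈ D | col i = b})
    (hU : ∀ L : Finset ι,
      |m L - m {i ∈ L | col i = true} * m {i ∈ L | col i = false}| ≤ ε)
    (L : Finset ι) (hL : ∃ i ∈ L, ∃ j ∈ L, col i ≠ col j) :
    |weightedCumulant m χ L| ≤ (L.card ! : ℝ) * 3 ^ L.card * C ^ L.card * ε := by
  have hε : 0 ≤ ε := (abs_nonneg _).trans (hU ∅)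
  induction L using Finset.strongInduction with
  | H L ih =>
    have h : L.Nonempty := ⟨_, hL.choose_spec.1⟩
    set a := L.min' h with ha
    have haL : a ∈ L := L.min'_mem h
    set S : Finset ι := {i ∈ L | col i = col a} with hS
    have haS : a ∈ S := by simp [hS, haL]
    have hSne : S ≠ L := by
      intro hSL
      obtain ⟨i, hi, j, hj, hij⟩ := hL
      rw [← hSL] at hi hj
      exact hij ((Finset.mem_filter.1 hi).2.trans (Finset.mem_filter.1 hj).2.symm)
    -- the defect of multiplicativity, written symmetrically in the two colours
    have hU' : ∀ D : Finset ι,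
        |m D - m {i ∈ D | col i = col a} * m {i ∈ D | col i ≠ col a}| ≤ ε := by
      intro D
      have := hU D
      rcases hca : col a with _ | _
      · simpa [mul_comm] using this
      · simpa using this
    have hSmin : S.min' ⟨a, haS⟩ = a :=
      le_antisymm (S.min'_le _ haS) (L.min'_le _ (Finset.filter_subset _ _ (S.min'_mem _)))
    have hSrec := sum_weightedCumulant_mul hm0 hχ0 ⟨a, haS⟩ (L := S)
    rw [hSmin] at hSrec
    set P : Finset (Finset ι) := {B ∈ L.powerset | a ∈ B ∧ B ≠ L} with hP
    have hsplit : P = {B ∈ P | B ⊆ S} ∪ {B ∈ P | ¬ B ⊆ S} := by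
      rw [Finset.filter_union_filter_not_eq]
    have hPS : {B ∈ P | B ⊆ S} = {B ∈ S.powerset | a ∈ B} := by
      ext B
      simp only [hP, Finset.mem_filter, Finset.mem_powerset]
      constructor
      · tauto
      · rintro ⟨h1, h2⟩
        exact ⟨⟨h1.trans (Finset.filter_subset _ _), h2,
          fun h3 => hSne ((Finset.filter_subset _ _).antisymm (h3.symm.subset.trans h1))⟩, h1⟩
    have hkey : weightedCumulant m χ L =
        (m L - m S * m {i ∈ L | col i ≠ col a}) -
          (∑ B ∈ P with B ⊆ S, weightedCumulant m χ B * χ B (L \ B) *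
            (m (L \ B) - m (S \ B) * m {i ∈ L | col i ≠ col a})) -
          ∑ B ∈ P with ¬ B ⊆ S, weightedCumulant m χ B * m (L \ B) * χ B (L \ B) := by
      rw [weightedCumulant_eq m χ h, ← ha, ← hP,
        ← Finset.sum_filter_add_sum_filter_not P (fun B => B ⊆ S)]
      have h1 : ∑ B ∈ P with B ⊆ S, weightedCumulant m χ B * χ B (L \ B) *
            (m (L \ B) - m (S \ B) * m {i ∈ L | col i ≠ col a}) =
          (∑ B ∈ P with B ⊆ S, weightedCumulant m χ B * m (L \ B) * χ B (L \ B)) -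
            m S * m {i ∈ L | col i ≠ col a} := by
        rw [← hSrec, hPS, Finset.sum_mul, ← Finset.sum_sub_distrib]
        refine Finset.sum_congr rfl fun B hB => ?_
        simp only [Finset.mem_filter, Finset.mem_powerset] at hB
        have h2 : χ B (L \ B) = χ B (S \ B) := by
          rw [hcol (col a) B (L \ B) fun i hi => (Finset.mem_filter.1 (hB.1 hi)).2]
          congr 1
          ext i
          simp only [hS, Finset.mem_filter, Finset.mem_sdiff]
          tauto
        rw [h2]
        ring
      rw [h1]
      ring
    have hb1 : ∀ B ∈ {B ∈ P | B ⊆ S}, |weightedCumulant m χ B * χ B (L \ B) *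
        (m (L \ B) - m (S \ B) * m {i ∈ L | col i ≠ col a})| ≤
          (B.card ! : ℝ) * 3 ^ B.card * (C ^ L.card * ε) := by
      intro B hB
      rw [Finset.mem_filter] at hB
      have hBL : B ⊆ L := hB.2.trans (Finset.filter_subset _ _)
      have h2 : ({i ∈ L \ B | col i = col a} : Finset ι) = S \ B := by
        ext i
        simp only [hS, Finset.mem_filter, Finset.mem_sdiff]
        tauto
      have h3 : ({i ∈ L \ B | col i ≠ col a} : Finset ι) = {i ∈ L | col i ≠ col a} := by
        ext i
        simp only [Finset.mem_filter, Finset.mem_sdiff]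
        have : i ∈ B → col i = col a := fun hi => (Finset.mem_filter.1 (hB.2 hi)).2
        tauto
      have h4 := hU' (L \ B)
      rw [h2, h3] at h4
      rw [abs_mul, abs_mul]
      calc _ ≤ ((B.card ! : ℝ) * 3 ^ B.card * C ^ B.card) * 1 * ε := by
            gcongr
            · exact abs_weightedCumulant_le hC hm hχ B
            · exact hχ _ _
        _ ≤ ((B.card ! : ℝ) * 3 ^ B.card * C ^ L.card) * 1 * ε := by
            gcongr
        _ = _ := by ring
    have hb2 : ∀ B ∈ {B ∈ P | ¬ B ⊆ S},
        |weightedCumulant m χ B * m (L \ B) * χ B (L \ B)| ≤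
          (B.card ! : ℝ) * 3 ^ B.card * (C ^ L.card * ε) := by
      intro B hB
      simp only [hP, Finset.mem_filter, Finset.mem_powerset] at hB
      obtain ⟨i, hi, hiS⟩ := Finset.not_subset.1 hB.2
      rw [abs_mul, abs_mul]
      calc _ ≤ ((B.card ! : ℝ) * 3 ^ B.card * C ^ B.card * ε) * C ^ (L \ B).card * 1 := by
            gcongr
            · refine ih B (hB.1.1.ssubset_of_ne hB.1.2.2) ⟨i, hi, a, hB.1.2.1, fun hc => hiS ?_⟩
              exact Finset.mem_filter.2 ⟨hB.1.1 hi, hc⟩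
            · exact hm _
            · exact hχ _ _
        _ = (B.card ! : ℝ) * 3 ^ B.card * (C ^ ((L \ B).card + B.card) * ε) := by
            rw [pow_add]
            ring
        _ = _ := by rw [Finset.card_sdiff_add_card_eq_card hB.1.1]
    have hsum : ∑ B ∈ P, (B.card ! : ℝ) * 3 ^ B.card * (C ^ L.card * ε) =
        (∑ B ∈ P with B ⊆ S, (B.card ! : ℝ) * 3 ^ B.card * (C ^ L.card * ε)) +
          ∑ B ∈ P with ¬ B ⊆ S, (B.card ! : ℝ) * 3 ^ B.card * (C ^ L.card * ε) :=
      (Finset.sum_filter_add_sum_filter_not _ _ _).symm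
    rw [hkey]
    calc _ ≤ |m L - m S * m {i ∈ L | col i ≠ col a}| +
          |∑ B ∈ P with B ⊆ S, weightedCumulant m χ B * χ B (L \ B) *
            (m (L \ B) - m (S \ B) * m {i ∈ L | col i ≠ col a})| +
          |∑ B ∈ P with ¬ B ⊆ S, weightedCumulant m χ B * m (L \ B) * χ B (L \ B)| :=
          (abs_sub _ _).trans (add_le_add (abs_sub _ _) le_rfl)
      _ ≤ C ^ L.card * ε +
          (∑ B ∈ P with B ⊆ S, (B.card ! : ℝ) * 3 ^ B.card * (C ^ L.card * ε)) +
          ∑ B ∈ P with ¬ B ⊆ S, (B.card ! : ℝ) * 3 ^ B.card * (C ^ L.card * ε) := by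
          gcongr
          · exact (hU' L).trans (le_mul_of_one_le_left hε (one_le_pow₀ hC))
          · exact (Finset.abs_sum_le_sum_abs _ _).trans (Finset.sum_le_sum hb1)
          · exact (Finset.abs_sum_le_sum_abs _ _).trans (Finset.sum_le_sum hb2)
      _ = ((∑ B ∈ P, (B.card ! : ℝ) * 3 ^ B.card) + 1) * (C ^ L.card * ε) := by
          rw [add_assoc, ← hsum, ← Finset.sum_mul]
          ring
      _ ≤ ((L.card ! : ℝ) * 3 ^ L.card) * (C ^ L.card * ε) := by
          gcongr
          exact sum_factorial_mul_pow_add_one_le h _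
      _ = _ := by ring

end Cluster

/-! ### Integration with respect to the law of a Poisson process -/

section Mixture

variable {Y : Type*} [MeasurableSpace Y] {A : ℕ → Type*} [∀ n, MeasurableSpace (A n)]

/-- The countable mixture, with weights `w n`, of the images of the measures `ν n` under the
embeddings `e n`. The law of a Poisson process, and its products with other measures, are of this
form. -/
def mixture (w : ℕ → ℝ≥0∞) (ν : ∀ n, Measure (A n)) (e : ∀ n, A n → Y) : Measure Y :=
  Measure.sum fun n => w n • (ν n).map (e n)

variable {w : ℕ → ℝ≥0∞} {ν : ∀ n, Measure (A n)} {e : ∀ n, A n → Y}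

theorem ae_mixture_iff (hw : ∀ n, w n ≠ 0) (he : ∀ n, MeasurableEmbedding (e n)) {p : Y → Prop} :
    (∀ᵐ y ∂mixture w ν e, p y) ↔ ∀ n, ∀ᵐ x ∂ν n, p (e n x) := by
  rw [mixture, Measure.ae_sum_iff]
  refine forall_congr' fun n => ?_
  rw [Measure.ae_ennreal_smul_measure_iff (hw n), (he n).ae_map_iff]

theorem aestronglyMeasurable_mixture (he : ∀ n, MeasurableEmbedding (e n)) {F : Y → ℝ}
    (h : ∀ n, AEStronglyMeasurable (fun x => F (e n x)) (ν n)) :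
    AEStronglyMeasurable F (mixture w ν e) :=
  AEStronglyMeasurable.sum_measure fun n =>
    ((he n).aestronglyMeasurable_map_iff.2 (h n)).smul_measure _

theorem integrable_mixture [∀ n, IsFiniteMeasure (ν n)] (hw : ∀ n, w n ≠ ∞)
    (he : ∀ n, MeasurableEmbedding (e n)) {F : Y → ℝ}
    (h : ∀ n, AEStronglyMeasurable (fun x => F (e n x)) (ν n)) {b : ℕ → ℝ}
    (hb : ∀ n, ∀ᵐ x ∂ν n, |F (e n x)| ≤ b n)
    (hs : Summable fun n => (w n).toReal * (b n * (ν n).real univ)) :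
    Integrable F (mixture w ν e) := by
  have hi : ∀ n, Integrable (fun x => F (e n x)) (ν n) := fun n =>
    Integrable.of_bound (h n) (b n) (by simpa using hb n)
  refine integrable_sum_measure (fun n => ?_) ?_
  · exact Integrable.smul_measure ((he n).integrable_map_iff.2 (hi n)) (hw n)
  · refine Summable.of_nonneg_of_le (fun n => integral_nonneg fun _ => norm_nonneg _)
      (fun n => ?_) hs
    rw [integral_smul_measure, (he n).integral_map, smul_eq_mul]
    refine mul_le_mul_of_nonneg_left ?_ ENNReal.toReal_nonneg
    calc _ ≤ ∫ _, b n ∂ν n := integral_mono_ae (hi n).norm (integrable_const _) (hb n)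
      _ = _ := by simp [mul_comm]

theorem integral_mixture (he : ∀ n, MeasurableEmbedding (e n)) {F : Y → ℝ}
    (h : Integrable F (mixture w ν e)) :
    ∫ y, F y ∂mixture w ν e = ∑' n, (w n).toReal * ∫ x, F (e n x) ∂ν n := by
  rw [mixture, integral_sum_measure h]
  refine tsum_congr fun n => ?_
  rw [integral_smul_measure, (he n).integral_map, smul_eq_mul]

end Mixture

section Law

variable {E : Type*} [MeasurableSpace E]

theorem measurableEmbedding_sigmaMk {ι : Type*} {A : ι → Type*} [∀ i, MeasurableSpace (A i)]
    (i : ι) : MeasurableEmbedding (Sigma.mk i : A i → Σ i, A i) where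
  injective := sigma_mk_injective
  measurable := fun s hs => by
    rw [MeasurableSpace.measurableSet_iInf] at hs
    exact hs i
  measurableSet_image' := fun s hs => by
    refine (MeasurableSpace.measurableSet_iInf).2 fun j => ?_
    change MeasurableSet (Sigma.mk j ⁻¹' (Sigma.mk i '' s))
    by_cases hij : i = j
    · subst hij
      rwa [preimage_image_eq _ sigma_mk_injective]
    · convert MeasurableSet.empty
      ext x
      simp only [mem_preimage, mem_image, mem_empty_iff_false, iff_false, not_exists, not_and]
      intro y _ h
      exact hij (congrArg Sigma.fst h)

/-- The realization that consists of the `n` points `q`. -/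
abbrev realization (n : ℕ) (q : Fin n → E) : Σ n : ℕ, (Fin n → E) := ⟨n, q⟩

theorem measurableEmbedding_realization (n : ℕ) :
    MeasurableEmbedding (realization n : (Fin n → E) → _) :=
  measurableEmbedding_sigmaMk (A := fun n : ℕ => (Fin n → E)) n

variable (Λ : Measure E)

/-- The weight `e^{-Λ(E)} / n!`. -/
def poissonWeight (n : ℕ) : ℝ≥0∞ := ENNReal.ofReal (Real.exp (-(Λ univ).toReal) / (n ! : ℝ))

theorem poissonWeight_ne_zero (n : ℕ) : poissonWeight Λ n ≠ 0 := by
  rw [poissonWeight, Ne, ENNReal.ofReal_eq_zero, not_le]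
  positivity

theorem poissonWeight_ne_top (n : ℕ) : poissonWeight Λ n ≠ ∞ := ENNReal.ofReal_ne_top

theorem toReal_poissonWeight (n : ℕ) :
    (poissonWeight Λ n).toReal = Real.exp (-Λ.real univ) / (n ! : ℝ) :=
  ENNReal.toReal_ofReal (by positivity)

theorem poissonProcessLaw_eq_mixture :
    poissonProcessLaw Λ =
      mixture (poissonWeight Λ) (fun n => Measure.pi fun _ : Fin n => Λ) realization :=
  rfl

theorem summable_poissonWeight_mul (c K a b : ℝ) :
    Summable fun n => (poissonWeight Λ n).toReal * (K * a ^ n * (c * b ^ n)) := by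
  have : (fun n => (poissonWeight Λ n).toReal * (K * a ^ n * (c * b ^ n))) =
      fun n : ℕ => (Real.exp (-Λ.real univ) * K * c) * ((a * b) ^ n / (n ! : ℝ)) := by
    ext n
    rw [toReal_poissonWeight, mul_pow]
    ring
  rw [this]
  exact (Real.summable_pow_div_factorial _).mul_left _

theorem ae_poissonProcessLaw_iff {p : (Σ n : ℕ, (Fin n → E)) → Prop} :
    (∀ᵐ ω ∂poissonProcessLaw Λ, p ω) ↔ ∀ n, ∀ᵐ q ∂(Measure.pi fun _ : Fin n => Λ), p ⟨n, q⟩ :=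
  ae_mixture_iff (poissonWeight_ne_zero Λ) measurableEmbedding_realization

/-- If the integrals of `F` over the configurations of `n` points decompose according to the
subsets of the `n` points, then the expectation of `F` is a double exponential series. -/
theorem integral_eq_tsum_of_subsets {F : (Σ n : ℕ, (Fin n → E)) → ℝ}
    (hF : Integrable F (poissonProcessLaw Λ)) {Φ : ℕ → ℕ → ℝ} {K a : ℝ}
    (hΦ : ∀ j m, |Φ j m| ≤ K * a ^ (j + m))
    (h : ∀ n, ∫ q, F ⟨n, q⟩ ∂(Measure.pi fun _ : Fin n => Λ) =
      ∑ s : Finset (Fin n), Φ s.card (n - s.card)) :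
    Summable (fun p : ℕ × ℕ => Φ p.1 p.2 / ((p.1 ! : ℝ) * (p.2 ! : ℝ))) ∧
    ∫ ω, F ω ∂poissonProcessLaw Λ = Real.exp (-Λ.real univ) *
      ∑' p : ℕ × ℕ, Φ p.1 p.2 / ((p.1 ! : ℝ) * (p.2 ! : ℝ)) := by
  have hsum : Summable (fun p : ℕ × ℕ => Φ p.1 p.2 / ((p.1 ! : ℝ) * (p.2 ! : ℝ))) := by
    have h1 := (Real.summable_pow_div_factorial |a|).mul_of_nonneg
      (Real.summable_pow_div_factorial |a|) (fun n => by positivity) (fun n => by positivity)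
    refine Summable.of_norm_bounded (h1.mul_left |K|) fun p => ?_
    rw [Real.norm_eq_abs, abs_div, abs_of_nonneg (by positivity : (0 : ℝ) ≤ p.1 ! * p.2 !)]
    rw [div_mul_div_comm, ← pow_add, ← mul_div_assoc]
    gcongr
    calc _ ≤ K * a ^ (p.1 + p.2) := hΦ _ _
      _ ≤ |K * a ^ (p.1 + p.2)| := le_abs_self _
      _ = _ := by rw [abs_mul, abs_pow]
  refine ⟨hsum, ?_⟩
  rw [poissonProcessLaw_eq_mixture] at hF ⊢
  rw [integral_mixture measurableEmbedding_realization hF, ← tsum_mul_left]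
  have h2 : ∀ n : ℕ, (poissonWeight Λ n).toReal *
      ∫ q, F ⟨n, q⟩ ∂(Measure.pi fun _ : Fin n => Λ) =
      ∑ p ∈ Finset.HasAntidiagonal.antidiagonal n,
        Real.exp (-Λ.real univ) * (Φ p.1 p.2 / ((p.1 ! : ℝ) * (p.2 ! : ℝ))) := by
    intro n
    have h3 := Finset.sum_powerset_apply_card (fun j => Φ j (n - j))
      (x := (Finset.univ : Finset (Fin n)))
    rw [Finset.powerset_univ, Finset.card_univ, Fintype.card_fin] at h3
    rw [h n, h3, toReal_poissonWeight, Finset.mul_sum,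
      Finset.Nat.sum_antidiagonal_eq_sum_range_succ_mk]
    refine Finset.sum_congr rfl fun j hj => ?_
    have hj' : j ≤ n := Nat.lt_succ_iff.1 (Finset.mem_range.1 hj)
    have h4 : (n.choose j : ℝ) * j ! * ((n - j)! : ℝ) = n ! := by
      exact_mod_cast Nat.choose_mul_factorial_mul_factorial hj'
    have h5 : (n ! : ℝ) ≠ 0 := by positivity
    have h6 : (j ! : ℝ) ≠ 0 := by positivity
    have h7 : ((n - j)! : ℝ) ≠ 0 := by positivity
    rw [nsmul_eq_mul]
    field_simp
    rw [← h4]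
    ring
  rw [tsum_congr h2]
  have h8 := (hsum.mul_left (Real.exp (-Λ.real univ)))
  rw [← (Finset.HasAntidiagonal.sigmaAntidiagonalEquivProd (A := ℕ)).summable_iff] at h8
  rw [← (Finset.HasAntidiagonal.sigmaAntidiagonalEquivProd (A := ℕ)).tsum_eq]
  refine Eq.trans ?_ (Summable.tsum_sigma' (fun n => (hasSum_fintype _).summable) h8).symm
  refine tsum_congr fun n => ?_
  rw [tsum_fintype, ← Finset.sum_coe_sort]
  rfl

variable [IsFiniteMeasure Λ]

theorem prod_poissonProcessLaw {X : Type*} [MeasurableSpace X] (μ : Measure X)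
    [SFinite μ] :
    μ.prod (poissonProcessLaw Λ) = mixture (poissonWeight Λ)
      (fun n => μ.prod (Measure.pi fun _ : Fin n => Λ)) fun n => Prod.map id (realization n) := by
  have (n : ℕ) : IsFiniteMeasure
      (poissonWeight Λ n • (Measure.pi fun _ : Fin n => Λ).map
        (realization n)) :=
    Measure.smul_finite _ (poissonWeight_ne_top Λ n)
  rw [poissonProcessLaw_eq_mixture, mixture, mixture, Measure.prod_sum_right]
  congr 1
  ext1 n
  rw [Measure.prod_smul_right]
  congr 1
  nth_rw 1 [← Measure.map_id (μ := μ)]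
  rw [Measure.map_prod_map _ _ measurable_id (measurableEmbedding_realization n).measurable]

theorem real_pi_univ (σ : Type*) [Fintype σ] :
    (Measure.pi fun _ : σ => Λ).real univ = Λ.real univ ^ Fintype.card σ := by
  simp [Measure.real, Measure.pi_univ]

instance isProbabilityMeasure_poissonProcessLaw : IsProbabilityMeasure (poissonProcessLaw Λ) := by
  constructor
  rw [poissonProcessLaw, Measure.sum_apply _ MeasurableSet.univ]
  have h : ∀ n : ℕ, (ENNReal.ofReal (Real.exp (-(Λ univ).toReal) / (n ! : ℝ)) •
      (Measure.pi fun _ : Fin n => Λ).map (realization n)) univ =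
      ENNReal.ofReal (Real.exp (-Λ.real univ) * (Λ.real univ ^ n / (n ! : ℝ))) := by
    intro n
    rw [Measure.smul_apply, Measure.map_apply (measurableEmbedding_realization n).measurable
      MeasurableSet.univ, preimage_univ, Measure.pi_univ]
    simp only [Finset.prod_const, Finset.card_univ, Fintype.card_fin, smul_eq_mul]
    rw [← ENNReal.ofReal_toReal (measure_ne_top Λ univ),
      ← ENNReal.ofReal_pow ENNReal.toReal_nonneg, ← ENNReal.ofReal_mul (by positivity),
      ENNReal.toReal_ofReal ENNReal.toReal_nonneg]
    congr 1
    simp only [Measure.real]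
    ring
  simp_rw [h]
  have h2 : Real.exp (Λ.real univ) = ∑' n : ℕ, Λ.real univ ^ n / (n ! : ℝ) := by
    rw [Real.exp_eq_exp_ℝ, NormedSpace.exp_eq_tsum_div]
  rw [← ENNReal.ofReal_tsum_of_nonneg (fun n => by positivity)
    ((Real.summable_pow_div_factorial _).mul_left _), tsum_mul_left, ← h2, ← Real.exp_add]
  simp

theorem integrable_poissonProcessLaw {F : (Σ n : ℕ, (Fin n → E)) → ℝ}
    (h : ∀ n, AEStronglyMeasurable (fun q => F ⟨n, q⟩) (Measure.pi fun _ : Fin n => Λ))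
    (K a : ℝ) (hb : ∀ n, ∀ᵐ q ∂(Measure.pi fun _ : Fin n => Λ), |F ⟨n, q⟩| ≤ K * a ^ n) :
    Integrable F (poissonProcessLaw Λ) := by
  rw [poissonProcessLaw_eq_mixture]
  refine integrable_mixture (poissonWeight_ne_top Λ) measurableEmbedding_realization h hb ?_
  simpa [real_pi_univ] using summable_poissonWeight_mul Λ 1 K a (Λ.real univ)

theorem aestronglyMeasurable_prod_poissonProcessLaw {X : Type*} [MeasurableSpace X]
    {μ : Measure X} [SFinite μ] {F : X × (Σ n : ℕ, (Fin n → E)) → ℝ}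
    (h : ∀ n, AEStronglyMeasurable (fun z : X × (Fin n → E) => F (z.1, ⟨n, z.2⟩))
      (μ.prod (Measure.pi fun _ : Fin n => Λ))) :
    AEStronglyMeasurable F (μ.prod (poissonProcessLaw Λ)) := by
  rw [prod_poissonProcessLaw]
  exact aestronglyMeasurable_mixture
    (fun n => MeasurableEmbedding.id.prodMap (measurableEmbedding_realization n)) h

theorem integrable_prod_poissonProcessLaw {X : Type*} [MeasurableSpace X]
    {μ : Measure X} [IsFiniteMeasure μ] {F : X × (Σ n : ℕ, (Fin n → E)) → ℝ}
    (h : ∀ n, AEStronglyMeasurable (fun z : X × (Fin n → E) => F (z.1, ⟨n, z.2⟩))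
      (μ.prod (Measure.pi fun _ : Fin n => Λ)))
    (K a : ℝ) (hb : ∀ n, ∀ᵐ z ∂(μ.prod (Measure.pi fun _ : Fin n => Λ)),
      |F (z.1, ⟨n, z.2⟩)| ≤ K * a ^ n) :
    Integrable F (μ.prod (poissonProcessLaw Λ)) := by
  rw [prod_poissonProcessLaw]
  refine integrable_mixture (poissonWeight_ne_top Λ)
    (fun n => MeasurableEmbedding.id.prodMap (measurableEmbedding_realization n)) h hb ?_
  have : ∀ n : ℕ, (μ.prod (Measure.pi fun _ : Fin n => Λ)).real univ =
      μ.real univ * Λ.real univ ^ n := by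
    intro n
    rw [← univ_prod_univ, measureReal_prod_prod, real_pi_univ, Fintype.card_fin]
  simpa [this] using summable_poissonWeight_mul Λ (μ.real univ) K a (Λ.real univ)

theorem integral_prod_poissonProcessLaw {X : Type*} [MeasurableSpace X]
    {μ : Measure X} [SFinite μ] {F : X × (Σ n : ℕ, (Fin n → E)) → ℝ}
    (h : Integrable F (μ.prod (poissonProcessLaw Λ))) :
    ∫ z, F z ∂(μ.prod (poissonProcessLaw Λ)) = Real.exp (-Λ.real univ) *
      ∑' n : ℕ, (∫ z, F (z.1, ⟨n, z.2⟩) ∂(μ.prod (Measure.pi fun _ : Fin n => Λ))) / (n ! : ℝ) := by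
  rw [prod_poissonProcessLaw] at h ⊢
  rw [integral_mixture
    (fun n => MeasurableEmbedding.id.prodMap (measurableEmbedding_realization n)) h,
    ← tsum_mul_left]
  refine tsum_congr fun n => ?_
  rw [toReal_poissonWeight]
  simp only [Prod.map, id]
  ring

end Law

/-! ### The Mecke formula and the independence of the process on disjoint sets -/

section Split

variable {E : Type*} [MeasurableSpace E] (Λ : Measure E) [IsFiniteMeasure Λ]

theorem measurePreserving_comp_equiv {σ τ : Type*} [Fintype σ] [Fintype τ] (e : σ ≃ τ) :
    MeasurePreserving (fun q : τ → E => q ∘ e) (Measure.pi fun _ => Λ) (Measure.pi fun _ => Λ) := by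
  have := measurePreserving_piCongrLeft (fun _ : σ => Λ) e.symm
  convert this using 1
  ext q i
  simp [MeasurableEquiv.piCongrLeft, Equiv.piCongrLeft, Equiv.piCongrLeft']

theorem integral_comp_equiv {σ τ : Type*} [Fintype σ] [Fintype τ] (e : σ ≃ τ)
    (F : (σ → E) → ℝ) :
    ∫ q : τ → E, F (q ∘ e) ∂(Measure.pi fun _ => Λ) = ∫ p, F p ∂(Measure.pi fun _ => Λ) := by
  refine (measurePreserving_comp_equiv Λ e).integral_comp ?_ F
  convert (MeasurableEquiv.piCongrLeft (fun _ : σ => E) e.symm).measurableEmbedding using 1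
  ext q i
  simp [MeasurableEquiv.piCongrLeft, Equiv.piCongrLeft, Equiv.piCongrLeft']

theorem measurePreserving_sumElim (σ τ : Type*) [Fintype σ] [Fintype τ] :
    MeasurePreserving (fun p : (σ → E) × (τ → E) => Sum.elim p.1 p.2)
      ((Measure.pi fun _ => Λ).prod (Measure.pi fun _ => Λ)) (Measure.pi fun _ => Λ) := by
  convert measurePreserving_sumPiEquivProdPi_symm (fun _ : σ ⊕ τ => Λ) using 1
  ext p (i | i) <;> rfl

theorem integral_sumElim {σ τ : Type*} [Fintype σ] [Fintype τ] (F : (σ ⊕ τ → E) → ℝ) :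
    ∫ p : (σ → E) × (τ → E), F (Sum.elim p.1 p.2)
      ∂((Measure.pi fun _ => Λ).prod (Measure.pi fun _ => Λ)) =
      ∫ q, F q ∂(Measure.pi fun _ => Λ) := by
  refine (measurePreserving_sumElim Λ σ τ).integral_comp ?_ F
  convert (MeasurableEquiv.sumPiEquivProdPi (fun _ : σ ⊕ τ => E)).symm.measurableEmbedding using 1
  ext p (i | i) <;> rfl

theorem integral_eq_integral_sumElim {n j m : ℕ} (e : Fin j ⊕ Fin m ≃ Fin n)
    (F : (Fin n → E) → ℝ) :
    ∫ q, F q ∂(Measure.pi fun _ => Λ) =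
      ∫ p : (Fin j → E) × (Fin m → E), F (Sum.elim p.1 p.2 ∘ e.symm)
        ∂((Measure.pi fun _ => Λ).prod (Measure.pi fun _ => Λ)) := by
  rw [integral_sumElim Λ (fun q => F (q ∘ e.symm))]
  exact (integral_comp_equiv Λ e.symm F).symm

theorem exists_equiv_sum {n : ℕ} (s : Finset (Fin n)) :
    ∃ e : Fin s.card ⊕ Fin (n - s.card) ≃ Fin n, ∀ i, i ∈ s ↔ ∃ a, e (Sum.inl a) = i := by
  have hc : Fintype.card {i // i ∉ s} = n - s.card := by
    rw [Fintype.card_subtype_compl, Fintype.card_fin, Fintype.card_coe]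
  refine ⟨(Equiv.sumCongr s.equivFin.symm (Fintype.equivFinOfCardEq hc).symm).trans
    (Equiv.sumCompl (· ∈ s)), fun i => ⟨fun hi => ⟨s.equivFin ⟨i, hi⟩, by simp⟩, ?_⟩⟩
  rintro ⟨a, rfl⟩
  simp

end Split

section Mecke

variable {E : Type*} [MeasurableSpace E] [DecidableEq E]

/-- The set of points of a realization. -/
def pts (ω : Σ n : ℕ, (Fin n → E)) : Finset E := Finset.univ.image ω.2

/-- Points that are chosen independently according to `Λ` are almost surely distinct. -/
def Diffuse (Λ : Measure E) : Prop :=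
  ∀ (σ : Type) [Fintype σ], ∀ᵐ q ∂(Measure.pi fun _ : σ => Λ), Function.Injective q

/-- Measurability of a function of a tuple of points of a finite set `X` and of the set `X`, where
`X` is given by an enumeration. -/
def TupleMeasurable (Λ : Measure E) {ι : Type} (g : (ι → E) → Finset E → ℝ) : Prop :=
  ∀ (σ : Type) [Fintype σ] (f : ι → σ), AEStronglyMeasurable
    (fun q : σ → E => g (q ∘ f) (Finset.univ.image q)) (Measure.pi fun _ => Λ)

/-- The sum of `g x X` over all tuples `x` of points of `X`. -/
def tupleSum {ι : Type} [Fintype ι] [DecidableEq ι] (g : (ι → E) → Finset E → ℝ) (X : Finset E) :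
    ℝ :=
  ∑ x : ι → X, g (fun i => (x i : E)) X

open scoped Classical in
/-- The surjective maps from `ι` to `{0, …, j - 1}`. -/
def surjections (ι : Type) [Fintype ι] [DecidableEq ι] (j : ℕ) : Finset (ι → Fin j) :=
  {f | Function.Surjective f}

omit [MeasurableSpace E] in
theorem image_sumElim {σ τ : Type*} [Fintype σ] [Fintype τ] (y : σ → E) (w : τ → E) :
    Finset.univ.image (Sum.elim y w) = Finset.univ.image y ∪ Finset.univ.image w := by
  ext z
  simp

omit [MeasurableSpace E] in
theorem image_comp_equiv {σ τ : Type*} [Fintype σ] [Fintype τ] (y : σ → E) (e : τ ≃ σ) :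
    Finset.univ.image (y ∘ e) = Finset.univ.image y := by
  ext z
  simp only [Finset.mem_image, Finset.mem_univ, true_and, Function.comp]
  exact (e.surjective.exists (p := fun a => y a = z)).symm

variable {ι : Type} [Fintype ι] [DecidableEq ι]

omit [MeasurableSpace E] in
theorem tupleSum_image {σ : Type*} [Fintype σ] [DecidableEq σ] {q : σ → E}
    (hq : Function.Injective q) (g : (ι → E) → Finset E → ℝ) :
    tupleSum g (Finset.univ.image q) = ∑ h : ι → σ, g (q ∘ h) (Finset.univ.image q) := by
  set e : σ ≃ (Finset.univ.image q : Finset E) :=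
    Equiv.ofBijective (fun i => ⟨q i, by simp⟩)
      ⟨fun i j hij => hq (congrArg Subtype.val hij), fun z => by
        obtain ⟨i, -, hi⟩ := Finset.mem_image.1 z.2
        exact ⟨i, Subtype.ext hi⟩⟩
  rw [tupleSum, ← Equiv.sum_comp (Equiv.arrowCongr (Equiv.refl ι) e)]
  rfl

omit [MeasurableSpace E] [DecidableEq E] in
theorem abs_tupleSum_le {g : (ι → E) → Finset E → ℝ} {K a : ℝ}
    (hK : ∀ x X, |g x X| ≤ K * a ^ X.card) (X : Finset E) :
    |tupleSum g X| ≤ (X.card : ℝ) ^ Fintype.card ι * (K * a ^ X.card) := by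
  refine (Finset.abs_sum_le_sum_abs _ _).trans ?_
  refine (Finset.sum_le_sum fun x _ => hK _ X).trans ?_
  rw [Finset.sum_const, nsmul_eq_mul, Finset.card_univ]
  simp

theorem pow_le_factorial_mul_exp (n k : ℕ) : (n : ℝ) ^ k ≤ (k ! : ℝ) * Real.exp 1 ^ n := by
  have := Real.pow_div_factorial_le_exp (n : ℝ) (by positivity) k
  rw [div_le_iff₀ (by positivity)] at this
  rw [← Real.exp_nat_mul, mul_one]
  linarith

theorem TupleMeasurable.aestronglyMeasurable_tupleSum {Λ : Measure E} (hΛ : Diffuse Λ)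
    {g : (ι → E) → Finset E → ℝ} (hg : TupleMeasurable Λ g) (σ : Type) [Fintype σ] :
    AEStronglyMeasurable (fun q : σ → E => tupleSum g (Finset.univ.image q))
      (Measure.pi fun _ => Λ) := by
  classical
  have h1 : AEStronglyMeasurable (fun q : σ → E => ∑ h : ι → σ, g (q ∘ h) (Finset.univ.image q))
      (Measure.pi fun _ => Λ) :=
    Finset.aestronglyMeasurable_fun_sum _ fun h _ => hg σ h
  refine h1.congr ?_
  filter_upwards [hΛ σ] with q hq
  exact (tupleSum_image hq g).symm

variable (Λ : Measure E) [IsFiniteMeasure Λ]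

theorem integrable_tupleSum (hΛ : Diffuse Λ)
    {g : (ι → E) → Finset E → ℝ} (hg : TupleMeasurable Λ g) {K a : ℝ} (ha : 1 ≤ a)
    (hK0 : 0 ≤ K) (hK : ∀ x X, |g x X| ≤ K * a ^ X.card) :
    Integrable (fun ω => tupleSum g (pts ω)) (poissonProcessLaw Λ) := by
  refine integrable_poissonProcessLaw Λ
    (fun n => hg.aestronglyMeasurable_tupleSum hΛ (Fin n))
    ((Fintype.card ι)! * K) (Real.exp 1 * a) fun n => Filter.Eventually.of_forall fun q => ?_
  have hc : (pts ⟨n, q⟩).card ≤ n :=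
    (Finset.card_image_le : (Finset.univ.image q).card ≤ _).trans_eq (by simp)
  calc _ ≤ ((pts ⟨n, q⟩).card : ℝ) ^ Fintype.card ι * (K * a ^ (pts ⟨n, q⟩).card) :=
        abs_tupleSum_le hK _
    _ ≤ (n : ℝ) ^ Fintype.card ι * (K * a ^ n) := by
        gcongr
    _ ≤ ((Fintype.card ι)! * Real.exp 1 ^ n) * (K * a ^ n) := by
        gcongr
        exact pow_le_factorial_mul_exp _ _
    _ = _ := by
        rw [mul_pow]
        ring

omit [Fintype ι] [DecidableEq ι] in
theorem TupleMeasurable.sumElim {Λ : Measure E} [IsFiniteMeasure Λ]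
    {g : (ι → E) → Finset E → ℝ} (hg : TupleMeasurable Λ g) (σ τ : Type) [Fintype σ] [Fintype τ]
    (f : ι → σ) :
    AEStronglyMeasurable (fun p : (σ → E) × (τ → E) =>
      g (p.1 ∘ f) (Finset.univ.image p.1 ∪ Finset.univ.image p.2))
      ((Measure.pi fun _ => Λ).prod (Measure.pi fun _ => Λ)) := by
  have := (hg (σ ⊕ τ) (Sum.inl ∘ f)).comp_measurePreserving (measurePreserving_sumElim Λ σ τ)
  convert this using 1
  ext p
  simp only [Function.comp_apply, image_sumElim]
  rfl

omit [DecidableEq E] in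
theorem real_pi_prod_pi_univ (j m : ℕ) :
    ((Measure.pi fun _ : Fin j => Λ).prod (Measure.pi fun _ : Fin m => Λ)).real univ =
      Λ.real univ ^ (j + m) := by
  rw [← univ_prod_univ, measureReal_prod_prod, real_pi_univ, real_pi_univ, Fintype.card_fin,
    Fintype.card_fin, pow_add]

/-- The **Mecke formula** for the sums over all tuples of points of a Poisson process `X`: after
sorting the tuples according to their coincidences, which are encoded by a surjection
`ι → {0, …, j - 1}` up to a permutation of its values, the distinct points can be integrated
independently of `X`, and are added to it. -/
theorem integral_tupleSum (hΛ : Diffuse Λ)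
    {g : (ι → E) → Finset E → ℝ} (hg : TupleMeasurable Λ g) {K a : ℝ} (ha : 1 ≤ a)
    (hK0 : 0 ≤ K) (hK : ∀ x X, |g x X| ≤ K * a ^ X.card) :
    ∫ ω, tupleSum g (pts ω) ∂poissonProcessLaw Λ =
      ∑ j ∈ Finset.range (Fintype.card ι + 1), ∑ f ∈ surjections ι j, (j ! : ℝ)⁻¹ *
        ∫ y : Fin j → E, ∫ ω, g (y ∘ f) (Finset.univ.image y ∪ pts ω) ∂poissonProcessLaw Λ
          ∂(Measure.pi fun _ => Λ) := by
  classical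
  set I : ∀ (j m : ℕ), (ι → Fin j) → ℝ := fun j m f =>
    ∫ p : (Fin j → E) × (Fin m → E), g (p.1 ∘ f) (Finset.univ.image p.1 ∪ Finset.univ.image p.2)
      ∂((Measure.pi fun _ => Λ).prod (Measure.pi fun _ => Λ)) with hI
  have hbd : ∀ (j m : ℕ) (f : ι → Fin j) (p : (Fin j → E) × (Fin m → E)),
      |g (p.1 ∘ f) (Finset.univ.image p.1 ∪ Finset.univ.image p.2)| ≤ K * a ^ (j + m) := by
    intro j m f p
    refine (hK _ _).trans ?_
    gcongr
    refine (Finset.card_union_le _ _).trans (add_le_add ?_ ?_)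
    · simpa using (Finset.card_image_le : (Finset.univ.image p.1).card ≤ _)
    · simpa using (Finset.card_image_le : (Finset.univ.image p.2).card ≤ _)
  have hint : ∀ (j m : ℕ) (f : ι → Fin j), Integrable (fun p : (Fin j → E) × (Fin m → E) =>
      g (p.1 ∘ f) (Finset.univ.image p.1 ∪ Finset.univ.image p.2))
      ((Measure.pi fun _ => Λ).prod (Measure.pi fun _ => Λ)) := fun j m f =>
    Integrable.of_bound (hg.sumElim (Fin j) (Fin m) f) (K * a ^ (j + m))
      (Filter.Eventually.of_forall fun p => hbd j m f p)
  have hIbd : ∀ j m f, |I j m f| ≤ K * (a * Λ.real univ) ^ (j + m) := by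
    intro j m f
    have := norm_integral_le_of_norm_le_const (μ := (Measure.pi fun _ : Fin j => Λ).prod
      (Measure.pi fun _ : Fin m => Λ)) (C := K * a ^ (j + m)) (f := fun p =>
        g (p.1 ∘ f) (Finset.univ.image p.1 ∪ Finset.univ.image p.2))
        (Filter.Eventually.of_forall fun p => hbd j m f p)
    rw [real_pi_prod_pi_univ, Real.norm_eq_abs] at this
    rw [mul_pow, ← mul_assoc]
    exact this
  -- sort the tuples of points by the set `s` of the indices that occur in them
  have hsub : ∀ n, ∫ q : Fin n → E, tupleSum g (Finset.univ.image q) ∂(Measure.pi fun _ => Λ) =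
      ∑ s : Finset (Fin n), ∑ f ∈ surjections ι s.card, I s.card (n - s.card) f := by
    intro n
    have h1 : ∫ q : Fin n → E, tupleSum g (Finset.univ.image q) ∂(Measure.pi fun _ => Λ) =
        ∫ q : Fin n → E, ∑ h : ι → Fin n, g (q ∘ h) (Finset.univ.image q)
          ∂(Measure.pi fun _ => Λ) := by
      refine integral_congr_ae ?_
      filter_upwards [hΛ (Fin n)] with q hq
      exact tupleSum_image hq g
    rw [h1, integral_finsetSum]
    · rw [← Finset.sum_fiberwise Finset.univ (fun h : ι → Fin n => Finset.univ.image h)]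
      refine Finset.sum_congr rfl fun s _ => ?_
      obtain ⟨e, he⟩ := exists_equiv_sum s
      symm
      refine Finset.sum_bij (fun f _ => fun i => e (Sum.inl (f i))) ?_ ?_ ?_ ?_
      · intro f hf
        have hf' : Function.Surjective f := by simpa [surjections] using hf
        simp only [Finset.mem_filter, Finset.mem_univ, true_and]
        ext i
        rw [he]
        simp only [Finset.mem_image, Finset.mem_univ, true_and]
        constructor
        · rintro ⟨b, hb⟩
          exact ⟨f b, hb⟩
        · rintro ⟨b, hb⟩
          obtain ⟨c, rfl⟩ := hf' b
          exact ⟨c, hb⟩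
      · intro f _ f' _ hff
        ext1 i
        have := congrFun hff i
        simpa using this
      · intro h hh
        simp only [Finset.mem_filter, Finset.mem_univ, true_and] at hh
        have h2 : ∀ i, ∃ b, e (Sum.inl b) = h i := fun i => by
          rw [← he, ← hh]
          simp
        choose f hf using h2
        refine ⟨f, ?_, funext hf⟩
        simp only [surjections, Finset.mem_filter, Finset.mem_univ, true_and]
        intro b
        have : e (Sum.inl b) ∈ Finset.univ.image h := hh.symm ▸ (he _).2 ⟨b, rfl⟩
        obtain ⟨i, -, hi⟩ := Finset.mem_image.1 this
        refine ⟨i, ?_⟩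
        rw [← hf i] at hi
        simpa using hi
      · intro f _
        rw [hI, integral_eq_integral_sumElim Λ e]
        refine integral_congr_ae (Filter.Eventually.of_forall fun p => ?_)
        simp only
        rw [image_comp_equiv, image_sumElim]
        congr 1
        ext i
        simp
    · intro h _
      refine Integrable.of_bound (hg (Fin n) h) (K * a ^ n)
        (Filter.Eventually.of_forall fun q => ?_)
      refine (hK _ _).trans ?_
      gcongr
      simpa using (Finset.card_image_le : (Finset.univ.image q).card ≤ _)
  have hΦ : ∀ j m, |∑ f ∈ surjections ι j, I j m f| ≤
      ((Fintype.card ι)! * K) * (Real.exp 1 * (a * Λ.real univ)) ^ (j + m) := by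
    intro j m
    have hl : 0 ≤ Λ.real univ := measureReal_nonneg
    calc _ ≤ ∑ f ∈ surjections ι j, K * (a * Λ.real univ) ^ (j + m) :=
          (Finset.abs_sum_le_sum_abs _ _).trans (Finset.sum_le_sum fun f _ => hIbd j m f)
      _ = ((surjections ι j).card : ℝ) * (K * (a * Λ.real univ) ^ (j + m)) := by
          rw [Finset.sum_const, nsmul_eq_mul]
      _ ≤ ((j : ℝ) ^ Fintype.card ι) * (K * (a * Λ.real univ) ^ (j + m)) := by
          gcongr
          have : (surjections ι j).card ≤ j ^ Fintype.card ι := by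
            refine (Finset.card_le_univ _).trans ?_
            simp
          exact_mod_cast this
      _ ≤ ((Fintype.card ι)! * Real.exp 1 ^ (j + m)) * (K * (a * Λ.real univ) ^ (j + m)) := by
          gcongr
          refine (pow_le_factorial_mul_exp _ _).trans ?_
          gcongr
          · exact Real.one_le_exp zero_le_one
          · omega
      _ = _ := by
          rw [mul_pow (Real.exp 1)]
          ring
  obtain ⟨hs, heq⟩ := integral_eq_tsum_of_subsets Λ (integrable_tupleSum Λ hΛ hg ha hK0 hK) hΦ hsub
  -- the sum over the number `m` of the remaining points is an expectation for the process
  rw [heq, hs.tsum_prod, tsum_eq_sum (s := Finset.range (Fintype.card ι + 1)), Finset.mul_sum]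
  · refine Finset.sum_congr rfl fun j _ => ?_
    have h3 : ∀ f : ι → Fin j, Summable fun m => I j m f / (m ! : ℝ) := by
      intro f
      refine Summable.of_norm_bounded
        ((Real.summable_pow_div_factorial (a * Λ.real univ)).mul_left
          (K * (a * Λ.real univ) ^ j)) fun m => ?_
      rw [Real.norm_eq_abs, abs_div, Nat.abs_cast, ← mul_div_assoc, mul_assoc, ← pow_add]
      gcongr
      exact hIbd j m f
    have h4 : ∀ m : ℕ, (∑ f ∈ surjections ι j, I j m f) / ((j ! : ℝ) * (m ! : ℝ)) =
        ∑ f ∈ surjections ι j, (j ! : ℝ)⁻¹ * (I j m f / (m ! : ℝ)) := by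
      intro m
      rw [Finset.sum_div]
      refine Finset.sum_congr rfl fun f _ => ?_
      field_simp
    simp only [h4]
    rw [Summable.tsum_finsetSum fun f _ => (h3 f).mul_left _, Finset.mul_sum]
    refine Finset.sum_congr rfl fun f _ => ?_
    have h5 : Integrable (fun z : (Fin j → E) × (Σ n : ℕ, (Fin n → E)) =>
        g (z.1 ∘ f) (Finset.univ.image z.1 ∪ pts z.2))
        ((Measure.pi fun _ => Λ).prod (poissonProcessLaw Λ)) :=
      integrable_prod_poissonProcessLaw Λ (fun m => hg.sumElim (Fin j) (Fin m) f) (K * a ^ j) a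
        fun m => Filter.Eventually.of_forall fun z => by
          have := hbd j m f z
          rwa [pow_add, ← mul_assoc] at this
    rw [← integral_prod _ h5, integral_prod_poissonProcessLaw Λ h5, tsum_mul_left]
    simp only [pts, hI]
    ring
  · intro j hj
    have : surjections ι j = ∅ := by
      rw [Finset.eq_empty_iff_forall_notMem]
      intro f hf
      have hf' : Function.Surjective f := by simpa [surjections] using hf
      have := Fintype.card_le_of_surjective f hf'
      rw [Fintype.card_fin] at this
      exact hj (Finset.mem_range.2 (Nat.lt_succ_of_le this))
    simp [this]

end Mecke

section Independence

variable {E : Type*} [MeasurableSpace E] [DecidableEq E] (Λ : Measure E) [IsFiniteMeasure Λ]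

open scoped Classical in
/-- The expectation of a product of functions of the points in `H` and of the points outside `H`:
the double series over the numbers of points in the two sets factorizes. -/
theorem integral_mul_eq_of_local {H : Set E} (hH : MeasurableSet H) {Φ Ψ : Finset E → ℝ}
    (hΦm : ∀ n, AEStronglyMeasurable (fun q : Fin n → E => Φ (Finset.univ.image q))
      (Measure.pi fun _ => Λ))
    (hΨm : ∀ n, AEStronglyMeasurable (fun q : Fin n → E => Ψ (Finset.univ.image q))
      (Measure.pi fun _ => Λ))
    {K : ℝ} (hΦK : ∀ X, |Φ X| ≤ K) (hΨK : ∀ X, |Ψ X| ≤ K)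
    (hΦ : ∀ X, Φ X = Φ {x ∈ X | x ∈ H}) (hΨ : ∀ X, Ψ X = Ψ {x ∈ X | x ∉ H}) :
    ∫ ω, Φ (pts ω) * Ψ (pts ω) ∂poissonProcessLaw Λ = Real.exp (-Λ.real univ) *
      ((∑' j : ℕ, (∫ q : Fin j → E in univ.pi fun _ => H, Φ (Finset.univ.image q)
          ∂(Measure.pi fun _ => Λ)) / (j ! : ℝ)) *
        ∑' m : ℕ, (∫ q : Fin m → E in univ.pi fun _ => Hᶜ, Ψ (Finset.univ.image q)
          ∂(Measure.pi fun _ => Λ)) / (m ! : ℝ)) := by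
  have hK0 : 0 ≤ K := (abs_nonneg _).trans (hΦK ∅)
  have hHpi : ∀ j, MeasurableSet (univ.pi fun _ : Fin j => H) := fun j =>
    MeasurableSet.univ_pi fun _ => hH
  have hHcpi : ∀ j, MeasurableSet (univ.pi fun _ : Fin j => Hᶜ) := fun j =>
    MeasurableSet.univ_pi fun _ => hH.compl
  have hbd : ∀ (G : Finset E → ℝ) (_ : ∀ X, |G X| ≤ K) (S : ∀ j : ℕ, Set (Fin j → E)) (j : ℕ),
      |∫ q in S j, G (Finset.univ.image q) ∂(Measure.pi fun _ : Fin j => Λ)| ≤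
        K * Λ.real univ ^ j := by
    intro G hG S j
    have := norm_setIntegral_le_of_norm_le_const
      (μ := Measure.pi fun _ : Fin j => Λ) (s := S j) (C := K)
      (f := fun q => G (Finset.univ.image q)) (measure_lt_top _ _) fun q _ => hG _
    rw [Real.norm_eq_abs] at this
    refine this.trans ?_
    gcongr
    refine (measureReal_mono (subset_univ _)).trans ?_
    rw [real_pi_univ, Fintype.card_fin]
  have hsum : ∀ (G : Finset E → ℝ) (_ : ∀ X, |G X| ≤ K) (S : ∀ j : ℕ, Set (Fin j → E)),
      Summable fun j : ℕ => ‖(∫ q in S j, G (Finset.univ.image q)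
        ∂(Measure.pi fun _ : Fin j => Λ)) / (j ! : ℝ)‖ := by
    intro G hG S
    refine Summable.of_nonneg_of_le (fun _ => norm_nonneg _) (fun j => ?_)
      ((Real.summable_pow_div_factorial (Λ.real univ)).mul_left K)
    rw [Real.norm_eq_abs, abs_div, Nat.abs_cast, ← mul_div_assoc]
    gcongr
    exact hbd G hG S j
  have hint : ∀ n, Integrable (fun q : Fin n → E =>
      Φ (Finset.univ.image q) * Ψ (Finset.univ.image q)) (Measure.pi fun _ => Λ) := fun n =>
    Integrable.of_bound ((hΦm n).mul (hΨm n)) (K * K) (Filter.Eventually.of_forall fun q => by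
      rw [norm_mul]
      exact mul_le_mul (hΦK _) (hΨK _) (norm_nonneg _) hK0)
  have hmeas : ∀ {n : ℕ} (s : Finset (Fin n)),
      MeasurableSet {q : Fin n → E | ∀ i, q i ∈ H ↔ i ∈ s} := by
    intro n s
    have : {q : Fin n → E | ∀ i, q i ∈ H ↔ i ∈ s} =
        ⋂ i, (if i ∈ s then (fun q : Fin n → E => q i) ⁻¹' H else
          (fun q : Fin n → E => q i) ⁻¹' Hᶜ) := by
      ext q
      simp only [mem_ofPred_eq, mem_iInter]
      refine forall_congr' fun i => ?_
      split_ifs with hi <;> simp [hi]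
    rw [this]
    refine MeasurableSet.iInter fun i => ?_
    split_ifs
    · exact measurable_pi_apply i hH
    · exact measurable_pi_apply i hH.compl
  obtain ⟨-, heq⟩ := integral_eq_tsum_of_subsets Λ
    (F := fun ω => Φ (pts ω) * Ψ (pts ω))
    (Φ := fun j m => (∫ q : Fin j → E in univ.pi fun _ => H, Φ (Finset.univ.image q)
          ∂(Measure.pi fun _ => Λ)) * ∫ q : Fin m → E in univ.pi fun _ => Hᶜ,
            Ψ (Finset.univ.image q) ∂(Measure.pi fun _ => Λ))
    (K := K * K) (a := Λ.real univ)
    (integrable_poissonProcessLaw Λ (fun n => (hΦm n).mul (hΨm n)) (K * K) 1 fun n =>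
      Filter.Eventually.of_forall fun q => by
        rw [abs_mul, one_pow, mul_one]
        exact mul_le_mul (hΦK _) (hΨK _) (abs_nonneg _) hK0)
    (fun j m => by
      rw [abs_mul, pow_add]
      calc _ ≤ (K * Λ.real univ ^ j) * (K * Λ.real univ ^ m) := by
            gcongr
            · exact hbd Φ hΦK (fun j => univ.pi fun _ : Fin j => H) j
            · exact hbd Ψ hΨK (fun j => univ.pi fun _ : Fin j => Hᶜ) m
        _ = _ := by ring)
    (fun n => by
      -- sort the configurations according to the set `s` of the indices of the points in `H`
      have h1 : ∫ q : Fin n → E, Φ (Finset.univ.image q) * Ψ (Finset.univ.image q)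
            ∂(Measure.pi fun _ => Λ) =
          ∑ s : Finset (Fin n), ∫ q in {q : Fin n → E | ∀ i, q i ∈ H ↔ i ∈ s},
            Φ (Finset.univ.image q) * Ψ (Finset.univ.image q) ∂(Measure.pi fun _ => Λ) := by
        rw [← integral_iUnion_fintype]
        · rw [← setIntegral_univ]
          congr 2
          symm
          rw [eq_univ_iff_forall]
          intro q
          rw [mem_iUnion]
          exact ⟨({i | q i ∈ H} : Finset (Fin n)), fun i => by simp⟩
        · exact hmeas
        · intro s t hst
          rw [Function.onFun, Set.disjoint_left]
          intro q hs ht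
          exact hst (Finset.ext fun i => (hs i).symm.trans (ht i))
        · exact fun s => (hint n).integrableOn
      change ∫ q : Fin n → E, Φ (Finset.univ.image q) * Ψ (Finset.univ.image q)
            ∂(Measure.pi fun _ => Λ) = _
      rw [h1]
      refine Finset.sum_congr rfl fun s _ => ?_
      obtain ⟨e, he⟩ := exists_equiv_sum s
      rw [← integral_indicator (hmeas s), integral_eq_integral_sumElim Λ e,
        ← integral_indicator (hHpi _), ← integral_indicator (hHcpi _), ← integral_prod_mul]
      refine integral_congr_ae (Filter.Eventually.of_forall fun p => ?_)
      have hmem : Sum.elim p.1 p.2 ∘ e.symm ∈ {q : Fin n → E | ∀ i, q i ∈ H ↔ i ∈ s} ↔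
          p.1 ∈ (univ.pi fun _ => H) ∧ p.2 ∈ (univ.pi fun _ => Hᶜ) := by
        simp only [mem_ofPred_eq, mem_pi, mem_univ, true_imp_iff, Function.comp]
        rw [e.symm.forall_congr_left]
        simp only [Equiv.symm_symm, Equiv.symm_apply_apply, he, EmbeddingLike.apply_eq_iff_eq,
          Sum.forall, Sum.elim_inl, Sum.elim_inr, Sum.inl.injEq, exists_eq, iff_true,
          reduceCtorEq, exists_false, iff_false, mem_compl_iff]
      simp only
      by_cases hp : p.1 ∈ (univ.pi fun _ => H) ∧ p.2 ∈ (univ.pi fun _ => Hᶜ)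
      · rw [indicator_of_mem (hmem.2 hp), indicator_of_mem hp.1, indicator_of_mem hp.2,
          image_comp_equiv, image_sumElim, hΦ, hΨ]
        congr 2
        · ext x
          simp only [Finset.mem_filter, Finset.mem_union, Finset.mem_image, Finset.mem_univ,
            true_and]
          constructor
          · rintro ⟨⟨i, rfl⟩ | ⟨i, rfl⟩, hx⟩
            · exact ⟨i, rfl⟩
            · exact absurd hx (hp.2 i (mem_univ i))
          · rintro ⟨i, rfl⟩
            exact ⟨Or.inl ⟨i, rfl⟩, hp.1 i (mem_univ i)⟩
        · ext x
          simp only [Finset.mem_filter, Finset.mem_union, Finset.mem_image, Finset.mem_univ,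
            true_and]
          constructor
          · rintro ⟨⟨i, rfl⟩ | ⟨i, rfl⟩, hx⟩
            · exact absurd (hp.1 i (mem_univ i)) hx
            · exact ⟨i, rfl⟩
          · rintro ⟨i, rfl⟩
            exact ⟨Or.inr ⟨i, rfl⟩, hp.2 i (mem_univ i)⟩
      · rw [indicator_of_notMem fun h => hp (hmem.1 h)]
        rw [not_and_or] at hp
        rcases hp with hp | hp
        · rw [indicator_of_notMem hp, zero_mul]
        · rw [indicator_of_notMem hp, mul_zero])
  rw [heq, tsum_mul_tsum_of_summable_norm
    (hsum Φ hΦK fun j => univ.pi fun _ : Fin j => H)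
    (hsum Ψ hΨK fun j => univ.pi fun _ : Fin j => Hᶜ)]
  congr 1
  refine tsum_congr fun p => ?_
  rw [div_mul_div_comm]

open scoped Classical in
/-- The Poisson process in a set and in its complement are independent. -/
theorem integral_mul_eq_mul_integral_of_local {H : Set E} (hH : MeasurableSet H)
    {Φ Ψ : Finset E → ℝ}
    (hΦm : ∀ n, AEStronglyMeasurable (fun q : Fin n → E => Φ (Finset.univ.image q))
      (Measure.pi fun _ => Λ))
    (hΨm : ∀ n, AEStronglyMeasurable (fun q : Fin n → E => Ψ (Finset.univ.image q))
      (Measure.pi fun _ => Λ))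
    {K : ℝ} (hΦK : ∀ X, |Φ X| ≤ K) (hΨK : ∀ X, |Ψ X| ≤ K)
    (hΦ : ∀ X, Φ X = Φ {x ∈ X | x ∈ H}) (hΨ : ∀ X, Ψ X = Ψ {x ∈ X | x ∉ H}) :
    ∫ ω, Φ (pts ω) * Ψ (pts ω) ∂poissonProcessLaw Λ =
      (∫ ω, Φ (pts ω) ∂poissonProcessLaw Λ) * ∫ ω, Ψ (pts ω) ∂poissonProcessLaw Λ := by
  have h1m : ∀ n, AEStronglyMeasurable (fun q : Fin n → E => (fun _ : Finset E => (1 : ℝ))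
      (Finset.univ.image q)) (Measure.pi fun _ => Λ) := fun n => aestronglyMeasurable_const
  have h1K : ∀ X : Finset E, |(fun _ : Finset E => (1 : ℝ)) X| ≤ max K 1 := by simp
  have hΦK' : ∀ X, |Φ X| ≤ max K 1 := fun X => (hΦK X).trans (le_max_left _ _)
  have hΨK' : ∀ X, |Ψ X| ≤ max K 1 := fun X => (hΨK X).trans (le_max_left _ _)
  -- the normalization is found by inserting the constant function `1` for `Φ`, for `Ψ`, or both
  have e1 := integral_mul_eq_of_local Λ hH hΦm hΨm hΦK hΨK hΦ hΨ
  have e2 := integral_mul_eq_of_local Λ hH hΦm h1m hΦK' h1K hΦ fun _ => rfl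
  have e3 := integral_mul_eq_of_local Λ hH h1m hΨm h1K hΨK' (fun _ => rfl) hΨ
  have e4 := integral_mul_eq_of_local Λ hH h1m h1m h1K h1K (fun _ => rfl) fun _ => rfl
  simp only [mul_one, one_mul, integral_const, probReal_univ, smul_eq_mul] at e2 e3 e4
  rw [e1, e2, e3]
  linear_combination (Real.exp (-Λ.real univ) *
      ((∑' j : ℕ, (∫ q : Fin j → E in univ.pi fun _ => H, Φ (Finset.univ.image q)
          ∂(Measure.pi fun _ => Λ)) / (j ! : ℝ)) *
        ∑' m : ℕ, (∫ q : Fin m → E in univ.pi fun _ => Hᶜ, Ψ (Finset.univ.image q)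
          ∂(Measure.pi fun _ => Λ)) / (m ! : ℝ))) * e4

end Independence

/-! ### Densities of the moment and cumulant measures -/

section TupleIntegral

variable {E : Type*} [MeasurableSpace E] [DecidableEq E] (Λ : Measure E)
variable {ι : Type} [Fintype ι] [DecidableEq ι]

/-- The expected sum of `D` over all tuples of points of the Poisson process. -/
def tupleIntegral (D : (ι → E) → ℝ) : ℝ :=
  ∫ ω, tupleSum (fun x _ => D x) (pts ω) ∂poissonProcessLaw Λ

theorem tupleIntegral_reindex {ι' : Type} [Fintype ι'] [DecidableEq ι'] (e : ι ≃ ι')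
    (D : (ι' → E) → ℝ) :
    tupleIntegral Λ (fun x : ι → E => D (x ∘ e.symm)) = tupleIntegral Λ D := by
  unfold tupleIntegral tupleSum
  congr 1
  ext ω
  rw [← Equiv.sum_comp (Equiv.arrowCongr e (Equiv.refl (pts ω)))]
  rfl

variable [IsFiniteMeasure Λ]

theorem tupleIntegral_eq (hΛ : Diffuse Λ) {D : (ι → E) → ℝ}
    (hD : TupleMeasurable Λ (fun x _ => D x)) {K : ℝ} (hK0 : 0 ≤ K) (hK : ∀ x, |D x| ≤ K) :
    tupleIntegral Λ D = ∑ j ∈ Finset.range (Fintype.card ι + 1), ∑ f ∈ surjections ι j,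
      (j ! : ℝ)⁻¹ * ∫ y : Fin j → E, D (y ∘ f) ∂(Measure.pi fun _ => Λ) := by
  rw [tupleIntegral, integral_tupleSum Λ hΛ hD le_rfl hK0 (by simpa using hK)]
  simp

theorem tupleIntegral_finsetSum (hΛ : Diffuse Λ) {β : Type*} (s : Finset β)
    {D : β → (ι → E) → ℝ} (hD : ∀ b ∈ s, TupleMeasurable Λ (fun x _ => D b x)) {K : ℝ}
    (hK0 : 0 ≤ K) (hK : ∀ b ∈ s, ∀ x, |D b x| ≤ K) :
    tupleIntegral Λ (fun x => ∑ b ∈ s, D b x) = ∑ b ∈ s, tupleIntegral Λ (D b) := by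
  unfold tupleIntegral
  rw [← integral_finsetSum]
  · congr 1
    ext ω
    unfold tupleSum
    rw [Finset.sum_comm]
  · intro b hb
    exact integrable_tupleSum Λ hΛ (hD b hb) le_rfl hK0 (by simpa using hK b hb)

omit [DecidableEq E] in
theorem ae_prod_injective (hΛ : Diffuse Λ) (j : ℕ) :
    ∀ᵐ y ∂(Measure.pi fun _ : Fin j => Λ), ∀ᵐ ω ∂poissonProcessLaw Λ,
      Function.Injective (Sum.elim y ω.2) := by
  refine Measure.ae_ae_of_ae_prod (p := fun z : (Fin j → E) × (Σ n : ℕ, (Fin n → E)) =>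
    Function.Injective (Sum.elim z.1 z.2.2)) ?_
  rw [prod_poissonProcessLaw]
  refine (ae_mixture_iff (poissonWeight_ne_zero Λ) fun n =>
    MeasurableEmbedding.id.prodMap (measurableEmbedding_realization n)).2 fun n => ?_
  exact (measurePreserving_sumElim Λ (Fin j) (Fin n)).quasiMeasurePreserving.ae
    (hΛ (Fin j ⊕ Fin n))

open scoped Classical in
/-- Off the coincidences, the tuples of points of a Poisson process that are indexed by a disjoint
union behave like pairs of independent tuples. -/
theorem tupleIntegral_sum (hΛ : Diffuse Λ) {γ : Type} [Fintype γ] [DecidableEq γ]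
    {G : (ι → E) → ℝ} {H : (γ → E) → ℝ} (hG : TupleMeasurable Λ (fun x _ => G x))
    (hH : TupleMeasurable Λ (fun x _ => H x)) {K : ℝ} (hGK : ∀ x, |G x| ≤ K)
    (hHK : ∀ x, |H x| ≤ K) (hK0 : 0 ≤ K) :
    tupleIntegral Λ (fun u : ι ⊕ γ → E => G (u ∘ Sum.inl) * H (u ∘ Sum.inr) *
      if ∀ b c, u (Sum.inl b) ≠ u (Sum.inr c) then 1 else 0) =
      tupleIntegral Λ G * tupleIntegral Λ H := by
  -- the sum over the second tuple is a function of the first tuple and of the configuration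
  set g : (ι → E) → Finset E → ℝ := fun x X =>
    G x * ∑ z : γ → X, H (fun c => (z c : E)) *
      if ∀ b c, x b ≠ (z c : E) then 1 else 0 with hgdef
  have hinj : ∀ (σ : Type) [Fintype σ] (q : σ → E) (_ : Function.Injective q) (f : ι → σ),
      g (q ∘ f) (Finset.univ.image q) = G (q ∘ f) * ∑ h : γ → σ, H (q ∘ h) *
        if ∀ b c, f b ≠ h c then 1 else 0 := by
    intro σ _ q hq f
    have := tupleSum_image hq (fun (z : γ → E) _ =>
      H z * if ∀ b c, (q ∘ f) b ≠ z c then 1 else 0)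
    simp only [tupleSum] at this
    simp only [hgdef]
    rw [this]
    congr 1
    refine Finset.sum_congr rfl fun h _ => ?_
    simp only [Function.comp, ne_eq, hq.eq_iff]
  have hgm : TupleMeasurable Λ g := by
    intro σ _ f
    have h1 : AEStronglyMeasurable (fun q : σ → E => G (q ∘ f) * ∑ h : γ → σ, H (q ∘ h) *
        if ∀ b c, f b ≠ h c then 1 else 0) (Measure.pi fun _ => Λ) :=
      (hG σ f).mul (Finset.aestronglyMeasurable_fun_sum _ fun h _ =>
        (hH σ h).mul aestronglyMeasurable_const)
    refine h1.congr ?_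
    filter_upwards [hΛ σ] with q hq
    exact (hinj σ q hq f).symm
  have hgb : ∀ x X, |g x X| ≤ (K * (K * (Fintype.card γ)!)) * Real.exp 1 ^ X.card := by
    intro x X
    rw [hgdef, abs_mul]
    have h1 : |∑ z : γ → X, H (fun c => (z c : E)) *
        if ∀ b c, x b ≠ (z c : E) then (1 : ℝ) else 0| ≤ (X.card : ℝ) ^ Fintype.card γ * K := by
      refine (Finset.abs_sum_le_sum_abs _ _).trans ?_
      refine (Finset.sum_le_card_nsmul _ _ K fun z _ => ?_).trans ?_
      · rw [abs_mul]
        refine (mul_le_mul (hHK _) (?_ : _ ≤ (1 : ℝ)) (abs_nonneg _) hK0).trans_eq (mul_one K)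
        split_ifs <;> simp
      · rw [nsmul_eq_mul]
        simp
    calc _ ≤ K * ((X.card : ℝ) ^ Fintype.card γ * K) :=
          mul_le_mul (hGK x) h1 (abs_nonneg _) hK0
      _ ≤ K * (((Fintype.card γ)! * Real.exp 1 ^ X.card) * K) := by
          gcongr
          exact pow_le_factorial_mul_exp _ _
      _ = _ := by ring
  have hLHS : tupleIntegral Λ (fun u : ι ⊕ γ → E => G (u ∘ Sum.inl) * H (u ∘ Sum.inr) *
      if ∀ b c, u (Sum.inl b) ≠ u (Sum.inr c) then 1 else 0) =
      ∫ ω, tupleSum g (pts ω) ∂poissonProcessLaw Λ := by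
    unfold tupleIntegral
    congr 1
    ext ω
    unfold tupleSum
    rw [← Equiv.sum_comp (Equiv.sumArrowEquivProdArrow ι γ (pts ω)).symm, Fintype.sum_prod_type]
    refine Finset.sum_congr rfl fun x _ => ?_
    rw [hgdef]
    simp only
    rw [Finset.mul_sum]
    refine Finset.sum_congr rfl fun z _ => ?_
    rw [← mul_assoc]
    rfl
  rw [hLHS, integral_tupleSum Λ hΛ hgm (Real.one_le_exp zero_le_one) (by positivity) hgb,
    tupleIntegral_eq Λ hΛ hG hK0 hGK, Finset.sum_mul]
  refine Finset.sum_congr rfl fun j _ => ?_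
  rw [Finset.sum_mul]
  refine Finset.sum_congr rfl fun f hf => ?_
  have hf' : Function.Surjective f := by simpa [surjections] using hf
  rw [mul_assoc]
  congr 1
  rw [← integral_mul_const]
  refine integral_congr_ae ?_
  filter_upwards [ae_prod_injective Λ hΛ j] with y hy
  rw [tupleIntegral, ← integral_const_mul]
  refine integral_congr_ae ?_
  filter_upwards [hy] with ω hω
  have hω2 : Function.Injective ω.2 := fun a b hab => Sum.inr_injective (hω hab)
  have h2 := hinj _ (Sum.elim y ω.2) hω (Sum.inl ∘ f)
  rw [image_sumElim] at h2
  have h3 : Sum.elim y ω.2 ∘ Sum.inl ∘ f = y ∘ f := rfl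
  rw [h3] at h2
  rw [pts, h2]
  congr 1
  rw [tupleSum_image hω2]
  symm
  -- the second tuple avoids the added points exactly if it consists of points of the process
  refine Fintype.sum_of_injective (fun h' : γ → Fin ω.1 => (Sum.inr ∘ h' : γ → Fin j ⊕ Fin ω.1))
    (fun a b hab => funext fun c => Sum.inr_injective (congrFun hab c)) _ _ ?_ ?_
  · intro h hh
    rw [if_neg, mul_zero]
    intro hne
    refine hh ?_
    have : ∀ c, ∃ i, h c = Sum.inr i := by
      intro c
      rcases hc : h c with a | i
      · obtain ⟨b, rfl⟩ := hf' a
        exact absurd hc.symm (hne b c)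
      · exact ⟨i, rfl⟩
    choose h' hh' using this
    exact ⟨h', funext fun c => (hh' c).symm⟩
  · intro h'
    rw [if_pos, mul_one]
    · rfl
    · intro b c
      simp

end TupleIntegral

section Density

/-- The value at `∅` is a convention: the empty set does not occur in the recursion. -/
theorem weightedCumulant_empty {ι : Type*} [LinearOrder ι] (m : Finset ι → ℝ)
    (χ : Finset ι → Finset ι → ℝ) : weightedCumulant m χ ∅ = 0 := by
  rw [weightedCumulant, dif_neg Finset.not_nonempty_empty]

variable {E : Type*} [MeasurableSpace E] [DecidableEq E] (Λ : Measure E)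

/-- Measurability of a functional `ζ` along the enumerations of configurations. Only the values
`ζ p X` at points `p ∈ X` are constrained. -/
def ScoreMeasurable (ζ : E → Finset E → ℝ) : Prop :=
  ∀ (σ : Type) [Fintype σ] (a : σ) (I : Finset σ), a ∈ I →
    AEStronglyMeasurable (fun q : σ → E => ζ (q a) (I.image q)) (Measure.pi fun _ => Λ)

/-- The density of the moment measure: the expected product of the values of `ζ` at the points of
the tuple `x`, which are added to the Poisson process. -/
def momentDensity (ζ : E → Finset E → ℝ) {ι : Type*} [Fintype ι] (x : ι → E) : ℝ :=
  ∫ ω, ∏ i, ζ (x i) (Finset.univ.image x ∪ pts ω) ∂poissonProcessLaw Λ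

/-- The moment density of the subtuple of `v` with indices in `L`. -/
def momentDensityOn (ζ : E → Finset E → ℝ) {ι : Type*} (v : ι → E) (L : Finset ι) : ℝ :=
  momentDensity Λ ζ fun i : L => v i

open scoped Classical in
/-- The indicator that the subtuples of `v` with indices in `B` and in `D` have no common points.
-/
def separated {E ι : Type*} (v : ι → E) (B D : Finset ι) : ℝ :=
  if ∀ i ∈ B, ∀ j ∈ D, v i ≠ v j then 1 else 0

/-- The density of the cumulant measure: the recursion for cumulants, in which the products are
restricted to groups of points without common points. -/
def cumulantDensity (ζ : E → Finset E → ℝ) {ι : Type*} [LinearOrder ι] (v : ι → E)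
    (L : Finset ι) : ℝ :=
  weightedCumulant (momentDensityOn Λ ζ v) (separated v) L

theorem abs_separated_le {E ι : Type*} (v : ι → E) (B D : Finset ι) : |separated v B D| ≤ 1 := by
  unfold separated
  split_ifs <;> simp

theorem separated_empty {E ι : Type*} (v : ι → E) (B : Finset ι) : separated v B ∅ = 1 := by
  simp [separated]

theorem cumulantDensity_congr (ζ : E → Finset E → ℝ) {ι : Type*} [LinearOrder ι] {v v' : ι → E}
    {L : Finset ι} (h : ∀ i ∈ L, v i = v' i) :
    cumulantDensity Λ ζ v L = cumulantDensity Λ ζ v' L := by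
  refine weightedCumulant_congr L (fun B hB => ?_) fun B hB D hD => ?_
  · unfold momentDensityOn
    congr 1
    ext i
    exact h i (hB i.2)
  · unfold separated
    congr 1
    refine propext (forall₂_congr fun i hi => forall₂_congr fun j hj => ?_)
    rw [h i (hB hi), h j (hD hj)]

variable [IsFiniteMeasure Λ] {ζ : E → Finset E → ℝ} {C : ℝ}

theorem momentDensityOn_empty {ι : Type*} (v : ι → E) : momentDensityOn Λ ζ v ∅ = 1 := by
  simp [momentDensityOn, momentDensity]

theorem abs_momentDensity_le (hζ : ∀ p X, |ζ p X| ≤ C) {ι : Type*} [Fintype ι] (x : ι → E) :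
    |momentDensity Λ ζ x| ≤ C ^ Fintype.card ι := by
  have := norm_integral_le_of_norm_le_const (μ := poissonProcessLaw Λ) (C := C ^ Fintype.card ι)
    (f := fun ω => ∏ i, ζ (x i) (Finset.univ.image x ∪ pts ω))
    (Filter.Eventually.of_forall fun ω => by
      rw [Real.norm_eq_abs, Finset.abs_prod]
      refine (Finset.prod_le_prod (fun _ _ => abs_nonneg _) fun i _ => hζ _ _).trans ?_
      simp)
  simpa [momentDensity] using this

theorem abs_momentDensityOn_le (hζ : ∀ p X, |ζ p X| ≤ C) {ι : Type*} (v : ι → E) (L : Finset ι) :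
    |momentDensityOn Λ ζ v L| ≤ C ^ L.card := by
  simpa [momentDensityOn] using abs_momentDensity_le Λ hζ fun i : L => v i

theorem abs_cumulantDensity_le (hC : 1 ≤ C) (hζ : ∀ p X, |ζ p X| ≤ C) {ι : Type*}
    [LinearOrder ι] (v : ι → E) (L : Finset ι) :
    |cumulantDensity Λ ζ v L| ≤ (L.card ! : ℝ) * 3 ^ L.card * C ^ L.card :=
  abs_weightedCumulant_le hC (abs_momentDensityOn_le Λ hζ v) (abs_separated_le v) L

theorem sum_cumulantDensity_mul {ι : Type*} [LinearOrder ι] (v : ι → E) {L : Finset ι}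
    (h : L.Nonempty) :
    ∑ B ∈ L.powerset with L.min' h ∈ B, cumulantDensity Λ ζ v B *
      momentDensityOn Λ ζ v (L \ B) * separated v B (L \ B) = momentDensityOn Λ ζ v L :=
  sum_weightedCumulant_mul (momentDensityOn_empty Λ v) (separated_empty v) h

variable {Λ}

theorem ScoreMeasurable.prod (hζm : ScoreMeasurable Λ ζ) {ι σ : Type} [Fintype ι] [Fintype σ]
    (f : ι → σ) (m : ℕ) :
    AEStronglyMeasurable (fun z : (σ → E) × (Fin m → E) =>
      ∏ i, ζ (z.1 (f i)) (Finset.univ.image (z.1 ∘ f) ∪ Finset.univ.image z.2))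
      ((Measure.pi fun _ => Λ).prod (Measure.pi fun _ => Λ)) := by
  classical
  refine Finset.aestronglyMeasurable_fun_prod _ fun i _ => ?_
  set I : Finset (σ ⊕ Fin m) :=
    Finset.univ.image (Sum.inl ∘ f) ∪ Finset.univ.image Sum.inr with hI
  have h := (hζm (σ ⊕ Fin m) (Sum.inl (f i)) I (by simp [hI])).comp_measurePreserving
    (measurePreserving_sumElim Λ σ (Fin m))
  convert h using 1
  ext z
  simp only [Function.comp_apply, Sum.elim_inl, hI]
  congr 1
  rw [Finset.image_union, Finset.image_image, Finset.image_image]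
  rfl

theorem ScoreMeasurable.momentDensity (hζm : ScoreMeasurable Λ ζ) {ι : Type} [Fintype ι] :
    TupleMeasurable Λ (fun (x : ι → E) _ => momentDensity Λ ζ x) := by
  intro σ _ f
  have h : AEStronglyMeasurable (fun z : (σ → E) × (Σ n : ℕ, (Fin n → E)) =>
      ∏ i, ζ (z.1 (f i)) (Finset.univ.image (z.1 ∘ f) ∪ pts z.2))
      ((Measure.pi fun _ => Λ).prod (poissonProcessLaw Λ)) :=
    aestronglyMeasurable_prod_poissonProcessLaw Λ fun m => hζm.prod f m
  exact h.integral_prod_right'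

omit [IsFiniteMeasure Λ] [DecidableEq E] in
theorem aestronglyMeasurable_separated (hΛ : Diffuse Λ) {ι σ : Type} [Fintype σ] (f : ι → σ)
    (B D : Finset ι) :
    AEStronglyMeasurable (fun y : σ → E => separated (y ∘ f) B D) (Measure.pi fun _ => Λ) := by
  refine (aestronglyMeasurable_const (b := separated f B D)).congr ?_
  filter_upwards [hΛ σ] with y hy
  unfold separated
  congr 1
  exact propext (forall₂_congr fun i _ => forall₂_congr fun j _ => hy.ne_iff.symm)

theorem aestronglyMeasurable_cumulantDensity (hΛ : Diffuse Λ) (hζm : ScoreMeasurable Λ ζ)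
    {ι : Type} [LinearOrder ι] {σ : Type} [Fintype σ] (f : ι → σ) (L : Finset ι) :
    AEStronglyMeasurable (fun y : σ → E => cumulantDensity Λ ζ (y ∘ f) L)
      (Measure.pi fun _ => Λ) := by
  have hm : ∀ B : Finset ι, AEStronglyMeasurable
      (fun y : σ → E => momentDensityOn Λ ζ (y ∘ f) B) (Measure.pi fun _ => Λ) := fun B =>
    hζm.momentDensity (ι := B) σ fun i => f i
  induction L using Finset.strongInduction with
  | H L ih =>
    rcases L.eq_empty_or_nonempty with rfl | h
    · simp only [cumulantDensity, weightedCumulant_empty]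
      exact aestronglyMeasurable_const
    have h1 : (fun y : σ → E => cumulantDensity Λ ζ (y ∘ f) L) = fun y =>
        momentDensityOn Λ ζ (y ∘ f) L - ∑ B ∈ L.powerset with (L.min' h ∈ B ∧ B ≠ L),
          cumulantDensity Λ ζ (y ∘ f) B * momentDensityOn Λ ζ (y ∘ f) (L \ B) *
            separated (y ∘ f) B (L \ B) := by
      ext y
      exact weightedCumulant_eq _ _ h
    rw [h1]
    refine (hm L).sub (Finset.aestronglyMeasurable_fun_sum _ fun B hB => ?_)
    simp only [Finset.mem_filter, Finset.mem_powerset] at hB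
    exact ((ih B (hB.1.ssubset_of_ne hB.2.2)).mul (hm _)).mul
      (aestronglyMeasurable_separated hΛ f _ _)

end Density

/-! ### The moment and cumulant measures -/

section PatternMeasure

variable {E S : Type*} [MeasurableSpace E] [DecidableEq E] [MeasurableSpace S] (Λ : Measure E)
  (loc : E → S) {ι : Type} [Fintype ι] [DecidableEq ι]

/-- The signed measure on `S^ι` whose integrals are the expected sums of `F (loc ∘ x) * D x` over
the tuples `x` of points of the Poisson process with intensity `Λ`, where `D` does not depend on
the process: the tuples are sorted according to their coincidences. -/
def patternMeasure (D : (ι → E) → ℝ) : SignedMeasure (ι → S) :=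
  ∑ j ∈ Finset.range (Fintype.card ι + 1), ∑ f ∈ surjections ι j, (j ! : ℝ)⁻¹ •
    ((Measure.pi fun _ : Fin j => Λ).withDensityᵥ fun y => D (y ∘ f)).map
      fun y i => loc (y (f i))

/-- The indicator that the locations of the tuple `x` lie in the sets `A i`. -/
def boxIndicator (A : ι → Set S) (x : ι → E) : ℝ :=
  ∏ i, (A i).indicator 1 (loc (x i))

variable {loc}

omit [MeasurableSpace E] [DecidableEq E] [MeasurableSpace S] [DecidableEq ι] in
theorem abs_boxIndicator_le (A : ι → Set S) (x : ι → E) : |boxIndicator loc A x| ≤ 1 := by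
  rw [boxIndicator, Finset.abs_prod]
  refine Finset.prod_le_one (fun _ _ => abs_nonneg _) fun i _ => ?_
  by_cases h : loc (x i) ∈ A i <;> simp [h]

omit [DecidableEq E] [Fintype ι] [DecidableEq ι] in
theorem measurable_indicator_loc (hloc : Measurable loc) {A : ι → Set S}
    (hA : ∀ i, MeasurableSet (A i)) {σ : Type} (f : ι → σ) (i : ι) :
    Measurable fun q : σ → E => (A i).indicator (1 : S → ℝ) (loc (q (f i))) :=
  (measurable_one.indicator (hA i)).comp (hloc.comp (measurable_pi_apply _))

omit [DecidableEq E] [DecidableEq ι] in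
theorem measurable_boxIndicator (hloc : Measurable loc) {A : ι → Set S}
    (hA : ∀ i, MeasurableSet (A i)) {σ : Type} (f : ι → σ) :
    Measurable fun q : σ → E => boxIndicator loc A (q ∘ f) :=
  Finset.measurable_fun_prod _ fun i _ => measurable_indicator_loc hloc hA f i

omit [DecidableEq ι] in
theorem TupleMeasurable.mul_boxIndicator {Λ : Measure E} {D : (ι → E) → ℝ}
    (hD : TupleMeasurable Λ fun x _ => D x) (hloc : Measurable loc) {A : ι → Set S}
    (hA : ∀ i, MeasurableSet (A i)) :
    TupleMeasurable Λ fun x _ => D x * boxIndicator loc A x := fun σ _ f =>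
  (hD σ f).mul (measurable_boxIndicator hloc hA f).aestronglyMeasurable

variable [IsFiniteMeasure Λ]

theorem patternMeasure_pi (hΛ : Diffuse Λ) (hloc : Measurable loc) {D : (ι → E) → ℝ}
    (hD : TupleMeasurable Λ fun x _ => D x) {K : ℝ} (hK0 : 0 ≤ K) (hK : ∀ x, |D x| ≤ K)
    {A : ι → Set S} (hA : ∀ i, MeasurableSet (A i)) :
    patternMeasure Λ loc D (univ.pi A) =
      tupleIntegral Λ fun x => D x * boxIndicator loc A x := by
  have hb : ∀ x : ι → E, |D x * boxIndicator loc A x| ≤ K := fun x => by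
    rw [abs_mul]
    exact (mul_le_mul (hK x) (abs_boxIndicator_le A x) (abs_nonneg _) hK0).trans_eq (mul_one K)
  rw [tupleIntegral_eq Λ hΛ (hD.mul_boxIndicator hloc hA) hK0 hb, patternMeasure]
  simp only [FunLike.coe_sum, Finset.sum_apply, FunLike.coe_smul, Pi.smul_apply,
    smul_eq_mul]
  refine Finset.sum_congr rfl fun j _ => Finset.sum_congr rfl fun f _ => ?_
  congr 1
  have hm : Measurable fun (y : Fin j → E) (i : ι) => loc (y (f i)) :=
    measurable_pi_iff.2 fun i => hloc.comp (measurable_pi_apply _)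
  have hint : Integrable (fun y : Fin j → E => D (y ∘ f)) (Measure.pi fun _ => Λ) :=
    Integrable.of_bound (hD (Fin j) f) K (Filter.Eventually.of_forall fun y => hK _)
  rw [VectorMeasure.map_apply _ hm (MeasurableSet.univ_pi hA),
    withDensityᵥ_apply hint (hm (MeasurableSet.univ_pi hA)),
    ← integral_indicator (hm (MeasurableSet.univ_pi hA))]
  congr 1
  ext y
  by_cases h : ∀ i, loc (y (f i)) ∈ A i
  · rw [indicator_of_mem (by simpa using h)]
    simp [boxIndicator, h]
  · rw [indicator_of_notMem (by simpa using h)]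
    obtain ⟨i, hi⟩ := not_forall.1 h
    rw [boxIndicator, Finset.prod_eq_zero (Finset.mem_univ i), mul_zero]
    simp [hi]

/-- The total variation of a pattern measure is at most the sum of the total masses of its
densities. -/
theorem abs_integral_patternMeasure_le {D : (ι → E) → ℝ}
    (hD : TupleMeasurable Λ fun x _ => D x) {K : ℝ} (hK : ∀ x, |D x| ≤ K) {V : ℝ}
    (hV : ∑ j ∈ Finset.range (Fintype.card ι + 1), ∑ f ∈ surjections ι j, (j ! : ℝ)⁻¹ *
      ∫ y : Fin j → E, |D (y ∘ f)| ∂(Measure.pi fun _ => Λ) ≤ V)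
    {F : (ι → S) → ℝ} {T : ℝ} (hT : 0 ≤ T) (hF : ∀ v, |F v| ≤ T) :
    |∫ᵛ v, F v ∂•(patternMeasure Λ loc D)| ≤ T * V := by
  set c := patternMeasure Λ loc D with hc
  have hint : ∀ (j : ℕ) (f : ι → Fin j),
      Integrable (fun y : Fin j → E => D (y ∘ f)) (Measure.pi fun _ => Λ) := fun j f =>
    Integrable.of_bound (hD (Fin j) f) K (Filter.Eventually.of_forall fun y => hK _)
  have hvar : c.variation univ ≤ ENNReal.ofReal V := by
    refine le_trans ?_ (ENNReal.ofReal_le_ofReal hV)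
    rw [ENNReal.ofReal_sum_of_nonneg fun j _ => Finset.sum_nonneg fun f _ => by positivity]
    refine ((VectorMeasure.variation_finsetSum_le _ _) univ).trans ?_
    rw [Measure.finsetSum_apply]
    refine Finset.sum_le_sum fun j _ => ?_
    rw [ENNReal.ofReal_sum_of_nonneg fun f _ => by positivity]
    refine ((VectorMeasure.variation_finsetSum_le _ _) univ).trans ?_
    rw [Measure.finsetSum_apply]
    refine Finset.sum_le_sum fun f _ => ?_
    rw [VectorMeasure.variation_smul, ENNReal.ofReal_mul (by positivity),
      Measure.smul_apply, ENNReal.smul_def, smul_eq_mul]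
    refine mul_le_mul' ?_ ?_
    · rw [← ENNReal.ofReal_coe_nnreal, coe_nnnorm, Real.norm_of_nonneg (by positivity)]
    · refine (VectorMeasure.variation_map_le univ).trans ?_
      have hm : AEMeasurable (fun (y : Fin j → E) (i : ι) => loc (y (f i)))
          ((Measure.pi fun _ : Fin j => Λ).withDensityᵥ fun y => D (y ∘ f)).variation ∨
          ¬ AEMeasurable (fun (y : Fin j → E) (i : ι) => loc (y (f i)))
          ((Measure.pi fun _ : Fin j => Λ).withDensityᵥ fun y => D (y ∘ f)).variation := em _
      rcases hm with hm | hm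
      · rw [Measure.map_apply_of_aemeasurable hm MeasurableSet.univ, preimage_univ,
          Measure.variation_withDensityᵥ (hint j f), withDensity_apply _ MeasurableSet.univ,
          setLIntegral_univ, ← ofReal_integral_norm_eq_lintegral_enorm (hint j f)]
        rfl
      · rw [Measure.map_of_not_aemeasurable hm]
        simp
  have hfin : IsFiniteMeasure c.variation := ⟨hvar.trans_lt ENNReal.ofReal_lt_top⟩
  have h1 := VectorMeasure.norm_integral_le_of_norm_le_const (μ := c)
    (B := ContinuousLinearMap.lsmul ℝ ℝ) (f := F) (C := T)
    (Filter.Eventually.of_forall fun v => hF v)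
  rw [Real.norm_eq_abs] at h1
  refine h1.trans ?_
  have hV0 : 0 ≤ V := le_trans (Finset.sum_nonneg fun j _ => Finset.sum_nonneg fun f _ => by
    positivity) hV
  have h2 : c.variation.real univ ≤ V := by
    rw [measureReal_def]
    exact (ENNReal.toReal_mono ENNReal.ofReal_ne_top hvar).trans_eq (ENNReal.toReal_ofReal hV0)
  have h3 : ‖(ContinuousLinearMap.lsmul ℝ ℝ : ℝ →L[ℝ] ℝ →L[ℝ] ℝ)‖ ≤ 1 :=
    ContinuousLinearMap.opNorm_lsmul_le
  calc _ ≤ T * 1 * V := by gcongr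
    _ = T * V := by ring

end PatternMeasure

section Cumulant

variable {E S : Type*} [MeasurableSpace E] [DecidableEq E] [MeasurableSpace S] {Λ : Measure E}
  [IsFiniteMeasure Λ] {loc : E → S} {ζ : E → Finset E → ℝ} {C : ℝ}

/-- The moment measures of a random measure `∑_{p ∈ X} ζ (p; X) δ_{loc p}`, for a Poisson process
`X`, have the density `momentDensity`. -/
theorem isMomentMeasure_patternMeasure (hΛ : Diffuse Λ) (hloc : Measurable loc)
    (hζm : ScoreMeasurable Λ ζ) (hC : 1 ≤ C) (hζ : ∀ p X, |ζ p X| ≤ C)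
    {ν : (Σ n : ℕ, (Fin n → E)) → SignedMeasure S}
    (hν : ∀ᵐ ω ∂poissonProcessLaw Λ, ∀ A, MeasurableSet A →
      ν ω A = ∑ p ∈ pts ω, ζ p (pts ω) * A.indicator 1 (loc p))
    {ι : Type} [Fintype ι] [DecidableEq ι] :
    IsMomentMeasure ν (poissonProcessLaw Λ)
      (patternMeasure Λ loc fun x : ι → E => momentDensity Λ ζ x) := by
  intro A hA
  set g : (ι → E) → Finset E → ℝ := fun x X =>
    ∏ i, ζ (x i) X * (A i).indicator 1 (loc (x i)) with hg
  have heq : (fun ω => ∏ i, ν ω (A i)) =ᵐ[poissonProcessLaw Λ] fun ω => tupleSum g (pts ω) := by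
    filter_upwards [hν] with ω hω
    have : ∀ i, ν ω (A i) = ∑ p : pts ω, ζ p (pts ω) * (A i).indicator 1 (loc p) := fun i => by
      rw [hω _ (hA i), ← Finset.sum_coe_sort]
    simp only [this]
    rw [Fintype.prod_sum]
    rfl
  have hgm : TupleMeasurable Λ g := fun σ _ f =>
    Finset.aestronglyMeasurable_fun_prod _ fun i _ =>
      (hζm σ (f i) Finset.univ (Finset.mem_univ _)).mul
        (measurable_indicator_loc hloc hA f i).aestronglyMeasurable
  have hgb : ∀ x X, |g x X| ≤ C ^ Fintype.card ι * 1 ^ X.card := by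
    intro x X
    rw [hg, one_pow, mul_one, Finset.abs_prod]
    refine (Finset.prod_le_prod (fun _ _ => abs_nonneg _) (g := fun _ => C) fun i _ => ?_).trans ?_
    · rw [abs_mul]
      refine (mul_le_mul (hζ _ _) (?_ : _ ≤ (1 : ℝ)) (abs_nonneg _) (by positivity)).trans_eq
        (mul_one C)
      by_cases h : loc (x i) ∈ A i <;> simp [h]
    · simp
  refine ⟨(integrable_congr heq).2 (integrable_tupleSum Λ hΛ hgm le_rfl (by positivity) hgb), ?_⟩
  have hmb : ∀ x : ι → E, |momentDensity Λ ζ x * boxIndicator loc A x| ≤ C ^ Fintype.card ι :=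
    fun x => by
      rw [abs_mul]
      exact (mul_le_mul (abs_momentDensity_le Λ hζ x) (abs_boxIndicator_le A x) (abs_nonneg _)
        (by positivity)).trans_eq (mul_one _)
  rw [integral_congr_ae heq, integral_tupleSum Λ hΛ hgm le_rfl (by positivity) hgb,
    patternMeasure_pi Λ hΛ hloc hζm.momentDensity (by positivity) (abs_momentDensity_le Λ hζ) hA,
    tupleIntegral_eq Λ hΛ (hζm.momentDensity.mul_boxIndicator hloc hA) (by positivity) hmb]
  refine Finset.sum_congr rfl fun j _ => Finset.sum_congr rfl fun f hf => ?_
  have hf' : Function.Surjective f := by simpa [surjections] using hf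
  congr 2
  ext y
  rw [momentDensity, ← integral_mul_const]
  congr 1
  ext ω
  rw [hg, boxIndicator, ← Finset.prod_mul_distrib]
  have himg : Finset.univ.image (y ∘ f) = Finset.univ.image y := by
    rw [← Finset.image_image, Finset.image_univ_of_surjective hf']
  rw [himg]

variable {ι : Type} [Fintype ι] [LinearOrder ι]

omit [Fintype ι] in
theorem tupleMeasurable_cumulantDensity (hΛ : Diffuse Λ) (hζm : ScoreMeasurable Λ ζ) {κ : Type}
    (r : ι → κ) (L : Finset ι) :
    TupleMeasurable Λ fun (x : κ → E) _ => cumulantDensity Λ ζ (x ∘ r) L := fun _ _ f =>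
  aestronglyMeasurable_cumulantDensity hΛ hζm (f ∘ r) L

variable (Λ loc ζ)

/-- The value of the moment measure of the indices in `L` at the product of the sets `A i`. -/
def boxMoment (A : ι → Set S) (L : Finset ι) : ℝ :=
  tupleIntegral Λ fun x : L → E => momentDensity Λ ζ x * boxIndicator loc (fun i : L => A i) x

/-- The retraction of `ι` onto the nonempty set `L`, which maps the indices that are not in `L` to
an element of `L`. It turns a tuple with indices in `L` into one with indices in `ι`, for which
`cumulantDensity` is defined. -/
def retraction {L : Finset ι} (h : L.Nonempty) (i : ι) : L :=
  if hi : i ∈ L then ⟨i, hi⟩ else ⟨L.min' h, L.min'_mem h⟩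

/-- The value of the cumulant measure of the indices in `L` at the product of the sets `A i`. -/
def boxCumulant (A : ι → Set S) (L : Finset ι) : ℝ :=
  if h : L.Nonempty then
    tupleIntegral Λ fun x : L → E =>
      cumulantDensity Λ ζ (x ∘ retraction h) L * boxIndicator loc (fun i : L => A i) x
  else 0

variable {Λ loc ζ}

omit [Fintype ι] in
theorem retraction_of_mem {L : Finset ι} (h : L.Nonempty) {i : ι} (hi : i ∈ L) :
    retraction h i = ⟨i, hi⟩ := dif_pos hi

omit [MeasurableSpace S] [Fintype ι] in
theorem boxMoment_empty (A : ι → Set S) : boxMoment Λ loc ζ A ∅ = 1 := by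
  simp [boxMoment, tupleIntegral, tupleSum, momentDensity, boxIndicator]

omit [Fintype ι] in
/-- The moments are the sums over the block of a fixed index of the products of cumulants and
moments. -/
theorem boxMoment_eq_sum (hΛ : Diffuse Λ) (hloc : Measurable loc)
    (hζm : ScoreMeasurable Λ ζ) (hC : 1 ≤ C) (hζ : ∀ p X, |ζ p X| ≤ C)
    {A : ι → Set S} (hA : ∀ i, MeasurableSet (A i)) {L : Finset ι} (h : L.Nonempty) :
    boxMoment Λ loc ζ A L = ∑ B ∈ L.powerset with L.min' h ∈ B,
      boxCumulant Λ loc ζ A B * boxMoment Λ loc ζ A (L \ B) := by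
  have hmd : ∀ x : L → E, momentDensity Λ ζ x = momentDensityOn Λ ζ (x ∘ retraction h) L := by
    intro x
    unfold momentDensityOn
    congr 1
    ext i
    simp [retraction_of_mem h i.2]
  have h1 : boxMoment Λ loc ζ A L = tupleIntegral Λ fun x : L → E =>
      ∑ B ∈ L.powerset with L.min' h ∈ B, cumulantDensity Λ ζ (x ∘ retraction h) B *
        momentDensityOn Λ ζ (x ∘ retraction h) (L \ B) * separated (x ∘ retraction h) B (L \ B) *
          boxIndicator loc (fun i : L => A i) x := by
    unfold boxMoment
    congr 1
    ext x
    rw [hmd, ← sum_cumulantDensity_mul Λ _ h, Finset.sum_mul]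
  set K : ℝ := (L.card ! : ℝ) * 3 ^ L.card * C ^ L.card with hK
  have hK1 : C ^ L.card ≤ K := by
    have h2 : (1 : ℝ) ≤ (L.card ! : ℝ) := by exact_mod_cast Nat.one_le_of_lt (Nat.factorial_pos _)
    have h3 : (1 : ℝ) ≤ 3 ^ L.card := one_le_pow₀ (by norm_num)
    exact le_mul_of_one_le_left (by positivity) (one_le_mul_of_one_le_of_one_le h2 h3)
  have hK0 : 0 ≤ K := by positivity
  have hcum : ∀ B ⊆ L, ∀ v : ι → E, |cumulantDensity Λ ζ v B| ≤ K := by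
    intro B hB v
    refine (abs_cumulantDensity_le Λ hC hζ v B).trans ?_
    have hcard := Finset.card_le_card hB
    rw [hK]
    gcongr
    · norm_num
  have hmom : ∀ B ⊆ L, ∀ {κ : Type} [Fintype κ] (_ : Fintype.card κ = B.card) (x : κ → E),
      |momentDensity Λ ζ x| ≤ K := by
    intro B hB κ _ hκ x
    refine (abs_momentDensity_le Λ hζ x).trans (le_trans ?_ hK1)
    rw [hκ]
    exact pow_le_pow_right₀ hC (Finset.card_le_card hB)
  have hmul : ∀ {a b : ℝ}, |a| ≤ K → |b| ≤ 1 → |a * b| ≤ K := fun ha hb => by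
    rw [abs_mul]
    exact (mul_le_mul ha hb (abs_nonneg _) hK0).trans_eq (mul_one K)
  have key : ∀ B ∈ ({B ∈ L.powerset | L.min' h ∈ B} : Finset (Finset ι)), ∃ D : (L → E) → ℝ,
      (D = fun x : L → E => cumulantDensity Λ ζ (x ∘ retraction h) B *
        momentDensityOn Λ ζ (x ∘ retraction h) (L \ B) * separated (x ∘ retraction h) B (L \ B) *
          boxIndicator loc (fun i : L => A i) x) ∧
      tupleIntegral Λ D = boxCumulant Λ loc ζ A B * boxMoment Λ loc ζ A (L \ B) := by
    intro B hB
    simp only [Finset.mem_filter, Finset.mem_powerset] at hB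
    obtain ⟨hBL, haB⟩ := hB
    have hBne : B.Nonempty := ⟨_, haB⟩
    refine ⟨_, rfl, ?_⟩
    rw [boxCumulant, dif_pos hBne, boxMoment]
    have hcm : TupleMeasurable Λ fun (x : B → E) _ =>
        cumulantDensity Λ ζ (x ∘ retraction hBne) B * boxIndicator loc (fun i : B => A i) x :=
      TupleMeasurable.mul_boxIndicator (fun σ _ f =>
        aestronglyMeasurable_cumulantDensity hΛ hζm (f ∘ retraction hBne) B) hloc fun i => hA i
    have hmm : TupleMeasurable Λ fun (x : (L \ B : Finset ι) → E) _ =>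
        momentDensity Λ ζ x * boxIndicator loc (fun i : (L \ B : Finset ι) => A i) x :=
      hζm.momentDensity.mul_boxIndicator hloc fun i => hA i
    rw [← tupleIntegral_sum Λ hΛ hcm hmm (K := K)
      (fun x => hmul (hcum B hBL _) (abs_boxIndicator_le _ _))
      (fun x => hmul (hmom (L \ B) Finset.sdiff_subset (by simp) x) (abs_boxIndicator_le _ _)) hK0]
    -- the indices in `L` are those in `B` and those in `L \ B`
    let e : (B ⊕ (L \ B : Finset ι)) ≃ L :=
      { toFun := Sum.elim (fun i => ⟨i, hBL i.2⟩) fun i => ⟨i, (Finset.mem_sdiff.1 i.2).1⟩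
        invFun := fun i => if hi : (i : ι) ∈ B then Sum.inl ⟨i, hi⟩
          else Sum.inr ⟨i, Finset.mem_sdiff.2 ⟨i.2, hi⟩⟩
        left_inv := by
          rintro (i | i)
          · simp
          · have := (Finset.mem_sdiff.1 i.2).2
            simp [this]
        right_inv := by
          intro i
          by_cases hi : (i : ι) ∈ B <;> simp [hi] }
    have he1 : ∀ b : B, e (Sum.inl b) = ⟨b, hBL b.2⟩ := fun b => rfl
    have he2 : ∀ b : (L \ B : Finset ι), e (Sum.inr b) = ⟨b, (Finset.mem_sdiff.1 b.2).1⟩ :=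
      fun b => rfl
    rw [← tupleIntegral_reindex Λ e.symm]
    congr 1
    ext x
    simp only [Equiv.symm_symm]
    have hc : cumulantDensity Λ ζ (x ∘ retraction h) B =
        cumulantDensity Λ ζ (((x ∘ e) ∘ Sum.inl) ∘ retraction hBne) B := by
      refine cumulantDensity_congr Λ ζ fun i hi => ?_
      simp [retraction_of_mem hBne hi, retraction_of_mem h (hBL hi), he1]
    have hm : momentDensityOn Λ ζ (x ∘ retraction h) (L \ B) =
        momentDensity Λ ζ ((x ∘ e) ∘ Sum.inr) := by
      unfold momentDensityOn
      congr 1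
      ext i
      simp [retraction_of_mem h (Finset.mem_sdiff.1 i.2).1, he2]
    have hs : separated (x ∘ retraction h) B (L \ B) =
        if ∀ b c, (x ∘ e) (Sum.inl b) ≠ (x ∘ e) (Sum.inr c) then 1 else 0 := by
      unfold separated
      congr 1
      refine propext ⟨fun hh b c => ?_, fun hh i hi j hj => ?_⟩
      · have := hh b b.2 c c.2
        simpa [retraction_of_mem h (hBL b.2), retraction_of_mem h (Finset.mem_sdiff.1 c.2).1, he1,
          he2] using this
      · have := hh ⟨i, hi⟩ ⟨j, hj⟩
        simpa [retraction_of_mem h (hBL hi), retraction_of_mem h (Finset.mem_sdiff.1 hj).1, he1,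
          he2] using this
    have hb : boxIndicator loc (fun i : L => A i) x =
        boxIndicator loc (fun i : B => A i) ((x ∘ e) ∘ Sum.inl) *
          boxIndicator loc (fun i : (L \ B : Finset ι) => A i) ((x ∘ e) ∘ Sum.inr) := by
      unfold boxIndicator
      rw [← Equiv.prod_comp e, Fintype.prod_sum_type]
      rfl
    rw [hc, hm, hs, hb]
    ring
  rw [h1, tupleIntegral_finsetSum Λ hΛ _ (K := K * K) ?_ (by positivity) ?_]
  · refine Finset.sum_congr rfl fun B hB => ?_
    obtain ⟨D, rfl, hD⟩ := key B hB
    exact hD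
  · intro B hB
    refine TupleMeasurable.mul_boxIndicator (fun σ _ f => ?_) hloc fun i => hA i
    refine ((aestronglyMeasurable_cumulantDensity hΛ hζm (f ∘ retraction h) B).mul
      (hζm.momentDensity (ι := (L \ B : Finset ι)) σ fun i => f (retraction h i))).mul ?_
    exact aestronglyMeasurable_separated hΛ (f ∘ retraction h) B (L \ B)
  · intro B hB x
    simp only [Finset.mem_filter, Finset.mem_powerset] at hB
    rw [abs_mul, abs_mul, abs_mul]
    have h2 := hcum B hB.1 (x ∘ retraction h)
    have h3 := (abs_momentDensityOn_le Λ hζ (x ∘ retraction h) (L \ B)).trans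
      ((pow_le_pow_right₀ hC (Finset.card_le_card Finset.sdiff_subset)).trans hK1)
    have h4 := abs_separated_le (x ∘ retraction h) B (L \ B)
    have h5 := abs_boxIndicator_le (loc := loc) (fun i : L => A i) x
    calc _ ≤ K * K * 1 * 1 := by gcongr
      _ = K * K := by ring

/-- The cumulant measure of a random measure `∑_{p ∈ X} ζ (p; X) δ_{loc p}`, for a Poisson process
`X`, has the density `cumulantDensity`. -/
theorem isCumulantMeasure_patternMeasure (hΛ : Diffuse Λ) (hloc : Measurable loc)
    (hζm : ScoreMeasurable Λ ζ) (hC : 1 ≤ C) (hζ : ∀ p X, |ζ p X| ≤ C)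
    {ν : (Σ n : ℕ, (Fin n → E)) → SignedMeasure S}
    (hν : ∀ᵐ ω ∂poissonProcessLaw Λ, ∀ A, MeasurableSet A →
      ν ω A = ∑ p ∈ pts ω, ζ p (pts ω) * A.indicator 1 (loc p)) {k : ℕ} (hk : k ≠ 0) :
    IsCumulantMeasure ν (poissonProcessLaw Λ) k
      (patternMeasure Λ loc fun x : Fin k → E => cumulantDensity Λ ζ x Finset.univ) := by
  refine ⟨fun L => patternMeasure Λ loc fun x : L → E => momentDensity Λ ζ x,
    fun L => isMomentMeasure_patternMeasure hΛ hloc hζm hC hζ hν, fun A hA => ?_⟩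
  have hne : (Finset.univ : Finset (Fin k)).Nonempty := ⟨⟨0, Nat.pos_of_ne_zero hk⟩, by simp⟩
  have hM : ∀ L : Finset (Fin k), patternMeasure Λ loc (fun x : L → E => momentDensity Λ ζ x)
      (univ.pi fun i : L => A i) = boxMoment Λ loc ζ A L := fun L =>
    patternMeasure_pi Λ hΛ hloc hζm.momentDensity (by positivity) (abs_momentDensity_le Λ hζ)
      fun i => hA i
  have hmem : (Finset.univ : Finset (Fin k)).min' hne ∈ (Finset.univ : Finset (Fin k)) :=
    Finset.mem_univ _
  have hrec := eq_partitionCumulant (m := boxMoment Λ loc ζ A) (c := boxCumulant Λ loc ζ A)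
    (boxMoment_empty A) hmem fun L _ hL => by
      have hLne : L.Nonempty := ⟨_, hL⟩
      have hmin : L.min' hLne = (Finset.univ : Finset (Fin k)).min' hne :=
        le_antisymm (L.min'_le _ hL) (Finset.min'_le _ _ (Finset.mem_univ _))
      rw [← hmin]
      exact boxMoment_eq_sum hΛ hloc hζm hC hζ hA hLne
  have hc : patternMeasure Λ loc (fun x : Fin k → E => cumulantDensity Λ ζ x Finset.univ)
      (univ.pi A) = boxCumulant Λ loc ζ A Finset.univ := by
    rw [patternMeasure_pi Λ hΛ hloc (D := fun x : Fin k → E => cumulantDensity Λ ζ x Finset.univ)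
      (tupleMeasurable_cumulantDensity hΛ hζm id _)
      (by positivity) (fun x => abs_cumulantDensity_le Λ hC hζ x _) hA, boxCumulant, dif_pos hne]
    let e : Fin k ≃ (Finset.univ : Finset (Fin k)) :=
      { toFun := fun i => ⟨i, Finset.mem_univ i⟩
        invFun := fun i => i
        left_inv := fun i => rfl
        right_inv := fun i => rfl }
    rw [← tupleIntegral_reindex Λ e]
    congr 1
    ext x
    congr 1
    · refine cumulantDensity_congr Λ ζ fun i hi => ?_
      simp only [Function.comp]
      rw [retraction_of_mem hne hi]
      rfl
    · unfold boxIndicator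
      rw [← Equiv.prod_comp e]
      rfl
  rw [hc, hrec, partitionCumulant, partitionSum]
  simp only [hM]

end Cumulant

/-! ### Marked configurations with random locations -/

section Generic

variable {X : Type*} [MeasurableSpace X]

/-- Independent points with a diffuse law are almost surely distinct. -/
theorem ae_injective_pi [MeasurableEq X] (μ : Measure X) [SigmaFinite μ]
    [NullSingletonClass μ] (σ : Type*) [Fintype σ] :
    ∀ᵐ x ∂(Measure.pi fun _ : σ => μ), Function.Injective x := by
  classical
  have h : ∀ i j : σ, i ≠ j → ∀ᵐ x ∂(Measure.pi fun _ : σ => μ), x i ≠ x j := by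
    intro i j hij
    let _ : Fintype {l : σ // l = i} := Subtype.fintype _
    have h1 : ∀ᵐ z ∂((Measure.pi fun _ : {l : σ // l = i} => μ).prod
        (Measure.pi fun _ : {l : σ // ¬ l = i} => μ)), z.1 ⟨i, rfl⟩ ≠ z.2 ⟨j, hij.symm⟩ := by
      rw [Measure.ae_prod_iff_ae_ae]
      · refine Filter.Eventually.of_forall fun u => ?_
        filter_upwards [Measure.ae_eval_ne (μ := fun _ : {l : σ // ¬ l = i} => μ)
          ⟨j, hij.symm⟩ (u ⟨i, rfl⟩)] with w hw
        exact hw.symm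
      · exact (measurableSet_eq_fun (by fun_prop) (by fun_prop)).compl
    exact (measurePreserving_piEquivPiSubtypeProd (fun _ : σ => μ)
      (fun l => l = i)).quasiMeasurePreserving.ae h1
  have h2 : ∀ᵐ x ∂(Measure.pi fun _ : σ => μ), ∀ i j : σ, i ≠ j → x i ≠ x j := by
    simp only [ae_all_iff]
    exact h
  filter_upwards [h2] with x hx i j hij
  exact not_imp_not.1 (hx i j) hij

/-- A subfamily of independent random variables with a common law. -/
theorem measurePreserving_comp_injective {Y : Type*} [MeasurableSpace Y] (Q : Measure Y)
    [IsProbabilityMeasure Q] {σ τ : Type*} [Fintype σ] [Fintype τ] {g : τ → σ}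
    (hg : Function.Injective g) :
    MeasurePreserving (fun t : σ → Y => t ∘ g) (Measure.pi fun _ => Q) (Measure.pi fun _ => Q) := by
  classical
  let _ : Fintype {s : σ // s ∈ range g} := Subtype.fintype _
  let e : τ ≃ {s : σ // s ∈ range g} := Equiv.ofInjective g hg
  have h1 := (measurePreserving_comp_equiv Q e).comp
    (measurePreserving_fst.comp (measurePreserving_piEquivPiSubtypeProd (fun _ : σ => Q)
      (fun s => s ∈ range g)))
  convert h1 using 1
  rfl

/-- Replace the marks of the points of `q` with indices in `V` by those of `τ`. -/
def resample {S Y σ : Type*} (V : Set σ) (q : σ → S × Y) (τ : σ → Y) : σ → S × Y := by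
  classical exact fun i => if i ∈ V then ((q i).1, τ i) else q i

/-- If points carry marks that are independent of each other and of the locations, then a property
which almost surely holds after a resampling of some of the marks does already hold. -/
theorem ae_of_ae_resample {S Y : Type*} [MeasurableSpace S] [MeasurableSpace Y] {σ : Type*}
    [Fintype σ] (ρ : σ → Measure S) [∀ i, SigmaFinite (ρ i)] (Q : Measure Y)
    [IsProbabilityMeasure Q] (V : Set σ) {h : (σ → S × Y) → Prop} (hm : MeasurableSet {q | h q}) :
    ∀ᵐ q ∂(Measure.pi fun i => (ρ i).prod Q),
      (∀ᵐ τ ∂(Measure.pi fun _ : σ => Q), h (resample V q τ)) → h q := by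
  classical
  have hpres : MeasurePreserving (fun z : (σ → S × Y) × (σ → Y) => resample V z.1 z.2)
      ((Measure.pi fun i => (ρ i).prod Q).prod (Measure.pi fun _ => Q))
      (Measure.pi fun i => (ρ i).prod Q) := by
    have h1 : ∀ i, MeasurePreserving (fun z : (S × Y) × Y => if i ∈ V then (z.1.1, z.2) else z.1)
        (((ρ i).prod Q).prod Q) ((ρ i).prod Q) := by
      intro i
      by_cases hi : i ∈ V
      · simp only [hi, if_true]
        exact measurePreserving_fst.prod (MeasurePreserving.id Q)
      · simp only [hi, if_false]
        exact measurePreserving_fst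
    have h2 := (measurePreserving_pi _ _ h1).comp
      (measurePreserving_arrowProdEquivProdArrow (S × Y) Y σ (fun i => (ρ i).prod Q)
        fun _ => Q).symm
    convert h2 using 1
    ext1 z
    ext1 i
    simp only [resample, Function.comp]
    rfl
  set N : Set (σ → S × Y) := {q | (∀ᵐ τ ∂(Measure.pi fun _ : σ => Q), h (resample V q τ)) ∧ ¬ h q}
    with hN
  have hNm : MeasurableSet N := by
    refine MeasurableSet.inter ?_ hm.compl
    have h3 : MeasurableSet {z : (σ → S × Y) × (σ → Y) | h (resample V z.1 z.2)} :=
      hpres.measurable hm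
    exact measurableSet_eq_fun (measurable_measure_prodMk_left h3.compl) measurable_const
  have hN0 : (Measure.pi fun i => (ρ i).prod Q) N = 0 := by
    rw [← hpres.measure_preimage hNm.nullMeasurableSet,
      Measure.measure_prod_null (hpres.measurable hNm)]
    refine Filter.Eventually.of_forall fun q => ?_
    have hrr : ∀ τ τ', resample V (resample V q τ) τ' = resample V q τ' := by
      intro τ τ'
      ext1 i
      by_cases hi : i ∈ V <;> simp [resample, hi]
    simp only [Pi.zero_apply]
    by_cases hq : ∀ᵐ τ ∂(Measure.pi fun _ : σ => Q), h (resample V q τ)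
    · refine measure_mono_null ?_ hq
      intro τ hτ
      exact hτ.2
    · convert measure_empty (μ := Measure.pi fun _ : σ => Q)
      rw [eq_empty_iff_forall_notMem]
      intro τ hτ
      refine hq ?_
      have := hτ.1
      simpa only [hrr] using this
  have h4 : ∀ᵐ q ∂(Measure.pi fun i => (ρ i).prod Q), q ∉ N := measure_eq_zero_iff_ae_notMem.1 hN0
  filter_upwards [h4] with q hq hh
  by_contra hne
  exact hq ⟨hh, hne⟩

end Generic

section Score

open scoped Classical

variable {d : ℕ} {M : Type*} {Ξ : Functional d M} {lam C : ℝ}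

theorem rescale_factor_pos (d : ℕ) (hlam : 0 < lam) : 0 < lam ^ (1 / (d : ℝ)) :=
  Real.rpow_pos_of_pos hlam _

theorem abs_rescale_le (hlam : 0 < lam)
    (hC : ∀ X : Finset (MPoint d M), IsConfig X → ∀ p ∈ X, |Ξ p X| ≤ C)
    {X : Finset (MPoint d M)} (hX : IsConfig X) {p : MPoint d M} (hp : p ∈ X) :
    |Ξ.rescale lam p X| ≤ C := by
  refine hC _ ?_ _ (Finset.mem_image_of_mem _ hp)
  intro a ha b hb hab
  simp only [Finset.coe_image, mem_image, Finset.mem_coe] at ha hb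
  obtain ⟨a', ha', rfl⟩ := ha
  obtain ⟨b', hb', rfl⟩ := hb
  have : a'.1 = b'.1 := smul_right_injective _ (rescale_factor_pos d hlam).ne' hab
  rw [hX ha' hb' this]

variable [MeasurableSpace M]

theorem measurableSet_injective_loc (σ : Type*) [Finite σ] :
    MeasurableSet {q : σ → MPoint d M | Function.Injective fun i => (q i).1} := by
  have : {q : σ → MPoint d M | Function.Injective fun i => (q i).1} =
      ⋂ i, ⋂ j, {q | (q i).1 = (q j).1 → i = j} := by
    ext q
    simp only [mem_ofPred_eq, mem_iInter]
    rfl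
  rw [this]
  refine MeasurableSet.iInter fun i => MeasurableSet.iInter fun j => ?_
  by_cases hij : i = j
  · simp [hij]
  · simp only [hij, imp_false]
    exact (measurableSet_eq_fun (by fun_prop) (by fun_prop)).compl

/-- Along the enumerations of marked configurations, the rescaled functional is a measurable
function of the points. -/
theorem exists_measurable_rescale (hΞ : Ξ.IsMeasurable) (hlam : 0 < lam) {σ : Type*} [Fintype σ]
    {a : σ} {I : Finset σ} (ha : a ∈ I) :
    ∃ G : (σ → MPoint d M) → ℝ, Measurable G ∧ ∀ q : σ → MPoint d M,
      (Function.Injective fun i => (q i).1) → Ξ.rescale lam (q a) (I.image q) = G q := by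
  set s := lam ^ (1 / (d : ℝ)) with hs
  have hs0 : s ≠ 0 := (rescale_factor_pos d hlam).ne'
  obtain ⟨n, hn⟩ : ∃ n, I.card = n + 1 :=
    ⟨I.card - 1, (Nat.succ_pred_eq_of_pos (Finset.card_pos.2 ⟨a, ha⟩)).symm⟩
  let e0 : Fin (n + 1) ≃ I := (Fintype.equivFinOfCardEq (by simpa using hn)).symm
  let e : Fin (n + 1) ≃ I := (Equiv.swap 0 (e0.symm ⟨a, ha⟩)).trans e0
  have he0 : e 0 = ⟨a, ha⟩ := by simp [e]
  obtain ⟨G, hGm, hG⟩ := (MeasurableEmbedding.subtype_coe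
    (measurableSet_injective_loc (d := d) (M := M) (Fin (n + 1)))).exists_measurable_extend (hΞ n)
      fun _ => ⟨0⟩
  refine ⟨fun q => G fun i => (s • (q (e i)).1, (q (e i)).2), hGm.comp (by fun_prop), ?_⟩
  intro q hq
  have hinj : Function.Injective fun i : Fin (n + 1) =>
      ((s • (q (e i)).1, (q (e i)).2) : MPoint d M).1 := by
    intro i j hij
    have h1 : (q (e i)).1 = (q (e j)).1 := smul_right_injective _ hs0 hij
    exact e.injective (Subtype.ext (hq h1))
  have h2 := congrFun hG ⟨_, hinj⟩
  simp only [Function.comp] at h2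
  beta_reduce
  rw [h2, Functional.rescale, he0]
  congr 1
  ext p
  simp only [Finset.mem_image, Finset.mem_univ, true_and]
  constructor
  · rintro ⟨_, ⟨i, hi, rfl⟩, rfl⟩
    exact ⟨e.symm ⟨i, hi⟩, by simp [hs]⟩
  · rintro ⟨i, rfl⟩
    exact ⟨q (e i), ⟨e i, (e i).2, rfl⟩, rfl⟩

/-- The rescaled functional, truncated at its bound `C`: it has the same values at the marked
configurations, and is bounded everywhere. -/
def truncatedScore (Ξ : Functional d M) (lam C : ℝ) : Functional d M := fun p X =>
  max (-C) (min C (Ξ.rescale lam p X))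

omit [MeasurableSpace M] in
theorem abs_truncatedScore_le (hC0 : 0 ≤ C) (p : MPoint d M) (X : Finset (MPoint d M)) :
    |truncatedScore Ξ lam C p X| ≤ C :=
  abs_le.2 ⟨le_max_left _ _, max_le (by linarith) (min_le_left _ _)⟩

omit [MeasurableSpace M] in
theorem truncatedScore_eq (hlam : 0 < lam)
    (hC : ∀ X : Finset (MPoint d M), IsConfig X → ∀ p ∈ X, |Ξ p X| ≤ C)
    {X : Finset (MPoint d M)} (hX : IsConfig X) {p : MPoint d M} (hp : p ∈ X) :
    truncatedScore Ξ lam C p X = Ξ.rescale lam p X := by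
  have h := abs_le.1 (abs_rescale_le hlam hC hX hp)
  rw [truncatedScore, min_eq_right h.2, max_eq_right h.1]

theorem exists_measurable_truncatedScore (hΞ : Ξ.IsMeasurable) (hlam : 0 < lam) (C : ℝ)
    {σ : Type*} [Fintype σ] {a : σ} {I : Finset σ} (ha : a ∈ I) :
    ∃ G : (σ → MPoint d M) → ℝ, Measurable G ∧ ∀ q : σ → MPoint d M,
      (Function.Injective fun i => (q i).1) → truncatedScore Ξ lam C (q a) (I.image q) = G q := by
  obtain ⟨G, hGm, hG⟩ := exists_measurable_rescale hΞ hlam ha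
  exact ⟨fun q => max (-C) (min C (G q)), by fun_prop, fun q hq => by
    rw [truncatedScore, hG q hq]⟩

variable (μ : Measure (Space d)) [IsFiniteMeasure μ] [NullSingletonClass μ]
  (Q : Measure M) [IsProbabilityMeasure Q]

theorem ae_injective_loc (σ : Type*) [Fintype σ] :
    ∀ᵐ q ∂(Measure.pi fun _ : σ => μ.prod Q), Function.Injective fun i => (q i).1 :=
  (measurePreserving_pi (fun _ : σ => μ.prod Q) (fun _ : σ => μ)
    fun _ => measurePreserving_fst).quasiMeasurePreserving.ae (ae_injective_pi μ σ)

/-- The locations of the points of the process are distinct from each other and from given points.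
-/
theorem ae_injective_sumElim_loc {ι σ : Type*} [Fintype ι] [Fintype σ] {x : ι → Space d}
    (hx : Function.Injective x) :
    ∀ᵐ q ∂(Measure.pi fun _ : σ => μ.prod Q),
      Function.Injective (Sum.elim x fun i => (q i).1) := by
  have h1 : ∀ᵐ q ∂(Measure.pi fun _ : σ => μ.prod Q), ∀ (i : σ) (s : ι), (q i).1 ≠ x s := by
    simp only [ae_all_iff]
    intro i s
    have h2 : ∀ᵐ p ∂(μ.prod Q), p.1 ≠ x s :=
      measurePreserving_fst.quasiMeasurePreserving.ae (Measure.ae_ne μ (x s))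
    exact (Measure.quasiMeasurePreserving_eval (fun _ : σ => μ.prod Q) i).ae h2
  filter_upwards [h1, ae_injective_loc μ Q σ] with q hq hq'
  exact hx.sumElim hq' fun s i => (hq i s).symm

theorem diffuse_prod : Diffuse (μ.prod Q) := by
  intro σ _
  filter_upwards [ae_injective_loc μ Q σ] with q hq i j hij
  exact hq (congrArg Prod.fst hij)

theorem scoreMeasurable_truncatedScore (hΞ : Ξ.IsMeasurable) (hlam : 0 < lam) (C : ℝ) :
    ScoreMeasurable (μ.prod Q) (truncatedScore Ξ lam C) := by
  intro σ _ a I ha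
  obtain ⟨G, hGm, hG⟩ := exists_measurable_truncatedScore hΞ hlam C ha
  refine hGm.aestronglyMeasurable.congr ?_
  filter_upwards [ae_injective_loc μ Q σ] with q hq
  exact (hG q hq).symm

omit [MeasurableSpace M] in
theorem isConfig_image {σ : Type*} {q : σ → MPoint d M}
    (hq : Function.Injective fun i => (q i).1) (I : Finset σ) : IsConfig (I.image q) := by
  intro a ha b hb hab
  simp only [Finset.coe_image, mem_image] at ha hb
  obtain ⟨i, -, rfl⟩ := ha
  obtain ⟨j, -, rfl⟩ := hb
  rw [hq hab]

/-- The values of the random measure in terms of the truncated functional. -/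
theorem ae_randomMeasure_apply (hlam : 0 < lam)
    (hC : ∀ X : Finset (MPoint d M), IsConfig X → ∀ p ∈ X, |Ξ p X| ≤ C) :
    ∀ᵐ ω ∂poissonProcessLaw (μ.prod Q), ∀ A, MeasurableSet A →
      randomMeasure (Ξ.rescale lam) ω A =
        ∑ p ∈ pts ω, truncatedScore Ξ lam C p (pts ω) * A.indicator 1 p.1 := by
  refine (ae_poissonProcessLaw_iff _).2 fun n => ?_
  filter_upwards [ae_injective_loc μ Q (Fin n)] with q hq A hA
  have hcfg : IsConfig (pts (⟨n, q⟩ : Config d M)) := isConfig_image hq _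
  have hp : points (⟨n, q⟩ : Config d M) = pts ⟨n, q⟩ := rfl
  rw [randomMeasure, hp]
  simp only [FunLike.coe_sum, FunLike.coe_smul, Finset.sum_apply, Pi.smul_apply, smul_eq_mul]
  refine Finset.sum_congr rfl fun p hp => ?_
  rw [truncatedScore_eq hlam hC hcfg hp, Measure.toSignedMeasure_apply_measurable hA,
    measureReal_def, Measure.dirac_apply' _ hA]
  by_cases h : p.1 ∈ A <;> simp [h]

end Score

/-! ### The events on which the functional is stable -/

section Stability

open scoped Classical

variable {d : ℕ} {M : Type*} [MeasurableSpace M]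

theorem ae_prod_poissonProcessLaw_iff {E X : Type*} [MeasurableSpace E] [MeasurableSpace X]
    (Λ : Measure E) [IsFiniteMeasure Λ] {ρ : Measure X} [SFinite ρ]
    {p : X × (Σ n : ℕ, (Fin n → E)) → Prop} :
    (∀ᵐ z ∂ρ.prod (poissonProcessLaw Λ), p z) ↔
      ∀ n, ∀ᵐ z ∂ρ.prod (Measure.pi fun _ : Fin n => Λ), p (z.1, ⟨n, z.2⟩) := by
  rw [prod_poissonProcessLaw]
  exact ae_mixture_iff (poissonWeight_ne_zero Λ)
    fun n => MeasurableEmbedding.id.prodMap (measurableEmbedding_realization n)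

/-- The assumption of strong exponential stabilization, for a fixed parameter `lam` and a process
with finite intensity measure `μ`, with the rate `γ` in place of `α λ^{1/d}`. -/
def StabilizingAt (μ : Measure (Space d)) (Q : Measure M) (Ξ : Functional d M)
    (lam L B γ : ℝ) : Prop :=
  ∀ (Z : Finset (Space d)) (x : Space d), x ∉ Z →
    ∃ R : Config d M × M × (Z → M) → ℝ, Measurable R ∧
      (∀ᵐ ω ∂((poissonProcessLaw (μ.prod Q)).prod (Q.prod (Measure.pi fun _ : Z => Q))),
        IsStabilizationRadius (Ξ.rescale lam) Q (x, ω.2.1) (mark Z ω.2.2) (points ω.1) (R ω)) ∧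
      ∀ t : ℝ, 0 ≤ t →
        ((poissonProcessLaw (μ.prod Q)).prod (Q.prod (Measure.pi fun _ : Z => Q))).real
            {ω | t ≤ R ω} ≤ L * B ^ Z.card * Real.exp (-(γ * t))

theorem image_disjSum {E ι κ : Type*} [DecidableEq E] (f : ι ⊕ κ → E) (K : Finset ι)
    (D : Finset κ) :
    (K.disjSum D).image f = K.image (f ∘ Sum.inl) ∪ D.image (f ∘ Sum.inr) := by
  ext p
  simp only [Finset.mem_image, Finset.mem_disjSum, Finset.mem_union, Function.comp]
  constructor
  · rintro ⟨s, (⟨b, hb, rfl⟩ | ⟨b, hb, rfl⟩), rfl⟩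
    · exact Or.inl ⟨b, hb, rfl⟩
    · exact Or.inr ⟨b, hb, rfl⟩
  · rintro (⟨b, hb, rfl⟩ | ⟨b, hb, rfl⟩)
    · exact ⟨_, Or.inl ⟨b, hb, rfl⟩, rfl⟩
    · exact ⟨_, Or.inr ⟨b, hb, rfl⟩, rfl⟩

variable (μ : Measure (Space d)) [IsFiniteMeasure μ] [NullSingletonClass μ]
  (Q : Measure M) [IsProbabilityMeasure Q] {Ξ : Functional d M} {lam L B γ : ℝ}

/-- Equality of the values of the functional at two configurations does not depend on the marks of
the points that belong to one of them only, if it almost surely holds for independent copies of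
these marks. -/
theorem ae_rescale_eq_of_resample (hΞ : Ξ.IsMeasurable) (hlam : 0 < lam)
    {ι : Type} [Fintype ι] {x : ι → Space d} (hx : Function.Injective x) (n : ℕ)
    (V : Set (ι ⊕ Fin n)) {a : ι ⊕ Fin n} {K I : Finset (ι ⊕ Fin n)} (hK : a ∈ K) (hI : a ∈ I) :
    ∀ᵐ z ∂((Measure.pi fun _ : ι => Q).prod (Measure.pi fun _ : Fin n => μ.prod Q)),
      (∀ᵐ τ ∂(Measure.pi fun _ : ι ⊕ Fin n => Q),
        Ξ.rescale lam (resample V (Sum.elim (fun s => (x s, z.1 s)) z.2) τ a)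
            (K.image (resample V (Sum.elim (fun s => (x s, z.1 s)) z.2) τ)) =
          Ξ.rescale lam (resample V (Sum.elim (fun s => (x s, z.1 s)) z.2) τ a)
            (I.image (resample V (Sum.elim (fun s => (x s, z.1 s)) z.2) τ))) →
        Ξ.rescale lam (Sum.elim (fun s => (x s, z.1 s)) z.2 a)
            (K.image (Sum.elim (fun s => (x s, z.1 s)) z.2)) =
          Ξ.rescale lam (Sum.elim (fun s => (x s, z.1 s)) z.2 a)
            (I.image (Sum.elim (fun s => (x s, z.1 s)) z.2)) := by
  obtain ⟨G, hGm, hG⟩ := exists_measurable_rescale hΞ hlam hK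
  obtain ⟨G', hGm', hG'⟩ := exists_measurable_rescale hΞ hlam hI
  -- the law of all points, the first of which have the deterministic locations `x`
  set ρ : ι ⊕ Fin n → Measure (Space d) := Sum.elim (fun s => Measure.dirac (x s)) fun _ => μ
    with hρ
  have hfin : ∀ i, SigmaFinite (ρ i) := by
    rintro (s | i)
    · exact (inferInstance : SigmaFinite (Measure.dirac (x s)))
    · exact (inferInstance : SigmaFinite μ)
  have h1 := ae_of_ae_resample ρ Q V (h := fun q => G q = G' q) (measurableSet_eq_fun hGm hGm')
  have hd : ∀ s : ι, MeasurePreserving (fun u : M => ((x s, u) : MPoint d M)) Q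
      ((Measure.dirac (x s)).prod Q) := fun s =>
    ⟨by fun_prop, by rw [Measure.dirac_prod]⟩
  have hpres : MeasurePreserving
      (fun z : (ι → M) × (Fin n → MPoint d M) => Sum.elim (fun s => (x s, z.1 s)) z.2)
      ((Measure.pi fun _ : ι => Q).prod (Measure.pi fun _ : Fin n => μ.prod Q))
      (Measure.pi fun i => (ρ i).prod Q) := by
    have h2 := (measurePreserving_sumPiEquivProdPi_symm fun i => (ρ i).prod Q).comp
      ((measurePreserving_pi (fun _ : ι => Q) (fun s => (Measure.dirac (x s)).prod Q) hd).prod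
        (MeasurePreserving.id (Measure.pi fun _ : Fin n => μ.prod Q)))
    convert h2 using 1
    ext1 z
    ext1 (s | i) <;> rfl
  have h3 : ∀ᵐ z ∂((Measure.pi fun _ : ι => Q).prod (Measure.pi fun _ : Fin n => μ.prod Q)),
      Function.Injective (Sum.elim x fun i => (z.2 i).1) :=
    Measure.quasiMeasurePreserving_snd.ae (ae_injective_sumElim_loc μ Q hx)
  filter_upwards [hpres.quasiMeasurePreserving.ae h1, h3] with z hz hinj
  set q : ι ⊕ Fin n → MPoint d M := Sum.elim (fun s => (x s, z.1 s)) z.2 with hq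
  have hqloc : Function.Injective fun i => (q i).1 := by
    convert hinj using 1
    ext1 (s | i) <;> rfl
  have hres : ∀ τ, Function.Injective fun i => (resample V q τ i).1 := by
    intro τ
    convert hqloc using 1
    ext1 i
    by_cases hi : i ∈ V <;> simp [resample, hi]
  simp only [hG _ hqloc, hG' _ hqloc, hG _ (hres _), hG' _ (hres _)]
  exact hz

/-- Off an exceptional event of exponentially small probability, the value of the functional at
the point `x a` is determined by the points `x b`, `b ∈ J`, and by the points of the process at
distance at most `r` from `x a`, and it is not changed by the addition of points `x b` at distance
larger than `r`. -/
theorem exists_stability_event (hΞ : Ξ.IsMeasurable) (hlam : 0 < lam)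
    (hst : StabilizingAt μ Q Ξ lam L B γ)
    {ι : Type} [Fintype ι] {x : ι → Space d} (hx : Function.Injective x) {a : ι} {J : Finset ι}
    (ha : a ∈ J) {r : ℝ} (hr : 0 ≤ r) :
    ∃ N : Set ((ι → M) × Config d M), MeasurableSet N ∧
      ((Measure.pi fun _ : ι => Q).prod (poissonProcessLaw (μ.prod Q))).real N ≤
        L * B ^ (J.card - 1) * Real.exp (-(γ * r)) ∧
      ∀ᵐ z ∂((Measure.pi fun _ : ι => Q).prod (poissonProcessLaw (μ.prod Q))), z ∉ N →
        ∀ K : Finset ι, J ⊆ K → (∀ b ∈ K, b ∉ J → r < dist (x b) (x a)) →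
          Ξ.rescale lam (x a, z.1 a) (K.image (fun b => (x b, z.1 b)) ∪ pts z.2) =
            Ξ.rescale lam (x a, z.1 a) (J.image (fun b => (x b, z.1 b)) ∪
              {p ∈ pts z.2 | p.1 ∈ Metric.closedBall (x a) r}) := by
  -- the hypothesis is applied to the set `Z` of the other points `x b`, `b ∈ J`; the radius of
  -- stabilization then depends on the marks `t b`, `b ∈ J`, only
  set Z : Finset (Space d) := (J.erase a).image x with hZ
  have haZ : x a ∉ Z := by
    intro h
    obtain ⟨b, hb, hab⟩ := Finset.mem_image.1 h
    exact (Finset.mem_erase.1 hb).1 (hx hab)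
  have hZcard : Z.card = J.card - 1 := by
    rw [hZ, Finset.card_image_of_injective _ hx, Finset.card_erase_of_mem ha]
  obtain ⟨R, hRm, hR, hRt⟩ := hst Z (x a) haZ
  -- the index of a point of `Z`
  have hidx : ∀ y : Z, ∃ b, b ∈ J.erase a ∧ x b = y := fun y => Finset.mem_image.1 y.2
  choose idx hidxJ hidxx using hidx
  have hg : Function.Injective (Sum.elim (fun _ : Unit => a) idx) := by
    refine Function.Injective.sumElim (fun _ _ _ => rfl) (fun y y' h => Subtype.ext ?_) ?_
    · rw [← hidxx y, ← hidxx y', h]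
    · intro _ y h
      exact (Finset.mem_erase.1 (hidxJ y)).1 h.symm
  have hπ : MeasurePreserving (fun t : ι → M => (t a, fun y => t (idx y)))
      (Measure.pi fun _ => Q) (Q.prod (Measure.pi fun _ : Z => Q)) := by
    have h1 := ((measurePreserving_funUnique Q Unit).prod
      (MeasurePreserving.id (Measure.pi fun _ : Z => Q))).comp
      ((measurePreserving_sumPiEquivProdPi fun _ : Unit ⊕ Z => Q).comp
        (measurePreserving_comp_injective Q hg))
    convert h1 using 1
    rfl
  have hT : MeasurePreserving
      (fun z : (ι → M) × Config d M => (z.2, (z.1 a, fun y => z.1 (idx y))))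
      ((Measure.pi fun _ : ι => Q).prod (poissonProcessLaw (μ.prod Q)))
      ((poissonProcessLaw (μ.prod Q)).prod (Q.prod (Measure.pi fun _ : Z => Q))) := by
    have h1 := ((MeasurePreserving.id (poissonProcessLaw (μ.prod Q))).prod hπ).comp
      (Measure.measurePreserving_swap (μ := Measure.pi fun _ : ι => Q)
        (ν := poissonProcessLaw (μ.prod Q)))
    convert h1 using 1
    rfl
  have hRset : MeasurableSet {ω | r ≤ R ω} := measurableSet_le measurable_const hRm
  refine ⟨_, hT.measurable hRset, ?_, ?_⟩
  · rw [hT.measureReal_preimage hRset.nullMeasurableSet, ← hZcard]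
    exact hRt r hr
  have hstab := hT.quasiMeasurePreserving.ae hR
  rw [ae_prod_poissonProcessLaw_iff] at hstab ⊢
  intro n
  have hinj : ∀ᵐ z ∂((Measure.pi fun _ : ι => Q).prod (Measure.pi fun _ : Fin n => μ.prod Q)),
      Function.Injective (Sum.elim x fun i => (z.2 i).1) :=
    Measure.quasiMeasurePreserving_snd.ae (ae_injective_sumElim_loc μ Q hx)
  -- the hypothesis speaks of fresh marks for the points outside the ball, but their own marks enter
  -- here
  have hown : ∀ᵐ z ∂((Measure.pi fun _ : ι => Q).prod (Measure.pi fun _ : Fin n => μ.prod Q)),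
      ∀ K I : Finset (ι ⊕ Fin n), Sum.inl a ∈ K → Sum.inl a ∈ I →
      (∀ᵐ τ ∂(Measure.pi fun _ : ι ⊕ Fin n => Q),
        Ξ.rescale lam (resample (K \ I : Finset _) (Sum.elim (fun s => (x s, z.1 s)) z.2) τ
              (Sum.inl a))
            (K.image (resample (K \ I : Finset _) (Sum.elim (fun s => (x s, z.1 s)) z.2) τ)) =
          Ξ.rescale lam (resample (K \ I : Finset _) (Sum.elim (fun s => (x s, z.1 s)) z.2) τ
              (Sum.inl a))
            (I.image (resample (K \ I : Finset _) (Sum.elim (fun s => (x s, z.1 s)) z.2) τ))) →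
        Ξ.rescale lam (x a, z.1 a)
            (K.image (Sum.elim (fun s => (x s, z.1 s)) z.2)) =
          Ξ.rescale lam (x a, z.1 a)
            (I.image (Sum.elim (fun s => (x s, z.1 s)) z.2)) := by
    simp only [ae_all_iff]
    intro K I hK hI
    exact ae_rescale_eq_of_resample μ Q hΞ hlam hx n _ hK hI
  filter_upwards [hstab n, hinj, hown] with z hzs hzi hzo hzN
  simp only [mem_preimage, mem_ofPred_eq, not_le] at hzN
  set ρ : ℝ := R (⟨n, z.2⟩, (z.1 a, fun y => z.1 (idx y))) with hρ
  set q : ι ⊕ Fin n → MPoint d M := Sum.elim (fun s => (x s, z.1 s)) z.2 with hq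
  have hqloc : Function.Injective fun i => (q i).1 := by
    convert hzi using 1
    ext1 (s | i) <;> rfl
  set I0 : Finset (Fin n) := {i | dist (z.2 i).1 (x a) ≤ ρ} with hI0
  have himg : ∀ s : ℝ, ({i | dist (z.2 i).1 (x a) ≤ s} : Finset (Fin n)).image z.2 =
      {p ∈ pts (⟨n, z.2⟩ : Config d M) | p.1 ∈ Metric.closedBall (x a) s} := by
    intro s
    ext p
    simp only [Finset.mem_image, Finset.mem_filter, Finset.mem_univ, true_and, pts,
      Metric.mem_closedBall]
    constructor
    · rintro ⟨i, hi, rfl⟩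
      exact ⟨⟨i, rfl⟩, hi⟩
    · rintro ⟨⟨i, rfl⟩, hi⟩
      exact ⟨i, hi, rfl⟩
  -- the configuration of the points of `J` and of the points of the process in the ball
  have hbase : (J.disjSum I0).image q = insert (x a, z.1 a)
      ({p ∈ points (⟨n, z.2⟩ : Config d M) | p.1 ∈ Metric.closedBall (x a) ρ} ∪
        mark Z fun y => z.1 (idx y)) := by
    rw [image_disjSum, hI0]
    have h1 : q ∘ Sum.inr = z.2 := rfl
    have h2 : q ∘ Sum.inl = fun b => (x b, z.1 b) := rfl
    rw [h1, h2, himg, ← Finset.insert_erase ha, Finset.image_insert, Finset.insert_union,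
      Finset.union_comm]
    congr 2
    ext p
    simp only [Finset.mem_image, mark, Finset.mem_univ, true_and]
    constructor
    · rintro ⟨b, hb, rfl⟩
      refine ⟨⟨x b, Finset.mem_image_of_mem _ hb⟩, ?_⟩
      have : idx ⟨x b, Finset.mem_image_of_mem _ hb⟩ = b := hx (hidxx _)
      rw [this]
    · rintro ⟨y, rfl⟩
      exact ⟨idx y, hidxJ y, by rw [hidxx]⟩
  -- beyond the radius `ρ` of stabilization, points of both kinds can be added
  have hcore : ∀ (K : Finset ι) (D : Finset (Fin n)), J ⊆ K →
      (∀ b ∈ K, b ∉ J → ρ < dist (x b) (x a)) → I0 ⊆ D →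
      Ξ.rescale lam (x a, z.1 a) ((K.disjSum D).image q) =
        Ξ.rescale lam (x a, z.1 a) ((J.disjSum I0).image q) := by
    intro K D hJK hfar hD
    have hsub : J.disjSum I0 ⊆ K.disjSum D := Finset.disjSum_mono hJK hD
    refine hzo _ _ (Finset.inl_mem_disjSum.2 (hJK ha)) (Finset.inl_mem_disjSum.2 ha) ?_
    set V : Finset (ι ⊕ Fin n) := K.disjSum D \ J.disjSum I0 with hV
    set Y : Finset (Space d) := V.image fun s => (q s).1 with hY
    have hYidx : ∀ y : Y, ∃ s, s ∈ V ∧ (q s).1 = y := fun y => Finset.mem_image.1 y.2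
    choose idy hidyV hidyq using hYidx
    have hidy : Function.Injective idy := fun y y' h => Subtype.ext (by
      rw [← hidyq y, ← hidyq y', h])
    have hYfar : ∀ y ∈ Y, y ∉ Metric.closedBall (x a) ρ ∧
        y ∉ (mark Z fun y => z.1 (idx y)).image Prod.fst := by
      intro y hy
      obtain ⟨s, hs, rfl⟩ := Finset.mem_image.1 hy
      rw [hV, Finset.mem_sdiff] at hs
      constructor
      · rw [Metric.mem_closedBall, not_le]
        rcases s with b | i
        · exact hfar b (Finset.inl_mem_disjSum.1 hs.1) fun h => hs.2 (Finset.inl_mem_disjSum.2 h)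
        · by_contra! h
          exact hs.2 (Finset.inr_mem_disjSum.2 (Finset.mem_filter.2 ⟨Finset.mem_univ _, h⟩))
      · intro h
        obtain ⟨p, hp, hps⟩ := Finset.mem_image.1 h
        simp only [mark, Finset.mem_image, Finset.mem_univ, true_and] at hp
        obtain ⟨y, rfl⟩ := hp
        have h1 : (q (Sum.inl (idx y))).1 = (q s).1 := (hidxx y).trans hps
        rw [← hqloc h1] at hs
        exact hs.2 (Finset.inl_mem_disjSum.2 (Finset.mem_of_mem_erase (hidxJ y)))
    have h1 := (measurePreserving_comp_injective Q hidy).quasiMeasurePreserving.ae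
      (hzs.2 Y hYfar)
    filter_upwards [h1] with τ hτ
    have hoff : ∀ s, s ∉ V → resample V q τ s = q s := fun s hs => by
      simp [resample, hs]
    have hon : ∀ s, s ∈ V → resample V q τ s = ((q s).1, τ s) := fun s hs => by
      simp [resample, hs]
    have hVdisj : ∀ s ∈ J.disjSum I0, s ∉ V := fun s hs h => (Finset.mem_sdiff.1 h).2 hs
    have e1 : resample V q τ (Sum.inl a) = (x a, z.1 a) :=
      hoff _ (hVdisj _ (Finset.inl_mem_disjSum.2 ha))
    have e2 : (J.disjSum I0).image (resample V q τ) = (J.disjSum I0).image q :=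
      Finset.image_congr fun s hs => hoff s (hVdisj s hs)
    have e3 : V.image (resample V q τ) = mark Y (τ ∘ idy) := by
      ext p
      simp only [Finset.mem_image, mark, Finset.mem_univ, true_and]
      constructor
      · rintro ⟨s, hs, rfl⟩
        refine ⟨⟨(q s).1, Finset.mem_image_of_mem _ hs⟩, ?_⟩
        have : idy ⟨(q s).1, Finset.mem_image_of_mem _ hs⟩ = s := hqloc (hidyq _)
        rw [hon s hs, Function.comp, this]
      · rintro ⟨y, rfl⟩
        exact ⟨idy y, hidyV y, by rw [hon _ (hidyV y), hidyq]; rfl⟩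
    have e4 : K.disjSum D = J.disjSum I0 ∪ V := by
      rw [hV, Finset.union_sdiff_of_subset hsub]
    have e5 : (K.disjSum D).image (resample V q τ) = insert (x a, z.1 a)
        ({p ∈ points (⟨n, z.2⟩ : Config d M) | p.1 ∈ Metric.closedBall (x a) ρ} ∪
          mark Y (τ ∘ idy) ∪ mark Z fun y => z.1 (idx y)) := by
      rw [e4, Finset.image_union, e2, e3, hbase, Finset.insert_union, Finset.union_right_comm]
    rw [e1, e5, e2, hbase]
    exact hτ
  intro K hJK hfar
  have h1 := hcore K Finset.univ hJK (fun b hb hbJ => hzN.trans (hfar b hb hbJ))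
    (Finset.subset_univ _)
  have h2 := hcore J {i | dist (z.2 i).1 (x a) ≤ r} Finset.Subset.rfl
    (fun b hb hbJ => absurd hb hbJ) (by
      intro i hi
      simp only [hI0, Finset.mem_filter, Finset.mem_univ, true_and] at hi ⊢
      exact hi.trans hzN.le)
  rw [← h2, image_disjSum, image_disjSum] at h1
  have h3 : q ∘ Sum.inr = z.2 := rfl
  rw [h3, himg] at h1
  exact h1

end Stability

/-! ### Decay of correlations -/

section Cluster

open scoped Classical

/-- Bounded functions that agree off a small set have nearby integrals. -/
theorem abs_integral_sub_integral_le {Ω : Type*} [MeasurableSpace Ω] {P : Measure Ω}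
    [IsFiniteMeasure P] {f g : Ω → ℝ} {K : ℝ} (hf : AEStronglyMeasurable f P)
    (hg : AEStronglyMeasurable g P) (hfK : ∀ ω, |f ω| ≤ K) (hgK : ∀ ω, |g ω| ≤ K)
    {N : Set Ω} (hN : MeasurableSet N) (h : ∀ᵐ ω ∂P, ω ∉ N → f ω = g ω) :
    |∫ ω, f ω ∂P - ∫ ω, g ω ∂P| ≤ 2 * K * P.real N := by
  rw [← integral_sub (Integrable.of_bound hf K (Filter.Eventually.of_forall hfK))
    (Integrable.of_bound hg K (Filter.Eventually.of_forall hgK)), ← Real.norm_eq_abs]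
  have h1 : ∫ ω, N.indicator (fun _ => 2 * K) ω ∂P = 2 * K * P.real N := by
    rw [integral_indicator hN, setIntegral_const, smul_eq_mul, mul_comm]
  rw [← h1]
  refine norm_integral_le_of_norm_le ((integrable_const _).indicator hN) ?_
  filter_upwards [h] with ω hω
  by_cases hN' : ω ∈ N
  · rw [indicator_of_mem hN', Real.norm_eq_abs]
    have := abs_sub (f ω) (g ω)
    linarith [hfK ω, hgK ω]
  · rw [indicator_of_notMem hN', hω hN']
    simp

variable {d : ℕ} {M : Type*} [MeasurableSpace M]
variable (μ : Measure (Space d)) [IsFiniteMeasure μ] [NullSingletonClass μ]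
  (Q : Measure M) [IsProbabilityMeasure Q] {Ξ : Functional d M} {lam C L B γ : ℝ}

theorem aestronglyMeasurable_score_filter (hΞ : Ξ.IsMeasurable) (hlam : 0 < lam) (C : ℝ)
    {κ : Type*} [Fintype κ] {u : κ → MPoint d M} (hu : Function.Injective fun b => (u b).1)
    {J : Finset κ} {a : κ} (ha : a ∈ J) {H : Set (MPoint d M)} (hH : MeasurableSet H) (n : ℕ) :
    AEStronglyMeasurable (fun q : Fin n → MPoint d M => truncatedScore Ξ lam C (u a)
      (J.image u ∪ {p ∈ Finset.univ.image q | p ∈ H})) (Measure.pi fun _ => μ.prod Q) := by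
  have hG : ∀ I : Finset (Fin n), ∃ G : (κ ⊕ Fin n → MPoint d M) → ℝ, Measurable G ∧
      ∀ q : κ ⊕ Fin n → MPoint d M, (Function.Injective fun i => (q i).1) →
        truncatedScore Ξ lam C (q (Sum.inl a)) ((J.disjSum I).image q) = G q := fun I =>
    exists_measurable_truncatedScore hΞ hlam C (Finset.inl_mem_disjSum.2 ha)
  choose G hGm hG using hG
  have hS : ∀ I : Finset (Fin n),
      MeasurableSet {q : Fin n → MPoint d M | ∀ i, q i ∈ H ↔ i ∈ I} := by
    intro I
    simp only [ofPred_forall]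
    refine MeasurableSet.iInter fun i => ?_
    by_cases hi : i ∈ I
    · simp only [hi, iff_true]
      exact (measurable_pi_apply i : Measurable fun q : Fin n → MPoint d M => q i) hH
    · simp only [hi, iff_false]
      exact (measurable_pi_apply i : Measurable fun q : Fin n → MPoint d M => q i) hH.compl
  have hm : Measurable fun q : Fin n → MPoint d M => ∑ I : Finset (Fin n),
      {q : Fin n → MPoint d M | ∀ i, q i ∈ H ↔ i ∈ I}.indicator
        (fun q => G I (Sum.elim u q)) q := by
    refine Finset.measurable_fun_sum _ fun I _ => ((hGm I).comp ?_).indicator (hS I)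
    refine measurable_pi_iff.2 ?_
    rintro (b | i)
    · exact measurable_const
    · exact measurable_pi_apply i
  refine hm.aestronglyMeasurable.congr ?_
  filter_upwards [ae_injective_sumElim_loc μ Q (σ := Fin n) hu] with q hq
  have hq' : Function.Injective fun i => (Sum.elim u q i).1 := by
    convert hq using 1
    ext1 (b | i) <;> rfl
  rw [Finset.sum_eq_single ({i | q i ∈ H} : Finset (Fin n))]
  · rw [indicator_of_mem (by simp), ← hG _ _ hq', image_disjSum]
    simp only [Sum.elim_inl, Sum.elim_comp_inl, Sum.elim_comp_inr]
    congr 2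
    ext p
    simp only [Finset.mem_image, Finset.mem_filter, Finset.mem_univ, true_and]
    constructor
    · rintro ⟨i, hi, rfl⟩
      exact ⟨⟨i, rfl⟩, hi⟩
    · rintro ⟨⟨i, rfl⟩, hi⟩
      exact ⟨i, hi, rfl⟩
  · intro I _ hI
    rw [indicator_of_notMem]
    intro h
    refine hI ?_
    ext i
    simpa using (h i).symm
  · intro h
    exact absurd (Finset.mem_univ _) h

/-- Decay of correlations: if two groups of points have distance larger than `2 r`, then the
moment density almost factorizes, in the mean with respect to the marks. -/
theorem exists_bound_moment_sub_mul (hΞ : Ξ.IsMeasurable) (hlam : 0 < lam) (hC : 1 ≤ C)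
    (hst : StabilizingAt μ Q Ξ lam L B γ) (hL : 0 ≤ L) (hB : 1 ≤ B)
    {κ : Type} [Fintype κ] {x : κ → Space d} (hx : Function.Injective x) (col : κ → Bool)
    {r : ℝ} (hr : 0 ≤ r) (hfar : ∀ a b, col a ≠ col b → 2 * r < dist (x a) (x b))
    {ι : Type} (f : ι → κ) (I : Finset ι) :
    ∃ g : (κ → M) → ℝ≥0∞, Measurable g ∧
      ∫⁻ t, g t ∂(Measure.pi fun _ => Q) ≤ ENNReal.ofReal (6 * C ^ I.card *
        (Fintype.card κ * (L * B ^ Fintype.card κ * Real.exp (-(γ * r))))) ∧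
      ∀ᵐ t ∂(Measure.pi fun _ => Q), ENNReal.ofReal
        |momentDensityOn (μ.prod Q) (truncatedScore Ξ lam C) (fun i => (x (f i), t (f i))) I -
          momentDensityOn (μ.prod Q) (truncatedScore Ξ lam C) (fun i => (x (f i), t (f i)))
            {i ∈ I | col (f i) = true} *
          momentDensityOn (μ.prod Q) (truncatedScore Ξ lam C) (fun i => (x (f i), t (f i)))
            {i ∈ I | col (f i) = false}| ≤ g t := by
  set ζ := truncatedScore Ξ lam C with hζdef
  have hC0 : 0 ≤ C := zero_le_one.trans hC
  have hζ : ∀ p X, |ζ p X| ≤ C := abs_truncatedScore_le hC0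
  set P := poissonProcessLaw (μ.prod Q) with hP
  set Jc : Bool → Finset κ := fun c => {b ∈ I.image f | col b = c} with hJc
  have hev : ∀ a : I.image f, ∃ N : Set ((κ → M) × Config d M), MeasurableSet N ∧
      ((Measure.pi fun _ : κ => Q).prod P).real N ≤
        L * B ^ Fintype.card κ * Real.exp (-(γ * r)) ∧
      ∀ᵐ z ∂((Measure.pi fun _ : κ => Q).prod P), z ∉ N →
        ∀ K : Finset κ, Jc (col a) ⊆ K → (∀ b ∈ K, b ∉ Jc (col a) → r < dist (x b) (x a)) →
          Ξ.rescale lam (x a, z.1 a) (K.image (fun b => (x b, z.1 b)) ∪ pts z.2) =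
            Ξ.rescale lam (x a, z.1 a) ((Jc (col a)).image (fun b => (x b, z.1 b)) ∪
              {p ∈ pts z.2 | p.1 ∈ Metric.closedBall (x a) r}) := by
    intro a
    have haJ : (a : κ) ∈ Jc (col a) := Finset.mem_filter.2 ⟨a.2, rfl⟩
    obtain ⟨N, hNm, hNP, hN⟩ := exists_stability_event μ Q hΞ hlam hst hx haJ hr
    refine ⟨N, hNm, hNP.trans ?_, hN⟩
    gcongr
    exact (Nat.sub_le _ _).trans (Finset.card_le_univ _)
  choose N hNm hNP hN using hev
  -- the exceptional event depends on the marks, hence a bound in the mean with respect to them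
  set NN : Set ((κ → M) × Config d M) := ⋃ a, N a with hNN
  have hNNm : MeasurableSet NN := MeasurableSet.iUnion hNm
  have hNNP : ((Measure.pi fun _ : κ => Q).prod P) NN ≤
      ENNReal.ofReal (Fintype.card κ * (L * B ^ Fintype.card κ * Real.exp (-(γ * r)))) := by
    rw [← ofReal_measureReal]
    refine ENNReal.ofReal_le_ofReal ((measureReal_iUnion_fintype_le _).trans ?_)
    refine (Finset.sum_le_sum fun a _ => hNP a).trans ?_
    rw [Finset.sum_const, nsmul_eq_mul, Finset.card_univ, Fintype.card_coe]
    gcongr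
    exact Finset.card_le_univ _
  refine ⟨fun t => ENNReal.ofReal (6 * C ^ I.card) * P (Prod.mk t ⁻¹' NN),
    (measurable_measure_prodMk_left hNNm).const_mul _, ?_, ?_⟩
  · rw [lintegral_const_mul _ (measurable_measure_prodMk_left hNNm), ← Measure.prod_apply hNNm,
      ENNReal.ofReal_mul (p := 6 * C ^ I.card) (by positivity)]
    gcongr
  have hall : ∀ᵐ z ∂((Measure.pi fun _ : κ => Q).prod P), z ∉ NN → ∀ a : I.image f,
      ∀ K : Finset κ, Jc (col a) ⊆ K → (∀ b ∈ K, b ∉ Jc (col a) → r < dist (x b) (x a)) →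
        Ξ.rescale lam (x a, z.1 a) (K.image (fun b => (x b, z.1 b)) ∪ pts z.2) =
          Ξ.rescale lam (x a, z.1 a) ((Jc (col a)).image (fun b => (x b, z.1 b)) ∪
            {p ∈ pts z.2 | p.1 ∈ Metric.closedBall (x a) r}) := by
    filter_upwards [ae_all_iff.2 hN] with z hz hzN a
    exact hz a fun h => hzN (mem_iUnion_of_mem a h)
  filter_upwards [Measure.ae_ae_of_ae_prod hall] with t ht
  set Nt : Set (Config d M) := Prod.mk t ⁻¹' NN with hNt
  have hNtm : MeasurableSet Nt := measurable_prodMk_left hNNm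
  set u : κ → MPoint d M := fun b => (x b, t b) with hu
  have hIc : ∀ c, ({i ∈ I | col (f i) = c} : Finset ι).image f = Jc c := by
    intro c
    ext b
    simp only [hJc, Finset.mem_image, Finset.mem_filter]
    constructor
    · rintro ⟨i, ⟨hi, hc⟩, rfl⟩
      exact ⟨⟨i, hi, rfl⟩, hc⟩
    · rintro ⟨⟨i, hi, rfl⟩, hc⟩
      exact ⟨i, ⟨hi, hc⟩, rfl⟩
  have hmd : ∀ D : Finset ι, momentDensityOn (μ.prod Q) ζ (fun i => (x (f i), t (f i))) D =
      ∫ ω, ∏ i ∈ D, ζ (u (f i)) ((D.image f).image u ∪ pts ω) ∂P := by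
    intro D
    unfold momentDensityOn momentDensity
    congr 1
    ext ω
    rw [← Finset.prod_coe_sort D]
    refine Finset.prod_congr rfl fun i _ => ?_
    congr 2
    ext p
    simp [hu]
  rw [hmd, hmd, hmd, hIc, hIc]
  -- the product of the scores over one group, with all points of the process, and with those only
  -- that are in the ball of radius `r` about the point in question
  set b : Bool → Config d M → ℝ := fun c ω =>
    ∏ i ∈ I with col (f i) = c, ζ (u (f i)) ((Jc c).image u ∪ pts ω) with hb
  set Φ : Bool → Finset (MPoint d M) → ℝ := fun c X =>
    ∏ i ∈ I with col (f i) = c, ζ (u (f i)) ((Jc c).image u ∪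
      {p ∈ X | p ∈ {p : MPoint d M | p.1 ∈ Metric.closedBall (x (f i)) r}}) with hΦ
  have hprodb : ∀ (D : Finset ι) (g : ι → ℝ), (∀ i, |g i| ≤ C) → |∏ i ∈ D, g i| ≤ C ^ D.card := by
    intro D g hg
    rw [Finset.abs_prod]
    exact (Finset.prod_le_prod (fun _ _ => abs_nonneg _) fun i _ => hg i).trans_eq (by simp)
  have huinj : Function.Injective fun b => (u b).1 := hx
  have hball : ∀ c : κ, MeasurableSet {p : MPoint d M | p.1 ∈ Metric.closedBall (x c) r} :=
    fun c => measurable_fst Metric.isClosed_closedBall.measurableSet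
  have hmemJc : ∀ i ∈ I, f i ∈ Jc (col (f i)) := fun i hi =>
    Finset.mem_filter.2 ⟨Finset.mem_image_of_mem f hi, rfl⟩
  have hmeasP : ∀ F : Config d M → ℝ, (∀ n, AEStronglyMeasurable (fun q => F ⟨n, q⟩)
      (Measure.pi fun _ : Fin n => μ.prod Q)) → AEStronglyMeasurable F P := fun F hF => by
    rw [hP, poissonProcessLaw_eq_mixture]
    exact aestronglyMeasurable_mixture measurableEmbedding_realization hF
  have hscore : ∀ (J : Finset κ) (c : κ), c ∈ J → ∀ n, AEStronglyMeasurable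
      (fun q : Fin n → MPoint d M => ζ (u c) (J.image u ∪ pts ⟨n, q⟩))
      (Measure.pi fun _ => μ.prod Q) := by
    intro J c hc n
    have := aestronglyMeasurable_score_filter μ Q hΞ hlam C huinj hc MeasurableSet.univ n
    simpa [pts] using this
  have hAm : AEStronglyMeasurable (fun ω => ∏ i ∈ I, ζ (u (f i)) ((I.image f).image u ∪ pts ω)) P :=
    hmeasP _ fun n => Finset.aestronglyMeasurable_fun_prod _ fun i hi =>
      hscore _ _ (Finset.mem_image_of_mem f hi) n
  have hbm : ∀ c, AEStronglyMeasurable (b c) P := fun c =>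
    hmeasP _ fun n => Finset.aestronglyMeasurable_fun_prod _ fun i hi => by
      obtain ⟨hi', rfl⟩ := Finset.mem_filter.1 hi
      exact hscore _ _ (hmemJc i hi') n
  have hΦn : ∀ c n, AEStronglyMeasurable (fun q : Fin n → MPoint d M => Φ c (Finset.univ.image q))
      (Measure.pi fun _ => μ.prod Q) := fun c n =>
    Finset.aestronglyMeasurable_fun_prod _ fun i hi => by
      obtain ⟨hi', rfl⟩ := Finset.mem_filter.1 hi
      exact aestronglyMeasurable_score_filter μ Q hΞ hlam C huinj (hmemJc i hi') (hball (f i)) n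
  have hΦm : ∀ c, AEStronglyMeasurable (fun ω => Φ c (pts ω)) P := fun c =>
    hmeasP _ fun n => hΦn c n
  have hsplit : ∀ g : ι → ℝ, ∏ i ∈ I, g i =
      (∏ i ∈ I with col (f i) = true, g i) * ∏ i ∈ I with col (f i) = false, g i := by
    intro g
    rw [← Finset.prod_filter_mul_prod_filter_not I fun i => col (f i) = true]
    simp
  have hcard : ({i ∈ I | col (f i) = true} : Finset ι).card +
      ({i ∈ I | col (f i) = false} : Finset ι).card = I.card := by
    rw [← Finset.card_filter_add_card_filter_not (s := I) fun i => col (f i) = true]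
    simp
  -- off the exceptional event, the three products agree
  have hAΦ : ∀ᵐ ω ∂P, ω ∉ Nt → ∏ i ∈ I, ζ (u (f i)) ((I.image f).image u ∪ pts ω) =
      Φ true (pts ω) * Φ false (pts ω) := by
    filter_upwards [ht] with ω hω hωN
    rw [hsplit]
    have key : ∀ i ∈ I, ζ (u (f i)) ((I.image f).image u ∪ pts ω) =
        ζ (u (f i)) ((Jc (col (f i))).image u ∪
          {p ∈ pts ω | p ∈ {p : MPoint d M | p.1 ∈ Metric.closedBall (x (f i)) r}}) := by
      intro i hi
      have h1 := hω hωN ⟨f i, Finset.mem_image_of_mem f hi⟩ (I.image f) (Finset.filter_subset _ _)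
        (by
          intro b hbI hbJ
          have hne : col b ≠ col (f i) := fun h => hbJ (Finset.mem_filter.2 ⟨hbI, h⟩)
          linarith [hfar _ _ hne])
      simp only [hζdef, truncatedScore]
      exact congrArg (fun s => max (-C) (min C s)) h1
    congr 1 <;>
    · refine Finset.prod_congr rfl fun i hi => ?_
      obtain ⟨hi, hc⟩ := Finset.mem_filter.1 hi
      rw [key i hi, hc]
  have hbΦ : ∀ c, ∀ᵐ ω ∂P, ω ∉ Nt → Φ c (pts ω) = b c ω := by
    intro c
    filter_upwards [ht] with ω hω hωN
    refine Finset.prod_congr rfl fun i hi => ?_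
    obtain ⟨hi', rfl⟩ := Finset.mem_filter.1 hi
    have h1 := hω hωN ⟨f i, Finset.mem_image_of_mem f hi'⟩ (Jc (col (f i))) Finset.Subset.rfl
      (fun b hb hb' => absurd hb hb')
    simp only [hζdef, truncatedScore]
    exact (congrArg (fun s => max (-C) (min C s)) h1).symm
  have hpow : ∀ c, C ^ ({i ∈ I | col (f i) = c} : Finset ι).card ≤ C ^ I.card := fun c =>
    pow_le_pow_right₀ hC (Finset.card_le_card (Finset.filter_subset _ _))
  have hΦK : ∀ c X, |Φ c X| ≤ C ^ ({i ∈ I | col (f i) = c} : Finset ι).card := fun c X =>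
    hprodb _ _ fun i => hζ _ _
  have hbK : ∀ c ω, |b c ω| ≤ C ^ ({i ∈ I | col (f i) = c} : Finset ι).card := fun c ω =>
    hprodb _ _ fun i => hζ _ _
  have hcc : C ^ ({i ∈ I | col (f i) = true} : Finset ι).card *
      C ^ ({i ∈ I | col (f i) = false} : Finset ι).card = C ^ I.card := by
    rw [← pow_add, hcard]
  -- the balls around the points of one group do not meet those around the points of the other
  have hind : ∫ ω, Φ true (pts ω) * Φ false (pts ω) ∂P =
      (∫ ω, Φ true (pts ω) ∂P) * ∫ ω, Φ false (pts ω) ∂P := by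
    refine integral_mul_eq_mul_integral_of_local (μ.prod Q)
      (H := ⋃ a ∈ Jc true, {p : MPoint d M | p.1 ∈ Metric.closedBall (x a) r})
      (Finset.measurableSet_biUnion _ fun a _ => hball a) (hΦn true) (hΦn false)
      (fun X => (hΦK true X).trans (hpow true)) (fun X => (hΦK false X).trans (hpow false)) ?_ ?_
    · intro X
      refine Finset.prod_congr rfl fun i hi => ?_
      obtain ⟨hi, hc⟩ := Finset.mem_filter.1 hi
      congr 2
      rw [Finset.filter_filter]
      refine Finset.filter_congr fun p _ => ?_
      refine ⟨fun h => ⟨?_, h⟩, fun h => h.2⟩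
      exact mem_iUnion₂.2 ⟨f i, hc ▸ hmemJc i hi, h⟩
    · intro X
      refine Finset.prod_congr rfl fun i hi => ?_
      obtain ⟨hi, hc⟩ := Finset.mem_filter.1 hi
      congr 2
      rw [Finset.filter_filter]
      refine Finset.filter_congr fun p _ => ?_
      refine ⟨fun h => ⟨?_, h⟩, fun h => h.2⟩
      intro h'
      obtain ⟨a, ha, hpa⟩ := mem_iUnion₂.1 h'
      have hne : col a ≠ col (f i) := by
        rw [hc, (Finset.mem_filter.1 ha).2]
        decide
      have h1 := hfar _ _ hne
      have h2 := dist_triangle_left (x a) (x (f i)) p.1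
      have h3 : dist p.1 (x a) ≤ r := hpa
      have h4 : dist p.1 (x (f i)) ≤ r := h
      linarith
  have e1 := abs_integral_sub_integral_le (P := P) (K := C ^ I.card) hAm
    ((hΦm true).mul (hΦm false)) (fun ω => hprodb _ _ fun i => hζ _ _)
    (fun ω => by
      rw [Pi.mul_apply, abs_mul, ← hcc]
      exact mul_le_mul (hΦK _ _) (hΦK _ _) (abs_nonneg _) (by positivity)) hNtm hAΦ
  have e2 := fun c => abs_integral_sub_integral_le (P := P) (hΦm c) (hbm c) (fun ω => hΦK c _)
    (fun ω => hbK c ω) hNtm (hbΦ c)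
  have e3 : |∫ ω, Φ true (pts ω) ∂P| ≤ C ^ ({i ∈ I | col (f i) = true} : Finset ι).card := by
    have := norm_integral_le_of_norm_le_const (μ := P) (f := fun ω => Φ true (pts ω))
      (Filter.Eventually.of_forall fun ω => hΦK true (pts ω))
    simpa using this
  have e4 : |∫ ω, b false ω ∂P| ≤ C ^ ({i ∈ I | col (f i) = false} : Finset ι).card := by
    have := norm_integral_le_of_norm_le_const (μ := P) (f := b false)
      (Filter.Eventually.of_forall fun ω => hbK false ω)
    simpa using this
  simp only [Pi.mul_apply] at e1
  rw [hind] at e1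
  have hβ : ENNReal.ofReal (6 * C ^ I.card * P.real Nt) =
      ENNReal.ofReal (6 * C ^ I.card) * P Nt := by
    rw [ENNReal.ofReal_mul (by positivity), ofReal_measureReal]
  rw [← hβ]
  refine ENNReal.ofReal_le_ofReal ?_
  have e5 : |(∫ ω, Φ true (pts ω) ∂P) * (∫ ω, Φ false (pts ω) ∂P) -
      (∫ ω, b true ω ∂P) * ∫ ω, b false ω ∂P| ≤ 4 * C ^ I.card * P.real Nt := by
    have : (∫ ω, Φ true (pts ω) ∂P) * (∫ ω, Φ false (pts ω) ∂P) -
        (∫ ω, b true ω ∂P) * ∫ ω, b false ω ∂P =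
        (∫ ω, Φ true (pts ω) ∂P) * ((∫ ω, Φ false (pts ω) ∂P) - ∫ ω, b false ω ∂P) +
        ((∫ ω, Φ true (pts ω) ∂P) - ∫ ω, b true ω ∂P) * ∫ ω, b false ω ∂P := by ring
    rw [this]
    refine (abs_add_le _ _).trans ?_
    rw [abs_mul, abs_mul]
    have h1 := mul_le_mul e3 (e2 false) (abs_nonneg _) (by positivity)
    have h2 := mul_le_mul (e2 true) e4 (abs_nonneg _) (by positivity)
    rw [← hcc]
    nlinarith [h1, h2]
  have := abs_sub_le (∫ ω, ∏ i ∈ I, ζ (u (f i)) ((I.image f).image u ∪ pts ω) ∂P)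
    ((∫ ω, Φ true (pts ω) ∂P) * ∫ ω, Φ false (pts ω) ∂P)
    ((∫ ω, b true ω ∂P) * ∫ ω, b false ω ∂P)
  linarith

/-- The cumulant density is small, in the mean with respect to the marks, if the points fall into
two groups at distance larger than `2 r`. -/
theorem lintegral_cumulantDensity_le (hΞ : Ξ.IsMeasurable) (hlam : 0 < lam) (hC : 1 ≤ C)
    (hst : StabilizingAt μ Q Ξ lam L B γ) (hL : 0 ≤ L) (hB : 1 ≤ B)
    {κ : Type} [Fintype κ] {x : κ → Space d} (hx : Function.Injective x) (col : κ → Bool)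
    {r : ℝ} (hr : 0 ≤ r) (hfar : ∀ a b, col a ≠ col b → 2 * r < dist (x a) (x b))
    {ι : Type} [Fintype ι] [LinearOrder ι] (f : ι → κ) (hcol : ∃ i j, col (f i) ≠ col (f j)) :
    ∫⁻ t, ENNReal.ofReal |cumulantDensity (μ.prod Q) (truncatedScore Ξ lam C)
        (fun i => (x (f i), t (f i))) Finset.univ| ∂(Measure.pi fun _ => Q) ≤
      ENNReal.ofReal (((Fintype.card ι)! : ℝ) * (6 * C * C) ^ Fintype.card ι * (6 *
        (Fintype.card κ * (L * B ^ Fintype.card κ * Real.exp (-(γ * r)))))) := by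
  set k := Fintype.card ι with hk
  set ζ := truncatedScore Ξ lam C with hζdef
  have hC0 : 0 ≤ C := zero_le_one.trans hC
  have hζ : ∀ p X, |ζ p X| ≤ C := abs_truncatedScore_le hC0
  set E : ℝ := Fintype.card κ * (L * B ^ Fintype.card κ * Real.exp (-(γ * r))) with hE
  have hE0 : 0 ≤ E := by positivity
  choose g hgm hgint hg using exists_bound_moment_sub_mul μ Q hΞ hlam hC hst hL hB hx col hr hfar f
  have hbd : ∀ᵐ t ∂(Measure.pi fun _ : κ => Q), ENNReal.ofReal |cumulantDensity (μ.prod Q) ζ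
      (fun i => (x (f i), t (f i))) Finset.univ| ≤
        ENNReal.ofReal ((k ! : ℝ) * 3 ^ k * C ^ k) * ∑ I : Finset ι, g I t := by
    filter_upwards [ae_all_iff.2 hg] with t ht
    set v : ι → MPoint d M := fun i => (x (f i), t (f i)) with hv
    set U : Finset ι → ℝ := fun I => |momentDensityOn (μ.prod Q) ζ v I -
      momentDensityOn (μ.prod Q) ζ v {i ∈ I | col (f i) = true} *
        momentDensityOn (μ.prod Q) ζ v {i ∈ I | col (f i) = false}| with hU
    have h1 : |cumulantDensity (μ.prod Q) ζ v Finset.univ| ≤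
        (k ! : ℝ) * 3 ^ k * C ^ k * ∑ I, U I := by
      have hc := abs_weightedCumulant_le_of_split hC (abs_momentDensityOn_le (μ.prod Q) hζ v)
        (momentDensityOn_empty (μ.prod Q) v) (abs_separated_le v) (separated_empty v)
        (fun i => col (f i)) (ε := ∑ I, U I) (by
          intro c D D' hD
          unfold separated
          congr 1
          refine propext ⟨fun h i hi j hj => h i hi j (Finset.mem_filter.1 hj).1,
            fun h i hi j hj => ?_⟩
          by_cases hjc : col (f j) = c
          · exact h i hi j (Finset.mem_filter.2 ⟨hj, hjc⟩)
          · intro hij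
            have : x (f i) = x (f j) := congrArg Prod.fst hij
            exact hjc (by rw [← hx this]; exact hD i hi))
        (fun I => Finset.single_le_sum (f := U) (fun _ _ => abs_nonneg _) (Finset.mem_univ I))
        Finset.univ (by
          obtain ⟨i, j, hij⟩ := hcol
          exact ⟨i, Finset.mem_univ _, j, Finset.mem_univ _, hij⟩)
      simpa [cumulantDensity, hk] using hc
    refine (ENNReal.ofReal_le_ofReal h1).trans ?_
    rw [ENNReal.ofReal_mul (by positivity), ENNReal.ofReal_sum_of_nonneg fun _ _ => abs_nonneg _]
    gcongr with I _
    exact ht I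
  refine (lintegral_mono_ae hbd).trans ?_
  rw [lintegral_const_mul _ (Finset.measurable_fun_sum _ fun I _ => hgm I),
    lintegral_finsetSum _ fun I _ => hgm I]
  have h2 : ∑ I : Finset ι, ∫⁻ t, g I t ∂(Measure.pi fun _ : κ => Q) ≤
      ENNReal.ofReal (2 ^ k * (6 * C ^ k * E)) := by
    refine (Finset.sum_le_card_nsmul _ _ (ENNReal.ofReal (6 * C ^ k * E)) fun I _ => ?_).trans_eq ?_
    · refine (hgint I).trans (ENNReal.ofReal_le_ofReal ?_)
      gcongr
      exact Finset.card_le_univ _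
    · rw [Finset.card_univ, Fintype.card_finset, nsmul_eq_mul,
        ENNReal.ofReal_mul (p := 2 ^ k) (by positivity)]
      congr 1
      rw [ENNReal.ofReal_pow (by norm_num)]
      simp [hk]
  refine (mul_le_mul_right h2 _).trans_eq ?_
  rw [← ENNReal.ofReal_mul (by positivity)]
  congr 1
  have : (6 * C * C) ^ k = 3 ^ k * 2 ^ k * C ^ k * C ^ k := by
    rw [mul_pow, mul_pow, ← mul_pow 3 2]
    norm_num
  rw [this]
  ring

end Cluster

/-! ### Connected tuples of points -/

section Trees

open scoped Classical

variable {S : Type*} [PseudoMetricSpace S] {κ : Type*}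

/-- `par` sends every vertex other than the root `a₀` to its parent in a tree with root `a₀`: a rank
that decreases from a vertex to its parent excludes cycles. The value `par a₀` is irrelevant. -/
def IsParentMap (a₀ : κ) (par : κ → κ) : Prop :=
  ∃ rank : κ → ℕ, ∀ a, a ≠ a₀ → rank (par a) < rank a

/-- The indicator of the event that the points with index in `T` are at distance at most `s` from
their parents. -/
def treeIndicator (par : κ → κ) (s : ℝ) (T : Finset κ) (x : κ → S) : ℝ≥0∞ :=
  ∏ a ∈ T, if dist (x a) (x (par a)) ≤ s then 1 else 0

/-- Either the points `x a` can be joined, in steps of length at most `s`, to the point `x a₀`, or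
they split into two parts at distance larger than `s`. -/
theorem exists_isParentMap_or_exists_color (x : κ → S) (s : ℝ) (a₀ : κ) :
    (∃ par, IsParentMap a₀ par ∧ ∀ a, a ≠ a₀ → dist (x a) (x (par a)) ≤ s) ∨
      ∃ col : κ → Bool, (∃ a b, col a ≠ col b) ∧ ∀ a b, col a ≠ col b → s < dist (x a) (x b) := by
  set G : SimpleGraph κ := SimpleGraph.fromRel fun a b => dist (x a) (x b) ≤ s with hG
  have hadj : ∀ {a b}, G.Adj a b ↔ a ≠ b ∧ dist (x a) (x b) ≤ s := by
    intro a b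
    simp [hG, SimpleGraph.fromRel_adj, dist_comm (x b) (x a)]
  by_cases hr : ∀ a, G.Reachable a a₀
  · left
    -- the parent of `a` is the next vertex on a shortest path to `a₀`
    have hpar : ∀ a, ∃ b, a ≠ a₀ → dist (x a) (x b) ≤ s ∧ G.dist b a₀ < G.dist a a₀ := by
      intro a
      by_cases ha : a = a₀
      · exact ⟨a, fun h => absurd ha h⟩
      obtain ⟨p, hp⟩ := (hr a).exists_walk_length_eq_dist
      cases p with
      | nil => exact absurd rfl ha
      | @cons _ b _ h q =>
        refine ⟨b, fun _ => ⟨(hadj.1 h).2, ?_⟩⟩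
        rw [← hp, SimpleGraph.Walk.length_cons]
        exact Nat.lt_succ_of_le (SimpleGraph.dist_le q)
    choose par hpar using hpar
    exact ⟨par, ⟨fun a => G.dist a a₀, fun a ha => (hpar a ha).2⟩, fun a ha => (hpar a ha).1⟩
  · right
    push Not at hr
    obtain ⟨a, ha⟩ := hr
    refine ⟨fun b => decide (G.Reachable b a₀), ⟨a₀, a, by simp [ha]⟩, fun b c hbc => ?_⟩
    by_contra! hle
    have hbc' : G.Reachable b c := by
      by_cases h : b = c
      · rw [h]
      · exact (hadj.2 ⟨h, hle⟩).reachable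
    refine hbc ?_
    simp only [decide_eq_decide]
    exact ⟨fun h => hbc'.symm.trans h, fun h => hbc'.trans h⟩

variable [Fintype κ]

/-- The number of trees with root `a₀` that have no edge longer than `s`. The value of a parent
map at the root is arbitrary, and a tree is counted once for each choice of this value. -/
def treeCount (a₀ : κ) (s : ℝ) (x : κ → S) : ℝ≥0∞ :=
  ∑ par : κ → κ with IsParentMap a₀ par, treeIndicator par s (Finset.univ.erase a₀) x

theorem one_le_treeCount_or_exists_color (x : κ → S) (s : ℝ) (a₀ : κ) :
    1 ≤ treeCount a₀ s x ∨
      ∃ col : κ → Bool, (∃ a b, col a ≠ col b) ∧ ∀ a b, col a ≠ col b → s < dist (x a) (x b) := by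
  refine (exists_isParentMap_or_exists_color x s a₀).imp_left ?_
  rintro ⟨par, hpar, h⟩
  calc (1 : ℝ≥0∞) = treeIndicator par s (Finset.univ.erase a₀) x := by
        refine (Finset.prod_eq_one fun a ha => ?_).symm
        rw [if_pos (h a (Finset.ne_of_mem_erase ha))]
    _ ≤ _ := Finset.single_le_sum
        (f := fun par => treeIndicator par s (Finset.univ.erase a₀) x) (fun _ _ => zero_le)
        (Finset.mem_filter.2 ⟨Finset.mem_univ _, hpar⟩)

/-- Finitely many points are connected at all large scales. -/
theorem exists_one_le_treeCount (x : κ → S) (a₀ : κ) :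
    ∃ s₀, ∀ s, s₀ ≤ s → 1 ≤ treeCount a₀ s x := by
  refine ⟨∑ a, ∑ b, dist (x a) (x b), fun s hs => ?_⟩
  refine (one_le_treeCount_or_exists_color x s a₀).resolve_right ?_
  rintro ⟨col, ⟨a, b, hab⟩, h⟩
  refine absurd (h a b hab) (not_lt.2 (le_trans ?_ hs))
  calc dist (x a) (x b) ≤ ∑ b, dist (x a) (x b) :=
        Finset.single_le_sum (f := fun b => dist (x a) (x b)) (fun _ _ => dist_nonneg)
          (Finset.mem_univ b)
    _ ≤ _ := Finset.single_le_sum (f := fun a => ∑ b, dist (x a) (x b))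
        (fun _ _ => Finset.sum_nonneg fun _ _ => dist_nonneg) (Finset.mem_univ a)

variable [MeasurableSpace S] [OpensMeasurableSpace S] [SecondCountableTopology S]

omit [Fintype κ] in
theorem measurable_treeIndicator (par : κ → κ) (s : ℝ) (T : Finset κ) :
    Measurable (treeIndicator (S := S) par s T) := by
  refine Finset.measurable_fun_prod _ fun a _ => Measurable.ite ?_ measurable_const measurable_const
  exact measurableSet_le ((measurable_pi_apply a).dist (measurable_pi_apply (par a)))
    measurable_const

theorem measurable_treeCount (a₀ : κ) (s : ℝ) : Measurable (treeCount (S := S) a₀ s) :=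
  Finset.measurable_fun_sum _ fun _ _ => measurable_treeIndicator _ _ _

variable (μ : Measure S) [SigmaFinite μ]

omit [Fintype κ] in
/-- The leaves are integrated out one by one. -/
theorem lmarginal_treeIndicator_le {a₀ : κ} {par : κ → κ} (hpar : IsParentMap a₀ par) {s : ℝ}
    {V : ℝ≥0∞} (hV : ∀ y, μ (Metric.closedBall y s) ≤ V) (T : Finset κ) (hT : a₀ ∉ T) (x : κ → S) :
    (∫⋯∫⁻_T, treeIndicator par s T ∂fun _ => μ) x ≤ V ^ T.card := by
  obtain ⟨rank, hrank⟩ := hpar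
  induction T using Finset.induction_on_max_value rank generalizing x with
  | empty => simp [treeIndicator]
  | insert a T haT hmax ih =>
    have ha : a ≠ a₀ := fun h => hT (h ▸ Finset.mem_insert_self _ _)
    have hT' : a₀ ∉ T := fun h => hT (Finset.mem_insert_of_mem h)
    rw [lmarginal_insert' _ (measurable_treeIndicator _ _ _) haT]
    have hle : ∀ x : κ → S,
        ∫⁻ y, treeIndicator par s (insert a T) (Function.update x a y) ∂μ ≤
          V * treeIndicator par s T x := by
      intro x
      have hpa : par a ≠ a := fun h => (hrank a ha).ne (by rw [h])
      have hfac : ∀ y, treeIndicator par s (insert a T) (Function.update x a y) =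
          (Metric.closedBall (x (par a)) s).indicator 1 y * treeIndicator par s T x := by
        intro y
        rw [treeIndicator, Finset.prod_insert haT]
        congr 1
        · simp [hpa, indicator_apply]
        · refine Finset.prod_congr rfl fun b hb => ?_
          have hba : b ≠ a := fun h => haT (h ▸ hb)
          -- `a` has maximal rank and so it is not the parent of `b`
          have hpb : par b ≠ a := fun h => by
            have h1 := hrank b fun h => hT' (h ▸ hb)
            rw [h] at h1
            exact absurd (hmax b hb) (not_le.2 h1)
          rw [Function.update_of_ne hba, Function.update_of_ne hpb]
      simp only [hfac]
      rw [lintegral_mul_const _ (measurable_one.indicator Metric.isClosed_closedBall.measurableSet),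
        lintegral_indicator_one Metric.isClosed_closedBall.measurableSet]
      gcongr
      exact hV _
    calc _ ≤ (∫⋯∫⁻_T, (fun x => V * treeIndicator par s T x) ∂fun _ => μ) x :=
          lmarginal_mono hle x
      _ = V * (∫⋯∫⁻_T, treeIndicator par s T ∂fun _ => μ) x := by
          simp only [lmarginal]
          exact lintegral_const_mul V ((measurable_treeIndicator par s T).comp
            measurable_updateFinset)
      _ ≤ V * V ^ T.card := by gcongr; exact ih hT' x
      _ = _ := by rw [Finset.card_insert_of_notMem haT, pow_succ']

/-- Tuples of points that are connected at the scale `s` are rare. -/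
theorem lintegral_treeCount_le (a₀ : κ) {s : ℝ} {V : ℝ≥0∞}
    (hV : ∀ y, μ (Metric.closedBall y s) ≤ V) :
    ∫⁻ x, treeCount a₀ s x ∂(Measure.pi fun _ : κ => μ) ≤
      (Fintype.card κ : ℝ≥0∞) ^ Fintype.card κ * (μ univ * V ^ (Fintype.card κ - 1)) := by
  have hone : ∀ par : κ → κ, IsParentMap a₀ par →
      ∫⁻ x, treeIndicator par s (Finset.univ.erase a₀) x ∂(Measure.pi fun _ : κ => μ) ≤
        μ univ * V ^ (Fintype.card κ - 1) := by
    intro par hpar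
    by_cases hS : Nonempty S
    swap
    · have : IsEmpty (κ → S) := ⟨fun x => hS ⟨x a₀⟩⟩
      simp
    obtain ⟨z⟩ := hS
    rw [lintegral_eq_lmarginal_univ fun _ => z, ← Finset.insert_erase (Finset.mem_univ a₀),
      lmarginal_insert _ (measurable_treeIndicator _ _ _) (Finset.notMem_erase _ _),
      Finset.insert_erase (Finset.mem_univ a₀)]
    calc _ ≤ ∫⁻ _ : S, V ^ (Finset.univ.erase a₀).card ∂μ := lintegral_mono fun y =>
          lmarginal_treeIndicator_le μ hpar hV _ (Finset.notMem_erase _ _) _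
      _ = _ := by
          rw [lintegral_const, mul_comm, Finset.card_erase_of_mem (Finset.mem_univ _),
            Finset.card_univ]
  unfold treeCount
  rw [lintegral_finsetSum _ fun _ _ => measurable_treeIndicator _ _ _]
  calc _ ≤ ∑ par : κ → κ with IsParentMap a₀ par, μ univ * V ^ (Fintype.card κ - 1) :=
        Finset.sum_le_sum fun par h => hone par (Finset.mem_filter.1 h).2
    _ ≤ ∑ _par : κ → κ, μ univ * V ^ (Fintype.card κ - 1) :=
        Finset.sum_le_sum_of_subset (Finset.filter_subset _ _)
    _ = _ := by simp

end Trees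

/-! ### The growth of the constants -/

/-- The exponential decay against a power of the scale costs a factorial. -/
theorem exp_neg_mul_add_one_pow_le {a : ℝ} (ha : 0 < a) (N m : ℕ) :
    Real.exp (-(a * m)) * ((m : ℝ) + 1) ^ N ≤
      (N ! : ℝ) * (2 / a) ^ N * Real.exp (a / 2) * Real.exp (-(a / 2)) ^ m := by
  have h := Real.pow_div_factorial_le_exp (a / 2 * ((m : ℝ) + 1)) (by positivity) N
  have h1 : ((m : ℝ) + 1) ^ N ≤ (N ! : ℝ) * (2 / a) ^ N * Real.exp (a / 2 * ((m : ℝ) + 1)) := by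
    rw [div_le_iff₀ (by positivity), mul_pow] at h
    calc ((m : ℝ) + 1) ^ N = (2 / a) ^ N * ((a / 2) ^ N * ((m : ℝ) + 1) ^ N) := by
          rw [← mul_assoc, ← mul_pow]
          field_simp
          simp
      _ ≤ (2 / a) ^ N * (Real.exp (a / 2 * ((m : ℝ) + 1)) * N !) := by gcongr
      _ = _ := by ring
  calc _ ≤ Real.exp (-(a * m)) *
        ((N ! : ℝ) * (2 / a) ^ N * Real.exp (a / 2 * ((m : ℝ) + 1))) := by gcongr
    _ = (N ! : ℝ) * (2 / a) ^ N * (Real.exp (-(a * m)) * Real.exp (a / 2 * ((m : ℝ) + 1))) := by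
        ring
    _ = (N ! : ℝ) * (2 / a) ^ N * (Real.exp (a / 2) * Real.exp (-(a / 2)) ^ m) := by
        rw [← Real.exp_add, ← Real.exp_nat_mul, ← Real.exp_add]
        congr 2
        ring
    _ = _ := by ring

theorem factorial_mul_le (d k : ℕ) :
    ((d * k)! : ℝ) ≤ (((d : ℝ) * Real.exp 1) ^ d) ^ k * (k ! : ℝ) ^ d := by
  have h1 : ((d * k)! : ℝ) ≤ ((d * k : ℕ) : ℝ) ^ (d * k) := by
    exact_mod_cast Nat.factorial_le_pow (d * k)
  calc ((d * k)! : ℝ) ≤ ((d * k : ℕ) : ℝ) ^ (d * k) := h1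
    _ = ((d : ℝ) ^ d) ^ k * ((k : ℝ) ^ k) ^ d := by
        push_cast
        rw [mul_pow, pow_mul, ← pow_mul, ← pow_mul, mul_comm k d]
    _ ≤ ((d : ℝ) ^ d) ^ k * ((k ! : ℝ) * Real.exp 1 ^ k) ^ d := by
        gcongr
        exact pow_le_factorial_mul_exp k k
    _ = _ := by
        rw [mul_pow, mul_pow, mul_pow, ← pow_mul (Real.exp 1), ← pow_mul (Real.exp 1),
          mul_comm d k]
        ring

theorem inv_factorial_mul_pow_le (j : ℕ) : ((j ! : ℝ))⁻¹ * (j : ℝ) ^ j ≤ Real.exp 1 ^ j := by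
  rw [inv_mul_le_iff₀ (by positivity)]
  exact pow_le_factorial_mul_exp j j

theorem card_surjections_le (k j : ℕ) :
    ((surjections (Fin k) j).card : ℝ) ≤ (k ! : ℝ) * Real.exp 1 ^ j := by
  refine le_trans ?_ (pow_le_factorial_mul_exp j k)
  have := Finset.card_le_univ (surjections (Fin k) j)
  rw [Fintype.card_fun, Fintype.card_fin, Fintype.card_fin] at this
  exact_mod_cast this

/-- The sum over all ways in which the `k` points can coincide. -/
theorem sum_surjections_le {d k : ℕ} (hk : k ≠ 0) {lam G : ℝ} (hlam : 0 ≤ lam) (hG : 0 ≤ G)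
    (I : (j : ℕ) → (Fin k → Fin j) → ℝ)
    (hI : ∀ j, 1 ≤ j → j ≤ k → ∀ f : Fin k → Fin j, Function.Surjective f →
      I j f ≤ (k ! : ℝ) ^ (d + 1) * (j : ℝ) ^ j * G ^ k * lam) :
    ∑ j ∈ Finset.range (k + 1), ∑ f ∈ surjections (Fin k) j, (j ! : ℝ)⁻¹ * I j f ≤
      (2 * Real.exp 1 ^ 2 * G) ^ k * (k ! : ℝ) ^ (d + 2) * lam := by
  have he : (1 : ℝ) ≤ Real.exp 1 := Real.one_le_exp zero_le_one
  have hone : ∀ j ∈ Finset.range (k + 1), ∑ f ∈ surjections (Fin k) j, (j ! : ℝ)⁻¹ * I j f ≤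
      (Real.exp 1 ^ 2 * G) ^ k * (k ! : ℝ) ^ (d + 2) * lam := by
    intro j hj
    have hjk : j ≤ k := Nat.lt_succ_iff.1 (Finset.mem_range.1 hj)
    rcases Nat.eq_zero_or_pos j with rfl | hj0
    · have : surjections (Fin k) 0 = ∅ := by
        refine Finset.eq_empty_of_forall_notMem fun f _ => ?_
        exact (f ⟨0, Nat.pos_of_ne_zero hk⟩).elim0
      rw [this, Finset.sum_empty]
      positivity
    calc _ ≤ (surjections (Fin k) j).card •
          (Real.exp 1 ^ k * ((k ! : ℝ) ^ (d + 1) * G ^ k * lam)) := by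
          refine Finset.sum_le_card_nsmul _ _ _ fun f hf => ?_
          have hf' : Function.Surjective f := by simpa [surjections] using hf
          calc _ ≤ (j ! : ℝ)⁻¹ * ((k ! : ℝ) ^ (d + 1) * (j : ℝ) ^ j * G ^ k * lam) := by
                gcongr
                exact hI j hj0 hjk f hf'
            _ = ((j ! : ℝ)⁻¹ * (j : ℝ) ^ j) * ((k ! : ℝ) ^ (d + 1) * G ^ k * lam) := by ring
            _ ≤ Real.exp 1 ^ j * ((k ! : ℝ) ^ (d + 1) * G ^ k * lam) := by
                gcongr
                exact inv_factorial_mul_pow_le j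
            _ ≤ _ := by gcongr
      _ ≤ ((k ! : ℝ) * Real.exp 1 ^ k) *
          (Real.exp 1 ^ k * ((k ! : ℝ) ^ (d + 1) * G ^ k * lam)) := by
          rw [nsmul_eq_mul]
          gcongr
          refine (card_surjections_le k j).trans ?_
          gcongr
      _ = _ := by ring
  calc _ ≤ (Finset.range (k + 1)).card • ((Real.exp 1 ^ 2 * G) ^ k * (k ! : ℝ) ^ (d + 2) * lam) :=
        Finset.sum_le_card_nsmul _ _ _ hone
    _ ≤ 2 ^ k * ((Real.exp 1 ^ 2 * G) ^ k * (k ! : ℝ) ^ (d + 2) * lam) := by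
        rw [nsmul_eq_mul, Finset.card_range]
        gcongr
        exact_mod_cast Nat.lt_two_pow_self
    _ = _ := by
        rw [mul_assoc 2, mul_pow 2]
        ring

/-! ### The total mass of the cumulant density -/

section Mass

open scoped Classical

variable {d : ℕ} {M : Type*} [MeasurableSpace M] (μ : Measure (Space d)) [IsFiniteMeasure μ]
  [NullSingletonClass μ] (Q : Measure M) [IsProbabilityMeasure Q] {Ξ : Functional d M}
  {lam C L B γ : ℝ}

omit [NullSingletonClass μ] in
/-- The locations and the marks of the points can be integrated one after the other. -/
theorem lintegral_pi_prod {κ : Type} [Fintype κ] {g : (κ → MPoint d M) → ℝ≥0∞}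
    (hg : AEMeasurable g (Measure.pi fun _ => μ.prod Q)) :
    ∫⁻ y, g y ∂(Measure.pi fun _ => μ.prod Q) =
      ∫⁻ x, ∫⁻ t, g (fun a => (x a, t a)) ∂(Measure.pi fun _ => Q) ∂(Measure.pi fun _ => μ) := by
  have h := (measurePreserving_arrowProdEquivProdArrow (Space d) M κ (fun _ => μ)
    fun _ => Q).symm
  rw [← h.lintegral_comp_emb (MeasurableEquiv.measurableEmbedding _), lintegral_prod]
  · rfl
  · exact hg.comp_quasiMeasurePreserving h.quasiMeasurePreserving

/-- If the points are connected at the scale `2 ℓ (m + 1)`, but not at the scale `2 ℓ m`, then they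
fall into two groups at distance larger than `2 ℓ m`. -/
theorem lintegral_cumulantDensity_le_tsum (hΞ : Ξ.IsMeasurable) (hlam : 0 < lam) (hC : 1 ≤ C)
    (hst : StabilizingAt μ Q Ξ lam L B γ) (hL : 0 ≤ L) (hB : 1 ≤ B) {ℓ : ℝ} (hℓ : 0 < ℓ)
    {κ : Type} [Fintype κ] (a₀ : κ) {x : κ → Space d} (hx : Function.Injective x)
    {k : ℕ} {f : Fin k → κ} (hf : Function.Surjective f) :
    ∫⁻ t, ENNReal.ofReal |cumulantDensity (μ.prod Q) (truncatedScore Ξ lam C)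
        (fun i => (x (f i), t (f i))) Finset.univ| ∂(Measure.pi fun _ => Q) ≤
      ENNReal.ofReal ((k ! : ℝ) * (6 * C * C) ^ k *
          (1 + 6 * (Fintype.card κ * (L * B ^ Fintype.card κ)))) *
        ∑' m : ℕ, ENNReal.ofReal (Real.exp (-(γ * ℓ * m))) *
          treeCount a₀ (2 * (ℓ * ((m : ℝ) + 1))) x := by
  set J : ℝ := Fintype.card κ * (L * B ^ Fintype.card κ) with hJ
  have hJ0 : 0 ≤ J := by positivity
  have hconn : ∃ m : ℕ, 1 ≤ treeCount a₀ (2 * (ℓ * ((m : ℝ) + 1))) x := by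
    obtain ⟨s₀, hs₀⟩ := exists_one_le_treeCount x a₀
    obtain ⟨m, hm⟩ := exists_nat_ge (s₀ / (2 * ℓ))
    refine ⟨m, hs₀ _ ?_⟩
    rw [div_le_iff₀ (by positivity)] at hm
    nlinarith
  have hone : ∀ m : ℕ, 1 ≤ treeCount a₀ (2 * (ℓ * ((m : ℝ) + 1))) x →
      ENNReal.ofReal (Real.exp (-(γ * ℓ * m))) ≤
        ∑' m : ℕ, ENNReal.ofReal (Real.exp (-(γ * ℓ * m))) *
          treeCount a₀ (2 * (ℓ * ((m : ℝ) + 1))) x := fun m hm =>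
    (le_mul_of_one_le_right' hm).trans (ENNReal.le_tsum (f := fun m : ℕ =>
      ENNReal.ofReal (Real.exp (-(γ * ℓ * m))) * treeCount a₀ (2 * (ℓ * ((m : ℝ) + 1))) x) m)
  -- compare with the term of the smallest `m` for which the points are connected
  have hm := Nat.find_spec hconn
  refine le_trans ?_ (mul_le_mul_right (hone _ hm) _)
  rw [← ENNReal.ofReal_mul (by positivity)]
  rcases hn : Nat.find hconn with _ | n
  · -- the points are connected at the smallest scale
    refine (lintegral_mono fun t => ENNReal.ofReal_le_ofReal
      (abs_cumulantDensity_le (μ.prod Q) hC (abs_truncatedScore_le (zero_le_one.trans hC)) _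
        Finset.univ)).trans ?_
    rw [lintegral_const, measure_univ, mul_one, Finset.card_univ, Fintype.card_fin]
    refine ENNReal.ofReal_le_ofReal ?_
    rw [Nat.cast_zero, mul_zero, neg_zero, Real.exp_zero, mul_one, mul_assoc, ← mul_pow]
    have h3 : (3 * C) ^ k ≤ (6 * C * C) ^ k := by
      gcongr
      nlinarith
    calc (k ! : ℝ) * (3 * C) ^ k ≤ (k ! : ℝ) * (6 * C * C) ^ k := by gcongr
      _ ≤ _ := le_mul_of_one_le_right (by positivity) (by linarith)
  · have hnot := Nat.find_min hconn (m := n) (by omega)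
    obtain ⟨col, ⟨a, b, hab⟩, hcol⟩ :=
      (one_le_treeCount_or_exists_color x (2 * (ℓ * ((n : ℝ) + 1))) a₀).resolve_left hnot
    obtain ⟨i, rfl⟩ := hf a
    obtain ⟨i', rfl⟩ := hf b
    refine (lintegral_cumulantDensity_le μ Q hΞ hlam hC hst hL hB hx col
      (r := ℓ * ((n : ℝ) + 1)) (by positivity) hcol f ⟨i, i', hab⟩).trans ?_
    refine ENNReal.ofReal_le_ofReal ?_
    rw [Fintype.card_fin]
    have he : Real.exp (-(γ * (ℓ * ((n : ℝ) + 1)))) = Real.exp (-(γ * ℓ * ((n + 1 : ℕ) : ℝ))) := by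
      push_cast
      congr 1
      ring
    rw [he]
    set e := Real.exp (-(γ * ℓ * ((n + 1 : ℕ) : ℝ)))
    calc _ = (k ! : ℝ) * (6 * C * C) ^ k * (6 * J) * e := by rw [hJ]; ring
      _ ≤ _ := by
          gcongr
          linarith

/-- The total mass of the cumulant density for one pattern of coincidences, if balls of radius
`2 ℓ (m + 1)` have measure at most `W (m + 1) ^ d`. -/
theorem integral_abs_cumulantDensity_le (hΞ : Ξ.IsMeasurable) (hlam : 0 < lam) (hC : 1 ≤ C)
    (hst : StabilizingAt μ Q Ξ lam L B γ) (hL : 0 ≤ L) (hB : 1 ≤ B) {ℓ : ℝ} (hℓ : 0 < ℓ)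
    (hγ : 0 < γ) {W : ℝ} (hW : 1 ≤ W)
    (hball : ∀ (m : ℕ) y, μ (Metric.closedBall y (2 * (ℓ * ((m : ℝ) + 1)))) ≤
      ENNReal.ofReal (W * ((m : ℝ) + 1) ^ d))
    {k j : ℕ} (hj : 1 ≤ j) (hjk : j ≤ k) {f : Fin k → Fin j} (hf : Function.Surjective f) :
    ∫ y : Fin j → MPoint d M, |cumulantDensity (μ.prod Q) (truncatedScore Ξ lam C) (y ∘ f)
        Finset.univ| ∂(Measure.pi fun _ => μ.prod Q) ≤
      (k ! : ℝ) ^ (d + 1) * (j : ℝ) ^ j *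
        ((1 + 6 * L) * (Real.exp (γ * ℓ / 2) * (1 - Real.exp (-(γ * ℓ / 2)))⁻¹) *
          (6 * C * C * (2 * B) * W * (((d : ℝ) * Real.exp 1) ^ d * max 1 (2 / (γ * ℓ)) ^ d))) ^ k *
        (μ univ).toReal := by
  set α := γ * ℓ with hα
  have hα0 : 0 < α := by positivity
  set D : (Fin j → MPoint d M) → ℝ := fun y =>
    cumulantDensity (μ.prod Q) (truncatedScore Ξ lam C) (y ∘ f) Finset.univ with hD
  have hDm : AEStronglyMeasurable D (Measure.pi fun _ => μ.prod Q) :=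
    aestronglyMeasurable_cumulantDensity (diffuse_prod μ Q)
      (scoreMeasurable_truncatedScore μ Q hΞ hlam C) f Finset.univ
  set A : ℝ := (k ! : ℝ) * (6 * C * C) ^ k * (1 + 6 * (j * (L * B ^ j))) with hA
  have hA0 : 0 ≤ A := by positivity
  set q := Real.exp (-(α / 2)) with hq
  have hq1 : q < 1 := by rw [hq, Real.exp_lt_one_iff]; linarith
  have hq0 : 0 ≤ q := (Real.exp_pos _).le
  set H : ℝ := (1 - q)⁻¹ with hH
  have hH1 : 1 ≤ H := (one_le_inv₀ (by linarith)).2 (by linarith)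
  set β : ℝ := max 1 (2 / α) with hβ
  have hβ1 : 1 ≤ β := le_max_left _ _
  set N := d * (j - 1) with hN
  have hNk : N ≤ d * k := Nat.mul_le_mul_left d (by omega)
  set P : ℝ := ((d * k)! : ℝ) * β ^ (d * k) * Real.exp (α / 2) with hP
  have hP0 : 0 ≤ P := by positivity
  have hterm : ∀ m : ℕ, Real.exp (-(α * m)) * (W * ((m : ℝ) + 1) ^ d) ^ (j - 1) ≤
      W ^ k * P * q ^ m := by
    intro m
    calc _ = W ^ (j - 1) * (Real.exp (-(α * m)) * ((m : ℝ) + 1) ^ N) := by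
          rw [mul_pow, ← pow_mul]
          ring
      _ ≤ W ^ k * ((N ! : ℝ) * (2 / α) ^ N * Real.exp (α / 2) * q ^ m) := by
          refine mul_le_mul (pow_le_pow_right₀ hW (by omega))
            (exp_neg_mul_add_one_pow_le hα0 N m) (by positivity) (by positivity)
      _ ≤ W ^ k * (((d * k)! : ℝ) * β ^ (d * k) * Real.exp (α / 2) * q ^ m) := by
          have h1 : (N ! : ℝ) ≤ ((d * k)! : ℝ) := by exact_mod_cast Nat.factorial_le hNk
          have h2 : (2 / α) ^ N ≤ β ^ (d * k) :=
            (pow_le_pow_left₀ (by positivity) (le_max_right _ _) N).trans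
              (pow_le_pow_right₀ hβ1 hNk)
          gcongr
      _ = _ := by rw [hP]; ring
  have hmass : μ univ = ENNReal.ofReal (μ univ).toReal :=
    (ENNReal.ofReal_toReal (measure_ne_top μ univ)).symm
  have key : ∫⁻ y, ENNReal.ofReal |D y| ∂(Measure.pi fun _ => μ.prod Q) ≤
      ENNReal.ofReal (A * ((j : ℝ) ^ j * (μ univ).toReal * (W ^ k * P * H))) := by
    rw [lintegral_pi_prod μ Q
      (g := fun y => ENNReal.ofReal |D y|) hDm.norm.aemeasurable.ennreal_ofReal]
    have hx := ae_injective_pi μ (Fin j)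
    calc _ ≤ ∫⁻ x, ENNReal.ofReal A * ∑' m : ℕ, ENNReal.ofReal (Real.exp (-(α * m))) *
            treeCount (⟨0, hj⟩ : Fin j) (2 * (ℓ * ((m : ℝ) + 1))) x ∂(Measure.pi fun _ => μ) := by
          refine lintegral_mono_ae ?_
          filter_upwards [hx] with x hx
          have := lintegral_cumulantDensity_le_tsum μ Q hΞ hlam hC hst hL hB hℓ
            (⟨0, hj⟩ : Fin j) hx hf
          rw [Fintype.card_fin] at this
          exact this
      _ = ENNReal.ofReal A * ∑' m : ℕ, ENNReal.ofReal (Real.exp (-(α * m))) *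
            ∫⁻ x, treeCount (⟨0, hj⟩ : Fin j) (2 * (ℓ * ((m : ℝ) + 1))) x
              ∂(Measure.pi fun _ => μ) := by
          have hm : ∀ m : ℕ, Measurable fun x : Fin j → Space d =>
              ENNReal.ofReal (Real.exp (-(α * m))) *
                treeCount (⟨0, hj⟩ : Fin j) (2 * (ℓ * ((m : ℝ) + 1))) x := fun m =>
            (measurable_treeCount _ _).const_mul _
          rw [lintegral_const_mul _ (Measurable.tsum hm),
            lintegral_tsum fun m => (hm m).aemeasurable]
          congr 2
          ext1 m
          rw [lintegral_const_mul _ (measurable_treeCount _ _)]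
      _ ≤ ENNReal.ofReal A * ∑' m : ℕ, ENNReal.ofReal (Real.exp (-(α * m))) *
            ((j : ℝ≥0∞) ^ j * (μ univ * ENNReal.ofReal (W * ((m : ℝ) + 1) ^ d) ^ (j - 1))) := by
          gcongr with m
          have := lintegral_treeCount_le μ (⟨0, hj⟩ : Fin j) (hball m)
          rwa [Fintype.card_fin] at this
      _ = ENNReal.ofReal A * ((j : ℝ≥0∞) ^ j * μ univ *
            ∑' m : ℕ,
              ENNReal.ofReal (Real.exp (-(α * m)) * (W * ((m : ℝ) + 1) ^ d) ^ (j - 1))) := by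
          congr 1
          rw [← ENNReal.tsum_mul_left]
          refine tsum_congr fun m => ?_
          rw [ENNReal.ofReal_mul (Real.exp_pos _).le, ENNReal.ofReal_pow (by positivity)]
          ring
      _ ≤ ENNReal.ofReal A * ((j : ℝ≥0∞) ^ j * μ univ *
            ∑' m : ℕ, ENNReal.ofReal (W ^ k * P * q ^ m)) := by
          gcongr ENNReal.ofReal A * (_ * ∑' m : ℕ, ENNReal.ofReal ?_) with m
          exact hterm m
      _ = _ := by
          rw [← ENNReal.ofReal_tsum_of_nonneg (fun m => by positivity)
            ((summable_geometric_of_lt_one hq0 hq1).mul_left _), tsum_mul_left,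
            tsum_geometric_of_lt_one hq0 hq1, ← hH, ENNReal.ofReal_mul (p := A) hA0,
            ENNReal.ofReal_mul (p := (j : ℝ) ^ j * _) (by positivity),
            ENNReal.ofReal_mul (p := (j : ℝ) ^ j) (by positivity),
            ENNReal.ofReal_pow (by positivity), ENNReal.ofReal_natCast, ← hmass]
  have hreal : ∫ y, |D y| ∂(Measure.pi fun _ => μ.prod Q) ≤
      A * ((j : ℝ) ^ j * (μ univ).toReal * (W ^ k * P * H)) := by
    rw [integral_eq_lintegral_of_nonneg_ae (Filter.Eventually.of_forall fun y => abs_nonneg _)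
      hDm.norm]
    refine ENNReal.toReal_le_of_le_ofReal ?_ key
    have : 0 ≤ H := zero_le_one.trans hH1
    positivity
  refine hreal.trans ?_
  have hj2 : (j : ℝ) ≤ 2 ^ k := by
    have h1 : (j : ℝ) ≤ 2 ^ j := by exact_mod_cast Nat.lt_two_pow_self.le
    exact h1.trans (pow_le_pow_right₀ (by norm_num) hjk)
  have hBk : B ^ j ≤ B ^ k := pow_le_pow_right₀ hB hjk
  have hA' : A ≤ (k ! : ℝ) * (6 * C * C) ^ k * ((1 + 6 * L) * (2 * B) ^ k) := by
    rw [hA]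
    gcongr
    have h1 : (1 : ℝ) ≤ (2 * B) ^ k := one_le_pow₀ (by linarith)
    have h2 : (j : ℝ) * B ^ j ≤ (2 * B) ^ k := by
      rw [mul_pow]
      gcongr
    nlinarith [mul_le_mul_of_nonneg_left h2 hL]
  have hP' : P ≤ ((((d : ℝ) * Real.exp 1) ^ d) ^ k * (k ! : ℝ) ^ d) * β ^ (d * k) *
      Real.exp (α / 2) := by
    rw [hP]
    gcongr
    exact factorial_mul_le d k
  set X : ℝ := (1 + 6 * L) * (Real.exp (α / 2) * H) with hX
  have hX1 : 1 ≤ X := by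
    have h1 : 1 ≤ Real.exp (α / 2) := Real.one_le_exp (by positivity)
    exact one_le_mul_of_one_le_of_one_le (by linarith) (one_le_mul_of_one_le_of_one_le h1 hH1)
  have hXk : X ≤ X ^ k := le_self_pow₀ hX1 (by omega)
  have hH0 : 0 ≤ H := zero_le_one.trans hH1
  set Y : ℝ := 6 * C * C * (2 * B) * W * (((d : ℝ) * Real.exp 1) ^ d * β ^ d) with hY
  have hY0 : 0 ≤ Y := by positivity
  have hYk : Y ^ k = (6 * C * C) ^ k * (2 * B) ^ k * W ^ k *
      ((((d : ℝ) * Real.exp 1) ^ d) ^ k * β ^ (d * k)) := by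
    rw [hY, mul_pow, mul_pow, mul_pow, mul_pow _ (β ^ d), ← pow_mul β]
  calc _ ≤ ((k ! : ℝ) * (6 * C * C) ^ k * ((1 + 6 * L) * (2 * B) ^ k)) *
        ((j : ℝ) ^ j * (μ univ).toReal * (W ^ k * (((((d : ℝ) * Real.exp 1) ^ d) ^ k *
          (k ! : ℝ) ^ d) * β ^ (d * k) * Real.exp (α / 2)) * H)) := by gcongr
    _ = (k ! : ℝ) ^ (d + 1) * (j : ℝ) ^ j * (X * Y ^ k) * (μ univ).toReal := by
        rw [hYk, hX]
        ring
    _ ≤ (k ! : ℝ) ^ (d + 1) * (j : ℝ) ^ j * (X ^ k * Y ^ k) * (μ univ).toReal := by gcongr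
    _ = _ := by rw [mul_pow X Y]

omit [NullSingletonClass μ] in
/-- A bound without stabilization, for small intensities. -/
theorem integral_abs_cumulantDensity_le_of_mass_le (hC : 1 ≤ C) {lam₀ : ℝ}
    (hmass : (μ univ).toReal ≤ lam₀) {k j : ℕ} (hj : 1 ≤ j) (hjk : j ≤ k) (f : Fin k → Fin j) :
    ∫ y : Fin j → MPoint d M, |cumulantDensity (μ.prod Q) (truncatedScore Ξ lam C) (y ∘ f)
        Finset.univ| ∂(Measure.pi fun _ => μ.prod Q) ≤
      (k ! : ℝ) ^ (d + 1) * (j : ℝ) ^ j * (3 * C * max 1 lam₀) ^ k * (μ univ).toReal := by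
  set R := (μ univ).toReal
  have hR0 : 0 ≤ R := ENNReal.toReal_nonneg
  have hR : R ≤ max 1 lam₀ := hmass.trans (le_max_right _ _)
  have hbd : ∀ y : Fin j → MPoint d M, |cumulantDensity (μ.prod Q) (truncatedScore Ξ lam C) (y ∘ f)
      Finset.univ| ≤ (k ! : ℝ) * (3 * C) ^ k := fun y => by
    have := abs_cumulantDensity_le (μ.prod Q) hC
      (abs_truncatedScore_le (Ξ := Ξ) (lam := lam) (zero_le_one.trans hC)) (y ∘ f) Finset.univ
    rwa [Finset.card_univ, Fintype.card_fin, mul_assoc, ← mul_pow] at this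
  have h1 : ∫ y : Fin j → MPoint d M, |cumulantDensity (μ.prod Q) (truncatedScore Ξ lam C) (y ∘ f)
        Finset.univ| ∂(Measure.pi fun _ => μ.prod Q) ≤ (k ! : ℝ) * (3 * C) ^ k * R ^ j := by
    refine (integral_mono_of_nonneg (Filter.Eventually.of_forall fun y => abs_nonneg _)
      (integrable_const ((k ! : ℝ) * (3 * C) ^ k))
      (Filter.Eventually.of_forall hbd)).trans_eq ?_
    rw [integral_const, real_pi_univ, Fintype.card_fin, smul_eq_mul, mul_comm, Measure.real,
      ← univ_prod_univ, Measure.prod_prod, measure_univ (μ := Q), mul_one]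
  refine h1.trans ?_
  have h2 : R ^ j ≤ max 1 lam₀ ^ k * R := by
    obtain ⟨i, rfl⟩ : ∃ i, j = i + 1 := ⟨j - 1, by omega⟩
    rw [pow_succ]
    gcongr
    exact (pow_le_pow_left₀ hR0 hR i).trans (pow_le_pow_right₀ (le_max_left _ _) (by omega))
  have h3 : (1 : ℝ) ≤ (k ! : ℝ) := by exact_mod_cast Nat.factorial_pos k
  have h4 : (k ! : ℝ) ≤ (k ! : ℝ) ^ (d + 1) := le_self_pow₀ h3 (by omega)
  have h5 : (1 : ℝ) ≤ (j : ℝ) ^ j := one_le_pow₀ (by exact_mod_cast hj)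
  calc _ ≤ (k ! : ℝ) ^ (d + 1) * (3 * C) ^ k * (max 1 lam₀ ^ k * R) := by gcongr
    _ = (k ! : ℝ) ^ (d + 1) * 1 * (3 * C * max 1 lam₀) ^ k * R := by
        rw [mul_pow _ (max 1 lam₀)]
        ring
    _ ≤ _ := by gcongr

end Mass

/-! ### The intensity measure -/

section Intensity

variable {d : ℕ} {κ : Space d → ℝ}

/-- The measure with density `lam * κ`. -/
abbrev intensity (κ : Space d → ℝ) (lam : ℝ) : Measure (Space d) :=
  volume.withDensity fun x : Space d => ENNReal.ofReal (lam * κ x)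

theorem intensity_univ (hκ : IsGoodDensity κ) {lam : ℝ} (hlam : 0 ≤ lam) :
    intensity κ lam univ = ENNReal.ofReal lam := by
  rw [intensity, withDensity_apply _ MeasurableSet.univ, setLIntegral_univ]
  simp only [ENNReal.ofReal_mul hlam]
  rw [lintegral_const_mul _ hκ.measurable.ennreal_ofReal, hκ.lintegral_eq_one, mul_one]

theorem nullSingletonClass_intensity (hd : 1 ≤ d) (κ : Space d → ℝ) (lam : ℝ) :
    NullSingletonClass (intensity κ lam) := by
  have : Nonempty (Fin d) := ⟨⟨0, hd⟩⟩
  have : Nontrivial (Space d) := inferInstance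
  exact ⟨fun x => withDensity_absolutelyContinuous _ _ (measure_singleton x)⟩

/-- The balls whose radius is of the order of `lam^{-1/d}` contain a bounded number of points in the
mean. -/
theorem exists_intensity_closedBall_le (hd : 1 ≤ d) (hκ : IsGoodDensity κ) :
    ∃ W : ℝ, 1 ≤ W ∧ ∀ lam : ℝ, 0 < lam → ∀ (m : ℕ) (y : Space d),
      intensity κ lam (Metric.closedBall y (2 * ((lam ^ (1 / (d : ℝ)))⁻¹ * ((m : ℝ) + 1)))) ≤
        ENNReal.ofReal (W * ((m : ℝ) + 1) ^ d) := by
  obtain ⟨K, hK⟩ := hκ.bounded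
  set V := volume.real (Metric.closedBall (0 : Space d) 1) with hV
  have hK0 : 0 ≤ K := (hκ.nonneg 0).trans (hK 0)
  refine ⟨max 1 (K * 2 ^ d * V), le_max_left _ _, fun lam hlam m y => ?_⟩
  set u := lam ^ (1 / (d : ℝ)) with hu
  have hu0 : 0 < u := Real.rpow_pos_of_pos hlam _
  have hud : u ^ d = lam := by
    rw [hu, ← Real.rpow_natCast, ← Real.rpow_mul hlam.le, one_div,
      inv_mul_cancel₀ (by positivity), Real.rpow_one]
  set r := 2 * (u⁻¹ * ((m : ℝ) + 1)) with hr
  have hr0 : 0 ≤ r := by positivity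
  calc intensity κ lam (Metric.closedBall y r)
      ≤ ∫⁻ _ in Metric.closedBall y r, ENNReal.ofReal (lam * K) := by
        rw [intensity, withDensity_apply _ Metric.isClosed_closedBall.measurableSet]
        refine lintegral_mono fun x => ENNReal.ofReal_le_ofReal ?_
        gcongr
        exact hK x
    _ = ENNReal.ofReal (lam * K) * (ENNReal.ofReal (r ^ d) * ENNReal.ofReal V) := by
        rw [lintegral_const, Measure.restrict_apply_univ,
          Measure.addHaar_closedBall' volume y hr0, finrank_euclideanSpace_fin, hV,
          Measure.real, ENNReal.ofReal_toReal measure_closedBall_lt_top.ne]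
    _ = ENNReal.ofReal (lam * K * (r ^ d * V)) := by
        rw [ENNReal.ofReal_mul (p := lam * K) (by positivity),
          ENNReal.ofReal_mul (p := r ^ d) (by positivity)]
    _ ≤ _ := by
        refine ENNReal.ofReal_le_ofReal ?_
        have h1 : lam * K * (r ^ d * V) = K * 2 ^ d * V * ((m : ℝ) + 1) ^ d := by
          rw [hr, mul_pow, mul_pow, inv_pow, hud]
          field_simp
        rw [h1]
        gcongr
        exact le_max_right _ _

end Intensity

/-! ### The bound on the cumulant measures -/

section Bound

open scoped Classical

variable {d : ℕ} {M : Type*} [MeasurableSpace M] {Q : Measure M} [IsProbabilityMeasure Q]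
  {κ : Space d → ℝ} {Ξ : Functional d M}

/-- The mass of the cumulant densities grows linearly with the intensity. -/
theorem exists_integral_abs_cumulantDensity_le (hd : 1 ≤ d) (h : Assumptions κ Q Ξ) {C : ℝ}
    (hC : 1 ≤ C) :
    ∃ G : ℝ, 0 ≤ G ∧ ∀ lam : ℝ, 0 < lam → ∀ k j : ℕ, 1 ≤ j → j ≤ k → ∀ f : Fin k → Fin j,
      Function.Surjective f →
        ∫ y : Fin j → MPoint d M, |cumulantDensity ((intensity κ lam).prod Q)
            (truncatedScore Ξ lam C) (y ∘ f) Finset.univ|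
            ∂(Measure.pi fun _ => (intensity κ lam).prod Q) ≤
          (k ! : ℝ) ^ (d + 1) * (j : ℝ) ^ j * G ^ k * lam := by
  obtain ⟨L, α, B, lam₀, hL, hα, hB, hlam₀, hst⟩ := h.stabilizing
  obtain ⟨W, hW, hball⟩ := exists_intensity_closedBall_le hd h.density
  set B' := max 1 B with hB'
  set G₁ : ℝ := (1 + 6 * L) * (Real.exp (α / 2) * (1 - Real.exp (-(α / 2)))⁻¹) *
    (6 * C * C * (2 * B') * W * (((d : ℝ) * Real.exp 1) ^ d * max 1 (2 / α) ^ d)) with hG₁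
  set G₂ : ℝ := 3 * C * max 1 lam₀ with hG₂
  have hG₁0 : 0 ≤ G₁ := by
    have : Real.exp (-(α / 2)) ≤ 1 := Real.exp_le_one_iff.2 (by linarith)
    have h1 : 0 ≤ (1 - Real.exp (-(α / 2)))⁻¹ := inv_nonneg.2 (by linarith)
    have h2 : 0 ≤ B' := zero_le_one.trans (le_max_left _ _)
    have h3 : 0 ≤ max 1 (2 / α) := zero_le_one.trans (le_max_left _ _)
    positivity
  have hG₂0 : 0 ≤ G₂ := by positivity
  refine ⟨max G₁ G₂, hG₁0.trans (le_max_left _ _), fun lam hlam k j hj hjk f hf => ?_⟩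
  have hmass := intensity_univ h.density hlam.le
  have hfin : IsFiniteMeasure (intensity κ lam) := ⟨by rw [hmass]; exact ENNReal.ofReal_lt_top⟩
  have hnull := nullSingletonClass_intensity hd κ lam
  have hmass' : (intensity κ lam univ).toReal = lam := by
    rw [hmass, ENNReal.toReal_ofReal hlam.le]
  rcases le_or_gt lam₀ lam with hle | hlt
  · set u := lam ^ (1 / (d : ℝ)) with hu
    have hu0 : 0 < u := Real.rpow_pos_of_pos hlam _
    have hst' : StabilizingAt (intensity κ lam) Q Ξ lam L B' (α * u) := by
      intro Z x hx
      obtain ⟨R, hRm, hR, hRt⟩ := hst lam hle Z x hx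
      refine ⟨R, hRm, hR, fun t ht => (hRt t ht).trans ?_⟩
      gcongr
      exact le_max_right _ _
    have hαu : α * u * u⁻¹ = α := by rw [mul_assoc, mul_inv_cancel₀ hu0.ne', mul_one]
    have := integral_abs_cumulantDensity_le (intensity κ lam) Q h.measurable hlam hC hst' hL.le
      (le_max_left _ _) (inv_pos.2 hu0) (by positivity) hW (hball lam hlam) hj hjk hf
    rw [hαu, hmass'] at this
    refine this.trans ?_
    gcongr
    exact le_max_left _ _
  · have := integral_abs_cumulantDensity_le_of_mass_le (intensity κ lam) Q (Ξ := Ξ) (lam := lam) hC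
      (hmass'.trans_le hlt.le) hj hjk f
    rw [hmass'] at this
    refine this.trans ?_
    gcongr
    exact le_max_right _ _

end Bound

end Stabilizing

end

theorem mainTheorem4 {d : ℕ} (hd : 1 ≤ d) {M : Type*} [MeasurableSpace M]
    (Q : Measure M) [IsProbabilityMeasure Q]
    (κ : Stabilizing.Space d → ℝ) (Ξ : Stabilizing.Functional d M)
    (h : Stabilizing.Assumptions κ Q Ξ) :
    ∃ A B : ℝ, ∀ k : ℕ, 2 ≤ k → ∀ lam : ℝ, 0 < lam →
      ∃ c : SignedMeasure (Fin k → Stabilizing.Space d),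
        Stabilizing.IsCumulantMeasure (Stabilizing.randomMeasure (Ξ.rescale lam))
          (Stabilizing.markedPoissonLaw κ Q lam) k c ∧
        ∀ F : (Fin k → Stabilizing.Space d) → ℝ, Measurable F →
          BddAbove (range fun v => |F v|) →
            |∫ᵛ v, F v ∂•c| ≤ A * B ^ k * (⨆ v, |F v|) * (k ! : ℝ) ^ (d + 2) * lam := by
  classical
  obtain ⟨C₀, hC₀⟩ := h.bounded
  have hC : (1 : ℝ) ≤ max 1 C₀ := le_max_left _ _
  have hΞC : ∀ X, Stabilizing.IsConfig X → ∀ p ∈ X, |Ξ p X| ≤ max 1 C₀ :=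
    fun X hX p hp => (hC₀ X hX p hp).trans (le_max_right _ _)
  obtain ⟨G, hG0, hG⟩ := Stabilizing.exists_integral_abs_cumulantDensity_le hd h hC
  refine ⟨1, 2 * Real.exp 1 ^ 2 * G, fun k hk lam hlam => ?_⟩
  have hk0 : k ≠ 0 := by omega
  have hfin : IsFiniteMeasure (Stabilizing.intensity κ lam) :=
    ⟨by rw [Stabilizing.intensity_univ h.density hlam.le]; exact ENNReal.ofReal_lt_top⟩
  have hnull := Stabilizing.nullSingletonClass_intensity hd κ lam
  have hdiff := Stabilizing.diffuse_prod (Stabilizing.intensity κ lam) Q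
  have hscore := Stabilizing.scoreMeasurable_truncatedScore (Stabilizing.intensity κ lam) Q
    h.measurable hlam (max 1 C₀)
  have hbound := Stabilizing.abs_truncatedScore_le (Ξ := Ξ) (lam := lam) (zero_le_one.trans hC)
  refine ⟨_, Stabilizing.isCumulantMeasure_patternMeasure hdiff measurable_fst hscore hC hbound
    (Stabilizing.ae_randomMeasure_apply (Stabilizing.intensity κ lam) Q hlam hΞC) hk0,
    fun F _ hF => ?_⟩
  have hV := Stabilizing.sum_surjections_le (d := d) hk0 hlam.le hG0 _ (hG lam hlam k)
  refine (Stabilizing.abs_integral_patternMeasure_le _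
    (Stabilizing.tupleMeasurable_cumulantDensity hdiff hscore id Finset.univ)
    (fun x => Stabilizing.abs_cumulantDensity_le _ hC hbound x Finset.univ)
    (V := (2 * Real.exp 1 ^ 2 * G) ^ k * (k ! : ℝ) ^ (d + 2) * lam)
    (by rw [Fintype.card_fin]; exact hV)
    (Real.iSup_nonneg fun v => abs_nonneg (F v)) (fun v => le_ciSup hF v)).trans_eq ?_
  ring
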